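/- Let $\mathfrak g$ be a real Lie algebra of dimension $8$ that is not solvable, that is indecomposable (not the direct sum of two non-zero ideals), and that is Frobenius, i.e. admits a symplectic form $\omega$ (a non-degenerate skew-symmetric bilinear form with $\omega([x,y],z)+\omega([y,z],x)+\omega([z,x],y)=0$) which is exact, $\omega(x,y)=-\beta([x,y])$ for some $\beta\in\mathfrak g^*$. Then there is a basis $f_1,\dots,f_8$ of $\mathfrak g$, with dual basis $f^1,\dots,f^8$ and $f^{ij}=f^i\wedge f^j$, such that $$\omega_0=f^{15}+f^{26}+f^{37}+f^{48}$$ is an exact symplectic form on $\mathfrak g$ and the brackets $[f_i,f_j]$, $i<j$, that do not vanish are those of one of the following families. - $\mathfrak g^1_\rho$: $[f_1,f_2]=f_3$, $[f_1,f_3]=-2f_1$, $[f_2,f_3]=2f_2$, $[f_1,f_5]=-\frac12f_6+f_7-f_8$, $[f_1,f_7]=-\frac12f_6$, $[f_1,f_8]=-\frac12f_6$, $[f_2,f_5]=\frac12(-f_5+f_8)$, $[f_2,f_6]=-f_7-f_8$, $[f_2,f_7]=\frac12(f_5-f_8)$, $[f_2,f_8]=\frac12(-f_5+f_8)$, $[f_3,f_5]=-f_5-f_7+f_8$,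 $[f_3,f_6]=f_6$, $[f_3,f_7]=-f_8$, $[f_3,f_8]=-f_7$, $[f_4,f_5]=-f_5+\frac12f_6+f_7+f_8$, $[f_4,f_6]=-f_6$, $[f_4,f_7]=-\frac12f_6-f_7$, $[f_4,f_8]=\frac12f_6-f_8$. - $\mathfrak g^2_\rho$, with $\lambda\ge 0$: $[f_1,f_2]=f_3$, $[f_1,f_3]=-2f_1$, $[f_2,f_3]=2f_2$, $[f_1,f_5]=f_7-(1+\lambda)f_8$, $[f_1,f_7]=-\frac{1+\lambda}2f_6$, $[f_1,f_8]=-\frac12f_6$, $[f_2,f_6]=-f_7-(1-\lambda)f_8$, $[f_2,f_7]=\frac{1-\lambda}2f_5$, $[f_2,f_8]=-\frac12f_5$, $[f_3,f_5]=-f_5$, $[f_3,f_6]=f_6$, $[f_3,f_7]=-\lambda f_7-(1-\lambda^2)f_8$, $[f_3,f_8]=-f_7+\lambda f_8$, $[f_4,f_5]=-(1+\lambda)f_5$, $[f_4,f_6]=(\lambda-1)f_6$, $[f_4,f_7]=(\lambda^2-1)f_7+\lambda(1-\lambda^2)f_8$, $[f_4,f_8]=\lambda f_7-(1+\lambda^2)f_8$.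 - $\mathfrak g^3_\rho$: $[f_1,f_2]=f_3$, $[f_1,f_3]=-2f_1$, $[f_2,f_3]=2f_2$, $[f_1,f_5]=f_7-f_8$, $[f_1,f_7]=-3f_5$, $[f_1,f_8]=-3(f_5+f_6)$, $[f_2,f_5]=-f_7$, $[f_2,f_6]=f_7-f_8$, $[f_2,f_7]=f_5+\frac14f_6$, $[f_2,f_8]=-3f_5-\frac34f_6$, $[f_3,f_5]=-f_5-f_6$, $[f_3,f_6]=3f_6$, $[f_3,f_7]=-2f_7-f_8$, $[f_3,f_8]=-3f_7$, $[f_4,f_j]=-f_j$ for $j=5,6,7,8$. - $\mathfrak g^4_\rho$, with $\nu<0$: $[f_1,f_2]=f_3$, $[f_1,f_3]=-2f_1$, $[f_2,f_3]=2f_2$, $[f_1,f_5]=-\frac12f_6+f_7+(-1+\frac\nu2)f_8$, $[f_1,f_6]=-\frac\nu2f_6+\frac{\nu^2}2f_8$, $[f_1,f_7]=-\frac12f_6+\frac\nu2f_8$, $[f_1,f_8]=-\frac12f_6+\frac\nu2f_8$, $[f_2,f_5]=\frac12(-f_5+f_8)$, $[f_2,f_6]=-\frac\nu2f_5-f_7+(-1+\frac\nu2)f_8$,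 $[f_2,f_7]=\frac12(f_5-f_8)$, $[f_2,f_8]=\frac12(-f_5+f_8)$, $[f_3,f_5]=-f_5-f_7+f_8$, $[f_3,f_6]=f_6-\nu(f_7+f_8)$, $[f_3,f_7]=-f_8$, $[f_3,f_8]=-f_7$, $[f_4,f_5]=(-1+\frac\nu2)f_5+\frac12f_6+f_7+(1-\nu)f_8$, $[f_4,f_6]=\frac{\nu^2}2f_5+(-1+\frac\nu2)f_6-\nu f_7+\nu(1-\nu)f_8$, $[f_4,f_7]=\frac\nu2f_5-\frac12f_6-f_7$, $[f_4,f_8]=\frac\nu2f_5+\frac12f_6-(\nu+1)f_8$. - $\mathfrak g^5_\rho$, with $\mu>0$: $[f_1,f_2]=f_3$, $[f_1,f_3]=-f_2$, $[f_2,f_3]=f_1$, $[f_1,f_5]=\frac\mu4f_5-(\frac{\mu^2}4+1)f_8$, $[f_1,f_6]=\frac12f_7$, $[f_1,f_7]=-\frac12f_6$, $[f_1,f_8]=\frac14f_5-\frac\mu4f_8$, $[f_2,f_5]=\frac\mu4f_6-\frac12f_7$, $[f_2,f_6]=-f_8$, $[f_2,f_7]=\frac12f_5-\frac\mu2f_8$,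 $[f_2,f_8]=\frac14f_6$, $[f_3,f_5]=\frac12f_6+\frac\mu4f_7$, $[f_3,f_6]=-\frac12f_5+\frac\mu2f_8$, $[f_3,f_7]=-f_8$, $[f_3,f_8]=\frac14f_7$, $[f_4,f_5]=-(\frac{\mu^2}4+1)f_5+\frac{\mu(\mu^2+4)}4f_8$, $[f_4,f_6]=-f_6+\frac\mu2f_7$, $[f_4,f_7]=-\frac\mu2f_6-f_7$, $[f_4,f_8]=-\frac\mu4f_5+(-1+\frac{\mu^2}4)f_8$. - $\mathfrak g^6_\rho$: $[f_1,f_2]=f_3$, $[f_1,f_3]=-f_2$, $[f_2,f_3]=f_1$, $[f_1,f_5]=-f_8$, $[f_1,f_6]=\frac12f_7$, $[f_1,f_7]=-\frac12f_6$, $[f_1,f_8]=\frac14f_5$, $[f_2,f_5]=-\frac12f_7$, $[f_2,f_6]=-f_8$, $[f_2,f_7]=\frac12f_5$, $[f_2,f_8]=\frac14f_6$, $[f_3,f_5]=\frac12f_6$, $[f_3,f_6]=-\frac12f_5$, $[f_3,f_7]=-f_8$, $[f_3,f_8]=\frac14f_7$, $[f_4,f_j]=-f_j$ for $j=5,6,7,8$.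 Moreover $(\mathfrak g,\omega_0)$ is in this basis the Lagrangian extension with zero two-cocycle of a left-symmetric algebra. That is, $\mathfrak g=\mathfrak h\oplus\mathfrak h^*$ with brackets $[x,y]=x\cdot y-y\cdot x$, $[x,\xi]=\rho(x)\xi$, $[\xi,\eta]=0$ for $x,y\in\mathfrak h$, $\xi,\eta\in\mathfrak h^*$, where $(\rho(x)\xi)(y)=-\xi(x\cdot y)$. The form $\omega_0$ is the dual pairing, $\omega_0(x,\xi)=\xi(x)$ and $\omega_0(x,y)=\omega_0(\xi,\eta)=0$. The vectors $f_1,\dots,f_4$ are the basis $e_1,\dots,e_4$ of $\mathfrak h$, the vectors $f_5,\dots,f_8$ are the dual basis of $\mathfrak h^*$, and the product of $\mathfrak h$ is, in the respective cases, the following left-symmetric product (products not listed are zero). - $\mathfrak h_1$: $e_1e_2=\frac12(e_1+e_3+e_4)$, $e_1e_3=-e_1$, $e_1e_4=e_4e_1=e_1$, $e_2e_1=\frac12(e_1-e_3+e_4)$, $e_2e_3=e_2$, $e_2e_4=e_4e_2=\frac12(-e_1+2e_2+e_3-e_4)$, $e_3e_1=e_1$, $e_3e_2=-e_2$, $e_3e_3=e_1+e_4$,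 $e_3e_4=e_4e_3=-e_1+e_3$, $e_4e_4=-e_1+e_4$. - $\mathfrak h_2^{\lambda}$, $\lambda\ge0$: $e_1e_2=\frac{1+\lambda}2e_3+\frac12e_4$, $e_1e_3=-e_1$, $e_1e_4=e_4e_1=(1+\lambda)e_1$, $e_2e_1=\frac{\lambda-1}2e_3+\frac12e_4$, $e_2e_3=e_2$, $e_2e_4=e_4e_2=(1-\lambda)e_2$, $e_3e_1=e_1$, $e_3e_2=-e_2$, $e_3e_3=\lambda e_3+e_4$, $e_3e_4=e_4e_3=(1-\lambda^2)e_3-\lambda e_4$, $e_4e_4=\lambda(\lambda^2-1)e_3+(1+\lambda^2)e_4$. - $\mathfrak h_3$: $e_1e_1=3(e_3+e_4)$, $e_1e_2=3e_4$, $e_1e_3=-e_1$, $e_2e_1=-e_3+3e_4$, $e_2e_2=-\frac14e_3+\frac34e_4$, $e_2e_3=e_1-e_2$, $e_3e_1=e_1$, $e_3e_2=e_1-3e_2$, $e_3e_3=2e_3+3e_4$, $e_je_4=e_4e_j=e_j$ for $j=1,\dots,4$. - $\mathfrak h_4^{\nu}$, $\nu<0$: $e_1e_2=\frac12(e_1+\nu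 e_2+e_3+e_4)$, $e_1e_3=-e_1$, $e_1e_4=e_4e_1=(1-\frac\nu2)e_1-\frac{\nu^2}2e_2-\frac\nu2(e_3+e_4)$, $e_2e_1=\frac12(e_1+\nu e_2-e_3+e_4)$, $e_2e_3=e_2$, $e_2e_4=e_4e_2=-\frac12e_1+(1-\frac\nu2)e_2+\frac12(e_3-e_4)$, $e_3e_1=e_1$, $e_3e_2=-e_2$, $e_3e_3=e_1+\nu e_2+e_4$, $e_3e_4=e_4e_3=-e_1+\nu e_2+e_3$, $e_4e_4=(\nu-1)e_1+\nu(\nu-1)e_2+(\nu+1)e_4$. - $\mathfrak h_5^{\mu}$, $\mu>0$: $e_1e_1=e_2e_2=e_3e_3=-\frac\mu4e_1-\frac14e_4$, $e_1e_2=\frac12e_3$, $e_1e_3=-\frac12e_2$, $e_1e_4=e_4e_1=(\frac{\mu^2}4+1)e_1+\frac\mu4e_4$, $e_2e_1=-\frac12e_3$, $e_2e_3=\frac12e_1$, $e_2e_4=e_4e_2=e_2+\frac\mu2e_3$, $e_3e_1=\frac12e_2$, $e_3e_2=-\frac12e_1$, $e_3e_4=e_4e_3=-\frac\mu2e_2+e_3$,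 $e_4e_4=-\frac{\mu(\mu^2+4)}4e_1+(1-\frac{\mu^2}4)e_4$. - $\mathfrak h_6$: $e_1e_1=e_2e_2=e_3e_3=-\frac14e_4$, $e_1e_2=\frac12e_3$, $e_1e_3=-\frac12e_2$, $e_2e_1=-\frac12e_3$, $e_2e_3=\frac12e_1$, $e_3e_1=\frac12e_2$, $e_3e_2=-\frac12e_1$, $e_je_4=e_4e_j=e_j$ for $j=1,\dots,4$. -/

import Mathlib

namespace FrobeniusEight

open Module

/-! ### Symplectic and Frobenius Lie algebras -/

section Symplectic

variable {L : Type*} [LieRing L] [LieAlgebra ℝ L]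

/-- A symplectic form on a real Lie algebra: a non-degenerate skew-symmetric bilinear form which is a
2-cocycle for the scalar cohomology. -/
structure IsSymplecticForm (ω : LinearMap.BilinForm ℝ L) : Prop where
  alt : ω.IsAlt
  nondegenerate : ω.Nondegenerate
  closed : ∀ x y z : L, ω ⁅x, y⁆ z + ω ⁅y, z⁆ x + ω ⁅z, x⁆ y = 0

/-- `ω` is exact: it is the Chevalley–Eilenberg differential of a linear form. -/
def IsExactForm (ω : LinearMap.BilinForm ℝ L) : Prop :=
  ∃ β : Dual ℝ L, ∀ x y : L, ω x y = -β ⁅x, y⁆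

/-- The two-form `f¹⁵ + f²⁶ + f³⁷ + f⁴⁸` attached to a basis `f = (f₁, …, f₈)`, numbered here from
`f 0` to `f 7`; `f^{ij}` is the wedge `fⁱ ∧ fʲ` of two members of the dual basis, with
`(α ∧ β)(x, y) = α(x) β(y) - α(y) β(x)`. -/
noncomputable def omegaZero (f : Basis (Fin 8) ℝ L) : LinearMap.BilinForm ℝ L :=
  LinearMap.mk₂ ℝ
    (fun x y => ∑ i : Fin 4,
      (f.coord (Fin.castAdd 4 i) x * f.coord (Fin.natAdd 4 i) y
        - f.coord (Fin.castAdd 4 i) y * f.coord (Fin.natAdd 4 i) x))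
    (by intro x x' y; simp only [map_add, ← Finset.sum_add_distrib]
        exact Finset.sum_congr rfl fun i _ => by ring)
    (by intro c x y; simp only [map_smul, smul_eq_mul, Finset.mul_sum]
        exact Finset.sum_congr rfl fun i _ => by ring)
    (by intro x y y'; simp only [map_add, ← Finset.sum_add_distrib]
        exact Finset.sum_congr rfl fun i _ => by ring)
    (by intro c x y; simp only [map_smul, smul_eq_mul, Finset.mul_sum]
        exact Finset.sum_congr rfl fun i _ => by ring)

variable (L)

/-- A Frobenius Lie algebra: a Lie algebra admitting an exact symplectic form. -/
def IsFrobenius : Prop :=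
  ∃ ω : LinearMap.BilinForm ℝ L, IsSymplecticForm ω ∧ IsExactForm ω

/-- `L` is not the direct sum of two non-zero ideals. -/
def IsIndecomposable : Prop :=
  ∀ I J : LieIdeal ℝ L, IsCompl I J → I = ⊥ ∨ J = ⊥

end Symplectic

/-! ### Left-symmetric algebras and their Lagrangian extensions -/

section Extension

variable {V : Type*} [AddCommGroup V] [Module ℝ V]

/-- Left-symmetry `(x, y, z) = (y, x, z)` of the associator `(x, y, z) = (x · y) · z - x · (y · z)`
of a bilinear product. -/
def IsLeftSymmetric (m : V →ₗ[ℝ] V →ₗ[ℝ] V) : Prop :=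
  ∀ x y z : V, m (m x y) z - m x (m y z) = m (m y x) z - m y (m x z)

/-- The dual `ρ` of the left multiplication: `(ρ(x) ξ)(y) = -ξ (x · y)`. -/
def dualRep (m : V →ₗ[ℝ] V →ₗ[ℝ] V) (x : V) : Dual ℝ V →ₗ[ℝ] Dual ℝ V :=
  -(m x).dualMap

/-- The bracket of the Lagrangian extension `𝔥 ⊕ 𝔥*` of a left-symmetric algebra `𝔥` by a two-cochain
`α` with values in `𝔥*`: `[x, y] = (x · y - y · x) + α(x, y)`, `[x, ξ] = ρ(x) ξ`, `[ξ, η] = 0`. -/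
def extensionBracket (m : V →ₗ[ℝ] V →ₗ[ℝ] V) (α : V →ₗ[ℝ] V →ₗ[ℝ] Dual ℝ V)
    (u v : V × Dual ℝ V) : V × Dual ℝ V :=
  (m u.1 v.1 - m v.1 u.1, α u.1 v.1 + dualRep m u.1 v.2 - dualRep m v.1 u.2)

/-- The two-form on `𝔥 ⊕ 𝔥*` given by the dual pairing: `ω(x, ξ) = ξ(x)`, with `𝔥` and `𝔥*`
isotropic. -/
def pairingForm (u v : V × Dual ℝ V) : ℝ := v.2 u.1 - u.2 v.1

end Extension

/-! ### The six families -/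

/-- Labels of the six families, with their real parameters. -/
inductive Family : Type
  | one : Family
  | two (lam : ℝ) : Family
  | three : Family
  | four (nu : ℝ) : Family
  | five (mu : ℝ) : Family
  | six : Family

/-- The range of the parameters. -/
def Family.Admissible : Family → Prop
  | .one => True
  | .two lam => 0 ≤ lam
  | .three => True
  | .four nu => nu < 0
  | .five mu => 0 < mu
  | .six => True

/-- The `i`-th standard basis vector of `ℝ⁴`. -/
def stdVec (i : Fin 4) : Fin 4 → ℝ := Pi.single i 1

/-- The table of products of basis vectors: the entry in row `i` and column `j` is `eᵢ · eⱼ`. -/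
noncomputable def Family.productTable : Family → Fin 4 → Fin 4 → (Fin 4 → ℝ) :=
  let e₁ := stdVec 0
  let e₂ := stdVec 1
  let e₃ := stdVec 2
  let e₄ := stdVec 3
  fun F => match F with
  | .one =>
    ![![0, (1 / 2 : ℝ) • (e₁ + e₃ + e₄), -e₁, e₁],
      ![(1 / 2 : ℝ) • (e₁ - e₃ + e₄), 0, e₂, (1 / 2 : ℝ) • (-e₁ + (2 : ℝ) • e₂ + e₃ - e₄)],
      ![e₁, -e₂, e₁ + e₄, -e₁ + e₃],
      ![e₁, (1 / 2 : ℝ) • (-e₁ + (2 : ℝ) • e₂ + e₃ - e₄), -e₁ + e₃, -e₁ + e₄]]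
  | .two lam =>
    ![![0, ((1 + lam) / 2) • e₃ + (1 / 2 : ℝ) • e₄, -e₁, (1 + lam) • e₁],
      ![((lam - 1) / 2) • e₃ + (1 / 2 : ℝ) • e₄, 0, e₂, (1 - lam) • e₂],
      ![e₁, -e₂, lam • e₃ + e₄, (1 - lam ^ 2) • e₃ - lam • e₄],
      ![(1 + lam) • e₁, (1 - lam) • e₂, (1 - lam ^ 2) • e₃ - lam • e₄,
        (lam * (lam ^ 2 - 1)) • e₃ + (1 + lam ^ 2) • e₄]]
  | .three =>
    ![![(3 : ℝ) • (e₃ + e₄), (3 : ℝ) • e₄, -e₁, e₁],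
      ![-e₃ + (3 : ℝ) • e₄, -(1 / 4 : ℝ) • e₃ + (3 / 4 : ℝ) • e₄, e₁ - e₂, e₂],
      ![e₁, e₁ - (3 : ℝ) • e₂, (2 : ℝ) • e₃ + (3 : ℝ) • e₄, e₃],
      ![e₁, e₂, e₃, e₄]]
  | .four nu =>
    ![![0, (1 / 2 : ℝ) • (e₁ + nu • e₂ + e₃ + e₄), -e₁,
        (-(nu / 2) + 1) • e₁ - (nu ^ 2 / 2) • e₂ - (nu / 2) • (e₃ + e₄)],
      ![(1 / 2 : ℝ) • (e₁ + nu • e₂ - e₃ + e₄), 0, e₂,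
        -(1 / 2 : ℝ) • e₁ + (-(nu / 2) + 1) • e₂ + (1 / 2 : ℝ) • (e₃ - e₄)],
      ![e₁, -e₂, e₁ + nu • e₂ + e₄, -e₁ + nu • e₂ + e₃],
      ![(-(nu / 2) + 1) • e₁ - (nu ^ 2 / 2) • e₂ - (nu / 2) • (e₃ + e₄),
        -(1 / 2 : ℝ) • e₁ + (-(nu / 2) + 1) • e₂ + (1 / 2 : ℝ) • (e₃ - e₄),
        -e₁ + nu • e₂ + e₃,
        (nu - 1) • e₁ + (nu * (nu - 1)) • e₂ + (nu + 1) • e₄]]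
  | .five mu =>
    ![![-(mu / 4) • e₁ - (1 / 4 : ℝ) • e₄, (1 / 2 : ℝ) • e₃, -(1 / 2 : ℝ) • e₂,
        (mu ^ 2 / 4 + 1) • e₁ + (mu / 4) • e₄],
      ![-(1 / 2 : ℝ) • e₃, -(mu / 4) • e₁ - (1 / 4 : ℝ) • e₄, (1 / 2 : ℝ) • e₁,
        e₂ + (mu / 2) • e₃],
      ![(1 / 2 : ℝ) • e₂, -(1 / 2 : ℝ) • e₁, -(mu / 4) • e₁ - (1 / 4 : ℝ) • e₄,
        -(mu / 2) • e₂ + e₃],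
      ![(mu ^ 2 / 4 + 1) • e₁ + (mu / 4) • e₄, e₂ + (mu / 2) • e₃, -(mu / 2) • e₂ + e₃,
        -(mu * (mu ^ 2 + 4) / 4) • e₁ + (-(mu ^ 2 / 4) + 1) • e₄]]
  | .six =>
    ![![-(1 / 4 : ℝ) • e₄, (1 / 2 : ℝ) • e₃, -(1 / 2 : ℝ) • e₂, e₁],
      ![-(1 / 2 : ℝ) • e₃, -(1 / 4 : ℝ) • e₄, (1 / 2 : ℝ) • e₁, e₂],
      ![(1 / 2 : ℝ) • e₂, -(1 / 2 : ℝ) • e₁, -(1 / 4 : ℝ) • e₄, e₃],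
      ![e₁, e₂, e₃, e₄]]

/-- The bilinear product on `𝔥 = ℝ⁴` with the given table: `x · y = ∑ᵢⱼ xᵢ yⱼ (eᵢ · eⱼ)`. -/
noncomputable def Family.product (F : Family) :
    (Fin 4 → ℝ) →ₗ[ℝ] (Fin 4 → ℝ) →ₗ[ℝ] (Fin 4 → ℝ) :=
  ∑ i : Fin 4, ∑ j : Fin 4,
    (LinearMap.proj (R := ℝ) (φ := fun _ : Fin 4 => ℝ) i).smulRight
      ((LinearMap.proj (R := ℝ) (φ := fun _ : Fin 4 => ℝ) j).smulRight (F.productTable i j))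

section Table

variable {L : Type*} [AddCommGroup L] [Module ℝ L] [Bracket L L]

/-- The brackets of `f₁, …, f₄` generating a copy of `𝔰𝔩₂(ℝ) ⊕ ℝ`, `f₄` being central in it. -/
def SlBrackets (f₁ f₂ f₃ f₄ : L) : Prop :=
  ⁅f₁, f₂⁆ = f₃ ∧ ⁅f₁, f₃⁆ = (-2 : ℝ) • f₁ ∧ ⁅f₂, f₃⁆ = (2 : ℝ) • f₂ ∧
  ⁅f₁, f₄⁆ = 0 ∧ ⁅f₂, f₄⁆ = 0 ∧ ⁅f₃, f₄⁆ = 0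

/-- The brackets of `f₁, …, f₄` generating a copy of `𝔰𝔬(3) ⊕ ℝ`, `f₄` being central in it. -/
def SoBrackets (f₁ f₂ f₃ f₄ : L) : Prop :=
  ⁅f₁, f₂⁆ = f₃ ∧ ⁅f₁, f₃⁆ = -f₂ ∧ ⁅f₂, f₃⁆ = f₁ ∧
  ⁅f₁, f₄⁆ = 0 ∧ ⁅f₂, f₄⁆ = 0 ∧ ⁅f₃, f₄⁆ = 0

/-- `f₅, …, f₈` commute. -/
def AbelianBrackets (f₅ f₆ f₇ f₈ : L) : Prop :=
  ⁅f₅, f₆⁆ = 0 ∧ ⁅f₅, f₇⁆ = 0 ∧ ⁅f₅, f₈⁆ = 0 ∧ ⁅f₆, f₇⁆ = 0 ∧ ⁅f₆, f₈⁆ = 0 ∧ ⁅f₇, f₈⁆ = 0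

/-- The explicit list of all brackets `[fᵢ, fⱼ]`, `i < j`, of the family `F` (the vanishing ones
included). -/
def Family.HasBrackets (F : Family) (f : Fin 8 → L) : Prop :=
  let f₁ := f 0
  let f₂ := f 1
  let f₃ := f 2
  let f₄ := f 3
  let f₅ := f 4
  let f₆ := f 5
  let f₇ := f 6
  let f₈ := f 7
  AbelianBrackets f₅ f₆ f₇ f₈ ∧
  match F with
  | .one =>
    SlBrackets f₁ f₂ f₃ f₄ ∧
    ⁅f₁, f₅⁆ = -(1 / 2 : ℝ) • f₆ + f₇ - f₈ ∧
    ⁅f₁, f₆⁆ = 0 ∧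
    ⁅f₁, f₇⁆ = -(1 / 2 : ℝ) • f₆ ∧
    ⁅f₁, f₈⁆ = -(1 / 2 : ℝ) • f₆ ∧
    ⁅f₂, f₅⁆ = (1 / 2 : ℝ) • (-f₅ + f₈) ∧
    ⁅f₂, f₆⁆ = -f₇ - f₈ ∧
    ⁅f₂, f₇⁆ = (1 / 2 : ℝ) • (f₅ - f₈) ∧
    ⁅f₂, f₈⁆ = (1 / 2 : ℝ) • (-f₅ + f₈) ∧
    ⁅f₃, f₅⁆ = -f₅ - f₇ + f₈ ∧
    ⁅f₃, f₆⁆ = f₆ ∧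
    ⁅f₃, f₇⁆ = -f₈ ∧
    ⁅f₃, f₈⁆ = -f₇ ∧
    ⁅f₄, f₅⁆ = -f₅ + (1 / 2 : ℝ) • f₆ + f₇ + f₈ ∧
    ⁅f₄, f₆⁆ = -f₆ ∧
    ⁅f₄, f₇⁆ = -(1 / 2 : ℝ) • f₆ - f₇ ∧
    ⁅f₄, f₈⁆ = (1 / 2 : ℝ) • f₆ - f₈
  | .two lam =>
    SlBrackets f₁ f₂ f₃ f₄ ∧
    ⁅f₁, f₅⁆ = f₇ - (1 + lam) • f₈ ∧
    ⁅f₁, f₆⁆ = 0 ∧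
    ⁅f₁, f₇⁆ = -((1 + lam) / 2) • f₆ ∧
    ⁅f₁, f₈⁆ = -(1 / 2 : ℝ) • f₆ ∧
    ⁅f₂, f₅⁆ = 0 ∧
    ⁅f₂, f₆⁆ = -f₇ - (1 - lam) • f₈ ∧
    ⁅f₂, f₇⁆ = ((1 - lam) / 2) • f₅ ∧
    ⁅f₂, f₈⁆ = -(1 / 2 : ℝ) • f₅ ∧
    ⁅f₃, f₅⁆ = -f₅ ∧
    ⁅f₃, f₆⁆ = f₆ ∧
    ⁅f₃, f₇⁆ = -lam • f₇ - (1 - lam ^ 2) • f₈ ∧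
    ⁅f₃, f₈⁆ = -f₇ + lam • f₈ ∧
    ⁅f₄, f₅⁆ = -(1 + lam) • f₅ ∧
    ⁅f₄, f₆⁆ = (lam - 1) • f₆ ∧
    ⁅f₄, f₇⁆ = (lam ^ 2 - 1) • f₇ + (lam * (1 - lam ^ 2)) • f₈ ∧
    ⁅f₄, f₈⁆ = lam • f₇ - (1 + lam ^ 2) • f₈
  | .three =>
    SlBrackets f₁ f₂ f₃ f₄ ∧
    ⁅f₁, f₅⁆ = f₇ - f₈ ∧
    ⁅f₁, f₆⁆ = 0 ∧
    ⁅f₁, f₇⁆ = (-3 : ℝ) • f₅ ∧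
    ⁅f₁, f₈⁆ = (-3 : ℝ) • (f₅ + f₆) ∧
    ⁅f₂, f₅⁆ = -f₇ ∧
    ⁅f₂, f₆⁆ = f₇ - f₈ ∧
    ⁅f₂, f₇⁆ = f₅ + (1 / 4 : ℝ) • f₆ ∧
    ⁅f₂, f₈⁆ = (-3 : ℝ) • f₅ - (3 / 4 : ℝ) • f₆ ∧
    ⁅f₃, f₅⁆ = -f₅ - f₆ ∧
    ⁅f₃, f₆⁆ = (3 : ℝ) • f₆ ∧
    ⁅f₃, f₇⁆ = (-2 : ℝ) • f₇ - f₈ ∧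
    ⁅f₃, f₈⁆ = (-3 : ℝ) • f₇ ∧
    ⁅f₄, f₅⁆ = -f₅ ∧
    ⁅f₄, f₆⁆ = -f₆ ∧
    ⁅f₄, f₇⁆ = -f₇ ∧
    ⁅f₄, f₈⁆ = -f₈
  | .four nu =>
    SlBrackets f₁ f₂ f₃ f₄ ∧
    ⁅f₁, f₅⁆ = -(1 / 2 : ℝ) • f₆ + f₇ + (-1 + nu / 2) • f₈ ∧
    ⁅f₁, f₆⁆ = -(nu / 2) • f₆ + (nu ^ 2 / 2) • f₈ ∧
    ⁅f₁, f₇⁆ = -(1 / 2 : ℝ) • f₆ + (nu / 2) • f₈ ∧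
    ⁅f₁, f₈⁆ = -(1 / 2 : ℝ) • f₆ + (nu / 2) • f₈ ∧
    ⁅f₂, f₅⁆ = (1 / 2 : ℝ) • (-f₅ + f₈) ∧
    ⁅f₂, f₆⁆ = -(nu / 2) • f₅ - f₇ + (-1 + nu / 2) • f₈ ∧
    ⁅f₂, f₇⁆ = (1 / 2 : ℝ) • (f₅ - f₈) ∧
    ⁅f₂, f₈⁆ = (1 / 2 : ℝ) • (-f₅ + f₈) ∧
    ⁅f₃, f₅⁆ = -f₅ - f₇ + f₈ ∧
    ⁅f₃, f₆⁆ = f₆ - nu • (f₇ + f₈) ∧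
    ⁅f₃, f₇⁆ = -f₈ ∧
    ⁅f₃, f₈⁆ = -f₇ ∧
    ⁅f₄, f₅⁆ = (-1 + nu / 2) • f₅ + (1 / 2 : ℝ) • f₆ + f₇ + (1 - nu) • f₈ ∧
    ⁅f₄, f₆⁆ = (nu ^ 2 / 2) • f₅ + (-1 + nu / 2) • f₆ - nu • f₇ + (nu * (1 - nu)) • f₈ ∧
    ⁅f₄, f₇⁆ = (nu / 2) • f₅ - (1 / 2 : ℝ) • f₆ - f₇ ∧
    ⁅f₄, f₈⁆ = (nu / 2) • f₅ + (1 / 2 : ℝ) • f₆ - (nu + 1) • f₈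
  | .five mu =>
    SoBrackets f₁ f₂ f₃ f₄ ∧
    ⁅f₁, f₅⁆ = (mu / 4) • f₅ - (mu ^ 2 / 4 + 1) • f₈ ∧
    ⁅f₁, f₆⁆ = (1 / 2 : ℝ) • f₇ ∧
    ⁅f₁, f₇⁆ = -(1 / 2 : ℝ) • f₆ ∧
    ⁅f₁, f₈⁆ = (1 / 4 : ℝ) • f₅ - (mu / 4) • f₈ ∧
    ⁅f₂, f₅⁆ = (mu / 4) • f₆ - (1 / 2 : ℝ) • f₇ ∧
    ⁅f₂, f₆⁆ = -f₈ ∧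
    ⁅f₂, f₇⁆ = (1 / 2 : ℝ) • f₅ - (mu / 2) • f₈ ∧
    ⁅f₂, f₈⁆ = (1 / 4 : ℝ) • f₆ ∧
    ⁅f₃, f₅⁆ = (1 / 2 : ℝ) • f₆ + (mu / 4) • f₇ ∧
    ⁅f₃, f₆⁆ = -(1 / 2 : ℝ) • f₅ + (mu / 2) • f₈ ∧
    ⁅f₃, f₇⁆ = -f₈ ∧
    ⁅f₃, f₈⁆ = (1 / 4 : ℝ) • f₇ ∧
    ⁅f₄, f₅⁆ = -(mu ^ 2 / 4 + 1) • f₅ + (mu * (mu ^ 2 + 4) / 4) • f₈ ∧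
    ⁅f₄, f₆⁆ = -f₆ + (mu / 2) • f₇ ∧
    ⁅f₄, f₇⁆ = -(mu / 2) • f₆ - f₇ ∧
    ⁅f₄, f₈⁆ = -(mu / 4) • f₅ + (-1 + mu ^ 2 / 4) • f₈
  | .six =>
    SoBrackets f₁ f₂ f₃ f₄ ∧
    ⁅f₁, f₅⁆ = -f₈ ∧
    ⁅f₁, f₆⁆ = (1 / 2 : ℝ) • f₇ ∧
    ⁅f₁, f₇⁆ = -(1 / 2 : ℝ) • f₆ ∧
    ⁅f₁, f₈⁆ = (1 / 4 : ℝ) • f₅ ∧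
    ⁅f₂, f₅⁆ = -(1 / 2 : ℝ) • f₇ ∧
    ⁅f₂, f₆⁆ = -f₈ ∧
    ⁅f₂, f₇⁆ = (1 / 2 : ℝ) • f₅ ∧
    ⁅f₂, f₈⁆ = (1 / 4 : ℝ) • f₆ ∧
    ⁅f₃, f₅⁆ = (1 / 2 : ℝ) • f₆ ∧
    ⁅f₃, f₆⁆ = -(1 / 2 : ℝ) • f₅ ∧
    ⁅f₃, f₇⁆ = -f₈ ∧
    ⁅f₃, f₈⁆ = (1 / 4 : ℝ) • f₇ ∧
    ⁅f₄, f₅⁆ = -f₅ ∧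
    ⁅f₄, f₆⁆ = -f₆ ∧
    ⁅f₄, f₇⁆ = -f₇ ∧
    ⁅f₄, f₈⁆ = -f₈

end Table

/-- The basis `f` of `L` exhibits `L`, with the form `f¹⁵ + f²⁶ + f³⁷ + f⁴⁸`, as the Lagrangian
extension `𝔥 ⊕ 𝔥*` of the algebra `𝔥 = ℝ⁴` with product `m` by the two-cochain `α`: `f₁, …, f₄` is
the standard basis of `𝔥` and `f₅, …, f₈` is the dual basis of `𝔥*`. -/
def IsLagrangianExtension {L : Type*} [LieRing L] [LieAlgebra ℝ L] (f : Basis (Fin 8) ℝ L)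
    (m : (Fin 4 → ℝ) →ₗ[ℝ] (Fin 4 → ℝ) →ₗ[ℝ] (Fin 4 → ℝ))
    (α : (Fin 4 → ℝ) →ₗ[ℝ] (Fin 4 → ℝ) →ₗ[ℝ] Dual ℝ (Fin 4 → ℝ)) : Prop :=
  ∃ Φ : ((Fin 4 → ℝ) × Dual ℝ (Fin 4 → ℝ)) ≃ₗ[ℝ] L,
    (∀ i : Fin 4, Φ (stdVec i, 0) = f (Fin.castAdd 4 i)) ∧
    (∀ i : Fin 4, Φ (0, LinearMap.proj i) = f (Fin.natAdd 4 i)) ∧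
    (∀ u v, Φ (extensionBracket m α u v) = ⁅Φ u, Φ v⁆) ∧
    (∀ u v, omegaZero f (Φ u) (Φ v) = pairingForm u v)

end FrobeniusEight

/-! ### Dimensions of Lie algebras with non-degenerate Killing form -/

namespace FrobeniusEight
open Module LieAlgebra LieModule

/-! Fix `β` such that `(x, y) ↦ -β ⁅x, y⁆` is non-degenerate. Two consequences drive the reduction.
The principal element `T`, defined by `β ∘ ad T = β`, satisfies `tr (ad T) = dim / 2`, so a non-zero
Frobenius algebra is not unimodular (`IsRegularForm.finrank_eq_zero`). And two subspaces that are
orthogonal for this form have dimensions adding up to at most the dimension of the algebra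
(`IsRegularForm.finrank_add_le`).

The quotient of `L` by its radical has non-degenerate Killing form, so by root counting over `ℂ` its
dimension is 0, 3 or at least 6. Dimension 0 means that `L` is solvable. In dimension at least 6 the
radical has dimension at most 2 and is abelian, because a non-abelian two-dimensional ideal is a
direct factor; then `L` is unimodular, which is impossible. So the quotient is `𝔰𝔩₂(ℝ)` or `𝔰𝔬(3)`,
spanned by a triple `x, y, z`, which lifts to `L` by Levi's argument: the Casimir operator kills the
relevant second cohomology.

Under the triple, `L` is the sum of the triple, its centralizer `T` and a module `N` without trivial
submodules, with `dim T + dim N = 5`. The trace of `ad` lives on `T`, and `T` acts non-trivially on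
`N` by indecomposability. If `dim N` is 2 or 3 then `T` acts by homotheties, and the kernel of this
action produces orthogonal subspaces that are too large. Hence `dim N = 4`, `T` is a line, and `N`
is an ideal, which turns out to be abelian.

It remains to classify four-dimensional modules without trivial part, with an endomorphism `M = ad d
+ 1` commuting with the triple and made traceless by rescaling `d`. In the split case `N` is
irreducible, `M = 0` (family three), or `N` is twice the standard module and `M` is a traceless real
two-by-two matrix: diagonalizable over `ℝ` (family two), non-zero nilpotent (one), or with non-real
eigenvalues (four). In the compact case `N` is the quaternions and `M` is an imaginary quaternion,
conjugate to a non-negative multiple of a fixed one: positive (five) or zero (six). An explicit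
basis of each model has the listed brackets. The Jacobi identity then gives left-symmetry, and a
right unit of the product gives exactness of the form. -/

theorem finrank_eq_finrank_add_card_root {K Q : Type*} [Field K] [CharZero K] [IsAlgClosed K]
    [LieRing Q] [LieAlgebra K Q] [FiniteDimensional K Q] [IsKilling K Q] [Nontrivial Q]
    (H : LieSubalgebra K Q) [H.IsCartanSubalgebra] :
    finrank K Q = finrank K H + H.root.card := by
  classical
  have hind := LieSubmodule.iSupIndep_toSubmodule.mpr (iSupIndep_genWeightSpace' K H Q)
  have htop : ⨆ χ : Weight K H Q, (genWeightSpace Q χ).toSubmodule = ⊤ := by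
    rw [← LieSubmodule.iSup_toSubmodule, iSup_genWeightSpace_eq_top']; rfl
  have hint := DirectSum.isInternal_submodule_of_iSupIndep_of_iSup_eq_top hind htop
  have h1 := (LinearEquiv.ofBijective (DirectSum.coeLinearMap _) hint).finrank_eq
  rw [Module.finrank_directSum] at h1
  rw [← h1, ← Finset.add_sum_erase _ _ (Finset.mem_univ (0 : Weight K H Q))]
  congr 1
  · have : rootSpace H (0 : H → K) = H.toLieSubmodule := rootSpace_zero_eq K Q H
    show finrank K (rootSpace H (0 : H → K)).toSubmodule = _
    rw [this]; rfl
  · rw [Finset.card_eq_sum_ones]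
    refine Finset.sum_congr ?_ ?_
    · ext χ
      simp [Weight.isNonZero_iff_ne_zero]
    · intro χ hχ
      exact IsKilling.finrank_rootSpace_eq_one χ (by simpa using hχ)

/-- Roots span the dual of a Cartan subalgebra, and the only roots proportional to a root `α` are
`±α`. Rank zero allows no root and rank one exactly two, while higher rank forces two
non-proportional roots with their negatives. The dimension is therefore 0, `1 + 2`, or at least `2 +
4`. -/
theorem finrank_killing_aux {K Q : Type*} [Field K] [CharZero K] [IsAlgClosed K]
    [LieRing Q] [LieAlgebra K Q] [FiniteDimensional K Q] [IsKilling K Q] :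
    finrank K Q = 0 ∨ finrank K Q = 3 ∨ 6 ≤ finrank K Q := by
  classical
  rcases subsingleton_or_nontrivial Q with hs | hn
  · exact .inl (finrank_zero_of_subsingleton)
  obtain ⟨H, hH⟩ : ∃ H : LieSubalgebra K Q, H.IsCartanSubalgebra := by
    obtain ⟨x, hx⟩ := exists_isCartanSubalgebra_engel K Q
    exact ⟨_, hx⟩
  rw [finrank_eq_finrank_add_card_root H]
  have hspan := IsKilling.span_weight_isNonZero_eq_top K Q H
  have hneg : ∀ α : Weight K H Q, α.IsNonZero → -α ≠ α := by
    intro α hα h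
    apply hα
    have : (-α : H → K) = α := by rw [← Weight.coe_neg, h]
    exact self_eq_neg.mp this.symm
  rcases Nat.lt_trichotomy (finrank K H) 1 with h0 | h1 | h2
  · left
    have hsub : Subsingleton H := (finrank_zero_iff (R := K)).mp (by omega)
    have : H.root = ∅ := by
      apply Finset.eq_empty_of_forall_notMem
      intro α hα
      exact LieSubalgebra.isNonZero_coe_root ⟨α, hα⟩ (by
        ext x; rw [Subsingleton.elim x 0]; simp)
    simp [this]; omega
  · right; left
    have hd : finrank K (Dual K H) = 1 := by rw [Subspace.dual_finrank_eq, h1]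
    obtain ⟨α, hα⟩ : ∃ α : Weight K H Q, α.IsNonZero := by
      by_contra! hcon
      have : {α : Weight K H Q | α.IsNonZero} = ∅ := by
        ext α; simpa using hcon α
      rw [this] at hspan
      rw [Set.image_empty, Submodule.span_empty] at hspan
      have h3 := finrank_top K (Dual K H)
      rw [← hspan, finrank_bot] at h3
      omega
    have : H.root = {α, -α} := by
      ext β
      rw [LieSubalgebra.root, Finset.mem_filter_univ, Finset.mem_insert, Finset.mem_singleton]
      constructor
      · intro hβ
        have hα0 : α.toLinear ≠ 0 := by simpa using hα
        obtain ⟨c, hc⟩ := (finrank_eq_one_iff_of_nonzero' _ hα0).mp hd β.toLinear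
        exact (IsKilling.eq_neg_or_eq_of_eq_smul α β hβ c (by
          ext x; exact (LinearMap.congr_fun hc x).symm)).symm
      · rintro (rfl | rfl)
        · exact hα
        · simpa using hα
    rw [this, Finset.card_pair (hneg α hα).symm, h1]
  · right; right
    suffices 4 ≤ H.root.card by omega
    have hd : finrank K (Dual K H) = finrank K H := Subspace.dual_finrank_eq
    obtain ⟨α, hα⟩ : ∃ α : Weight K H Q, α.IsNonZero := by
      by_contra! hcon
      have : {α : Weight K H Q | α.IsNonZero} = ∅ := by
        ext α; simpa using hcon α
      rw [this] at hspan
      rw [Set.image_empty, Submodule.span_empty] at hspan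
      have h3 := finrank_top K (Dual K H)
      rw [← hspan, finrank_bot] at h3
      omega
    obtain ⟨β, hβ, hαβ⟩ : ∃ β : Weight K H Q, β.IsNonZero ∧
        β.toLinear ∉ Submodule.span K {α.toLinear} := by
      by_contra! hcon
      have : (⊤ : Submodule K (Dual K H)) ≤ Submodule.span K {α.toLinear} := by
        rw [← hspan, Submodule.span_le]
        rintro _ ⟨β, hβ, rfl⟩
        exact hcon β hβ
      have h3 := Submodule.finrank_mono this
      rw [finrank_top] at h3
      have := finrank_span_le_card (R := K) ({α.toLinear} : Set (Dual K H))
      simp only [Set.toFinset_singleton, Finset.card_singleton] at this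
      omega
    have hne : ∀ γ : Weight K H Q, γ.toLinear ∈ Submodule.span K {α.toLinear} → β ≠ γ := by
      rintro γ hγ rfl; exact hαβ hγ
    have e1 : β ≠ α := hne _ (Submodule.mem_span_singleton_self _)
    have e2 : β ≠ -α := hne _ (by simp)
    have e3 : -β ≠ α := fun h => e2 (by rw [← h, neg_neg])
    have e4 : -β ≠ -α := fun h => e1 (neg_injective h)
    have : ({α, -α, β, -β} : Finset (Weight K H Q)) ⊆ H.root := by
      intro γ hγ
      simp only [Finset.mem_insert, Finset.mem_singleton] at hγ
      rw [LieSubalgebra.root, Finset.mem_filter_univ]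
      rcases hγ with rfl | rfl | rfl | rfl <;> simpa
    refine le_trans (le_of_eq ?_) (Finset.card_le_card this)
    rw [Finset.card_insert_of_notMem, Finset.card_insert_of_notMem,
      Finset.card_pair (hneg β hβ).symm]
    · simp [e2.symm, e4.symm]
    · simp [e1.symm, e3.symm, (hneg α hα).symm]

/-- The Gram matrix of the Killing form in a base-changed basis is the image of the real one, so its
determinant stays non-zero. -/
theorem isKilling_baseChange {Q : Type*} [LieRing Q] [LieAlgebra ℝ Q] [FiniteDimensional ℝ Q]
    [IsKilling ℝ Q] : IsKilling ℂ (TensorProduct ℝ ℂ Q) where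
  killingCompl_top_eq_bot := by
    classical
    have hnd : (killingForm ℂ (TensorProduct ℝ ℂ Q)).Nondegenerate := by
      let b := finBasis ℝ Q
      rw [LinearMap.BilinForm.nondegenerate_iff_det_ne_zero (b := b.baseChange ℂ)]
      have h1 := (LinearMap.BilinForm.nondegenerate_iff_det_ne_zero (b := b)).mp
        (IsKilling.killingForm_nondegenerate ℝ Q)
      have h2 : LinearMap.BilinForm.toMatrix (b.baseChange ℂ)
          (killingForm ℂ (TensorProduct ℝ ℂ Q)) =
          (LinearMap.BilinForm.toMatrix b (killingForm ℝ Q)).map (algebraMap ℝ ℂ) := by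
        ext i j
        have h3 : killingForm ℂ (TensorProduct ℝ ℂ Q) =
            LinearMap.BilinForm.baseChange ℂ (killingForm ℝ Q) := traceForm_baseChange ℝ Q Q ℂ
        rw [h3]
        simp [LinearMap.BilinForm.toMatrix_apply, LinearMap.BilinForm.baseChange_tmul]
      rw [h2, ← RingHom.mapMatrix_apply, ← RingHom.map_det]
      simpa using h1
    rw [LieSubmodule.eq_bot_iff]
    intro x hx
    rw [LieIdeal.mem_killingCompl] at hx
    exact hnd.2 x fun y => hx y trivial

theorem finrank_killing {Q : Type*} [LieRing Q] [LieAlgebra ℝ Q] [FiniteDimensional ℝ Q]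
    [IsKilling ℝ Q] :
    finrank ℝ Q = 0 ∨ finrank ℝ Q = 3 ∨ 6 ≤ finrank ℝ Q := by
  have := isKilling_baseChange (Q := Q)
  have := finrank_killing_aux (K := ℂ) (Q := TensorProduct ℝ ℂ Q)
  simpa using this
end FrobeniusEight

/-! ### Regular linear forms, the principal element, and two-dimensional direct factors -/

namespace FrobeniusEight
open Module LieAlgebra
attribute [local instance 100] LieRing.ofAssociativeRing

section Form
variable {K : Type*} [LieRing K] [LieAlgebra ℝ K]

/-- The linear form `β` has trivial stabilizer, i.e. `(x, y) ↦ -β ⁅x, y⁆` is non-degenerate. -/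
def IsRegularForm (β : Dual ℝ K) : Prop := ∀ x : K, (∀ y : K, β ⁅x, y⁆ = 0) → x = 0

/-- The coadjoint orbit map `x ↦ β ∘ ad x`. -/
noncomputable def coadMap (β : Dual ℝ K) : K →ₗ[ℝ] Dual ℝ K :=
  (LinearMap.compRight ℝ β) ∘ₗ (ad ℝ K).toLinearMap

@[simp] theorem coadMap_apply (β : Dual ℝ K) (x y : K) :
    coadMap β x y = β ⁅x, y⁆ := rfl

theorem IsRegularForm.injective {β : Dual ℝ K} (h : IsRegularForm β) :
    Function.Injective (coadMap β) := by
  rw [← LinearMap.ker_eq_bot, LinearMap.ker_eq_bot']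
  intro x hx
  exact h x fun y => by simpa using LinearMap.congr_fun hx y

/-- The injective map `coadMap β` carries `U` into the annihilator of `W`. This is the tool that
excludes small `N`. -/
theorem IsRegularForm.finrank_add_le [FiniteDimensional ℝ K] {β : Dual ℝ K} (h : IsRegularForm β)
    (U W : Submodule ℝ K) (hUW : ∀ u ∈ U, ∀ w ∈ W, β ⁅u, w⁆ = 0) : finrank ℝ U + finrank ℝ W ≤ finrank ℝ K := by
  have h1 : U.map (coadMap β) ≤ W.dualAnnihilator := by
    rintro _ ⟨u, hu, rfl⟩
    rw [Submodule.mem_dualAnnihilator]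
    exact fun w hw => hUW u hu w hw
  have h2 := Submodule.finrank_mono h1
  rw [LinearEquiv.finrank_eq (Submodule.equivMapOfInjective _ h.injective U).symm] at h2
  have h3 := Subspace.finrank_add_finrank_dualAnnihilator_eq W
  omega

theorem trace_id_sub {V : Type*} [AddCommGroup V] [Module ℝ V] (f : V →ₗ[ℝ] V) :
    LinearMap.trace ℝ V (LinearMap.id - f) =
      LinearMap.trace ℝ V LinearMap.id - LinearMap.trace ℝ V f :=
  (LinearMap.trace ℝ V).map_sub _ _

/-- The principal element of a Frobenius Lie algebra has trace half the dimension. -/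
theorem IsRegularForm.exists_trace_ad [FiniteDimensional ℝ K] {β : Dual ℝ K} (h : IsRegularForm β) :
    ∃ T : K, 2 * LinearMap.trace ℝ K (ad ℝ K T) = finrank ℝ K := by
  let e : K ≃ₗ[ℝ] Dual ℝ K :=
    LinearEquiv.ofInjectiveOfFinrankEq (coadMap β) h.injective Subspace.dual_finrank_eq.symm
  have he : ∀ x y, e x y = β ⁅x, y⁆ := fun x y => rfl
  refine ⟨e.symm β, ?_⟩
  set T := e.symm β
  have hT : ∀ y, β ⁅T, y⁆ = β y := fun y => by rw [← he, LinearEquiv.apply_symm_apply]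
  -- Since `β ∘ ad T = β`, one has `β ⁅⁅T, x⁆, y⁆ = β ⁅x, y⁆ - β ⁅x, ⁅T, y⁆⁆`: transported to the
  -- dual, `ad T` becomes the identity minus its own transpose. Comparing traces gives `tr = dim -
  -- tr`.
  have hconj : e.conj (ad ℝ K T) = LinearMap.id - Dual.transpose (ad ℝ K T) := by
    ext φ y
    obtain ⟨x, rfl⟩ := e.surjective φ
    simp only [LinearEquiv.conj_apply_apply, LinearEquiv.symm_apply_apply, ad_apply,
      LinearMap.sub_apply, LinearMap.id_apply, Dual.transpose_apply, LinearMap.comp_apply, he]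
    rw [← hT ⁅x, y⁆, leibniz_lie T x y, map_add]
    ring
  have h1 := LinearMap.trace_conj' (ad ℝ K T) e
  rw [hconj, trace_id_sub, LinearMap.trace_transpose', LinearMap.trace_id,
    Subspace.dual_finrank_eq] at h1
  linarith

variable (K) in
/-- The linear form `x ↦ tr (ad x)`. -/
noncomputable def traceAd : Dual ℝ K := LinearMap.trace ℝ K ∘ₗ (ad ℝ K).toLinearMap

theorem traceAd_apply (x : K) : traceAd K x = LinearMap.trace ℝ K (ad ℝ K x) := rfl

theorem traceAd_lie (x y : K) : traceAd K ⁅x, y⁆ = 0 := by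
  rw [traceAd_apply, LieHom.map_lie, LieRing.of_associative_ring_bracket, map_sub,
    LinearMap.trace_mul_comm, sub_self]

theorem traceAd_eq_zero_of_mem_span {x : K}
    (hx : x ∈ Submodule.span ℝ {m : K | ∃ x y : K, ⁅x, y⁆ = m}) : traceAd K x = 0 := by
  have h : Submodule.span ℝ {m : K | ∃ x y : K, ⁅x, y⁆ = m} ≤ LinearMap.ker (traceAd K) := by
    rw [Submodule.span_le]
    rintro _ ⟨x, y, rfl⟩
    exact traceAd_lie x y
  exact h hx

/-- The principal element has trace half the dimension, so a unimodular Frobenius algebra can only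
be zero. -/
theorem IsRegularForm.finrank_eq_zero [FiniteDimensional ℝ K] {β : Dual ℝ K}
    (h : IsRegularForm β) (hp : traceAd K = 0) : finrank ℝ K = 0 := by
  obtain ⟨T, hT⟩ := h.exists_trace_ad
  rw [← traceAd_apply, hp, LinearMap.zero_apply, mul_zero] at hT
  exact_mod_cast hT.symm

end Form

section Decomposable
variable {L : Type*} [LieRing L] [LieAlgebra ℝ L]

/-- A two-dimensional non-abelian ideal is a direct factor. -/
theorem IsIndecomposable.lie_eq_zero_of_finrank_two (hindec : IsIndecomposable L)
    (hdim : finrank ℝ L ≠ 2) (I : LieIdeal ℝ L) (hI : finrank ℝ I = 2) :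
    ∀ x ∈ I, ∀ y ∈ I, ⁅x, y⁆ = 0 := by
  by_contra! hcon
  obtain ⟨a, ha, b, hb, hab⟩ := hcon
  have hspan : ∀ c ∈ I, ∀ d ∈ I, (∀ t : ℝ, d ≠ t • c) → c ≠ 0 → ∀ x ∈ I, ∃ p q : ℝ,
      x = p • c + q • d := by
    intro c hc d hd hcd hc0 x hx
    have hli : LinearIndependent ℝ ![(⟨c, hc⟩ : I), ⟨d, hd⟩] := by
      rw [LinearIndependent.pair_iff' (by simpa [Subtype.ext_iff] using hc0)]
      intro t ht
      exact hcd t (Subtype.ext_iff.mp ht).symm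
    have htop := hli.span_eq_top_of_card_eq_finrank (by simpa using hI.symm)
    have hx' : (⟨x, hx⟩ : I) ∈ Submodule.span ℝ (Set.range ![(⟨c, hc⟩ : I), ⟨d, hd⟩]) := by
      rw [htop]; trivial
    rw [Matrix.range_cons, Matrix.range_cons, Matrix.range_empty, Set.union_empty,
      Set.singleton_union, Submodule.mem_span_pair] at hx'
    obtain ⟨p, q, hpq⟩ := hx'
    exact ⟨p, q, by simpa using (Subtype.ext_iff.mp hpq).symm⟩
  -- Normal form of the non-abelian plane: `c` is the derived vector `⁅a, b⁆ = α a + γ b`, and `d`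
  -- is a multiple of `b` or of `a` according to whether `γ` vanishes.
  obtain ⟨c, hc, d, hd, hc0, hdc⟩ : ∃ c ∈ I, ∃ d ∈ I, c ≠ 0 ∧ ⁅d, c⁆ = c := by
    have hcI : ⁅a, b⁆ ∈ I := lie_mem_right ℝ L I a b hb
    have ha0 : a ≠ 0 := by rintro rfl; simp at hab
    obtain ⟨α, γ, h⟩ := hspan a ha b hb (by rintro t rfl; simp at hab) ha0 _ hcI
    by_cases hγ : γ = 0
    · have hα : α ≠ 0 := by rintro rfl; simp [hγ] at h; exact hab h
      refine ⟨⁅a, b⁆, hcI, -(α⁻¹ • b), I.neg_mem (I.smul_mem _ hb), hab, ?_⟩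
      rw [h, hγ, zero_smul, add_zero, neg_lie, smul_lie, lie_smul, smul_smul,
        inv_mul_cancel₀ hα, one_smul, lie_skew, h, hγ, zero_smul, add_zero]
    · refine ⟨⁅a, b⁆, hcI, γ⁻¹ • a, I.smul_mem _ ha, hab, ?_⟩
      rw [smul_lie, h, lie_add, lie_smul, lie_smul, lie_self, smul_zero, zero_add, smul_smul,
        inv_mul_cancel₀ hγ, one_smul, h]
  have hli : ∀ t : ℝ, d ≠ t • c := by
    rintro t rfl
    rw [smul_lie, lie_self, smul_zero] at hdc
    exact hc0 hdc.symm
  have hI2 := hspan c hc d hd hli hc0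
  have hcd : ⁅c, d⁆ = -c := by rw [← lie_skew, hdc]
  have hdisj : ∀ x ∈ I, ⁅x, c⁆ = 0 → ⁅x, d⁆ = 0 → x = 0 := by
    intro x hx h1 h2
    obtain ⟨p, q, rfl⟩ := hI2 x hx
    simp only [add_lie, smul_lie, lie_self, hdc, hcd, smul_zero, zero_add, add_zero, smul_neg,
      neg_eq_zero] at h1 h2
    rw [(smul_eq_zero.mp h1).resolve_right hc0, h2, zero_smul, add_zero]
  -- The complement is the centralizer of `I`. It is complementary because `I` has trivial center
  -- and only inner derivations.
  let C : LieIdeal ℝ L := LieModule.ker ℝ L I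
  have hC : ∀ x : L, x ∈ C ↔ ⁅x, c⁆ = 0 ∧ ⁅x, d⁆ = 0 := by
    intro x
    rw [LieModule.mem_ker]
    constructor
    · intro h
      exact ⟨Subtype.ext_iff.mp (h ⟨c, hc⟩), Subtype.ext_iff.mp (h ⟨d, hd⟩)⟩
    · rintro ⟨h1, h2⟩ ⟨m, hm⟩
      obtain ⟨p, q, rfl⟩ := hI2 m hm
      apply Subtype.ext
      simp [h1, h2]
  have hcompl : IsCompl I C := by
    rw [← LieSubmodule.isCompl_toSubmodule, isCompl_iff]
    constructor
    · rw [Submodule.disjoint_def]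
      intro x hx hxC
      have := (hC x).mp hxC
      exact hdisj x hx this.1 this.2
    · rw [codisjoint_iff, eq_top_iff]
      intro x _
      obtain ⟨p, q, h1⟩ := hI2 ⁅x, c⁆ (lie_mem_right ℝ L I x c hc)
      obtain ⟨r, s, h2⟩ := hI2 ⁅x, d⁆ (lie_mem_right ℝ L I x d hd)
      -- The Leibniz rule on `⁅d, c⁆ = c` forces `q = s = 0`, so `x` acts on `I` as the element `p •
      -- d - r • c` of `I`.
      have h3 := leibniz_lie x d c
      rw [hdc, h2] at h3
      conv_rhs at h3 => rw [h1]
      rw [h1] at h3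
      simp only [add_lie, smul_lie, lie_self, hdc, smul_zero, zero_add, add_zero, lie_add,
        lie_smul] at h3
      have h4 : s • c - q • d = 0 := by
        have : p • c + q • d = p • c + s • c := by rw [h3]; abel
        rw [sub_eq_zero]; exact (add_left_cancel this).symm
      have hs : q = 0 := by
        by_contra hq
        exact hli (q⁻¹ * s) (by
          rw [mul_smul, sub_eq_zero.mp h4, smul_smul, inv_mul_cancel₀ hq, one_smul])
      have hs' : s = 0 := by
        rw [hs, zero_smul, sub_zero] at h4
        exact (smul_eq_zero.mp h4).resolve_right hc0
      rw [hs, zero_smul, add_zero] at h1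
      rw [hs', zero_smul, add_zero] at h2
      rw [Submodule.mem_sup]
      refine ⟨p • d - r • c, I.sub_mem (I.smul_mem _ hd) (I.smul_mem _ hc),
        x - (p • d - r • c), (hC _).mpr ⟨?_, ?_⟩, by abel⟩
      · simp [sub_lie, h1, hdc]
      · simp [sub_lie, h2, hcd]
  rcases hindec I C hcompl with h | h
  · exact hc0 (by rw [h] at hc; simpa using hc)
  · rw [h] at hcompl
    have : I = ⊤ := eq_top_of_isCompl_bot hcompl
    rw [this] at hI
    apply hdim
    rw [← hI]
    exact (finrank_top ℝ L).symm

end Decomposable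
end FrobeniusEight

/-! ### The radical and the semisimple quotient -/

namespace FrobeniusEight
open Module LieAlgebra
attribute [local instance 100] LieRing.ofAssociativeRing

section Radical
variable {L : Type*} [LieRing L] [LieAlgebra ℝ L]

/-- The projection onto the quotient by an ideal, as a morphism of Lie algebras. -/
def quotHom (I : LieIdeal ℝ L) : L →ₗ⁅ℝ⁆ L ⧸ I where
  toLinearMap := I.toSubmodule.mkQ
  map_lie' := rfl

theorem quotHom_surjective (I : LieIdeal ℝ L) : Function.Surjective (quotHom I) :=
  Submodule.Quotient.mk_surjective I.toSubmodule

@[simp] theorem quotHom_eq_zero {I : LieIdeal ℝ L} {x : L} : quotHom I x = 0 ↔ x ∈ I :=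
  Submodule.Quotient.mk_eq_zero I.toSubmodule

variable (L)

/-- The preimage of a solvable ideal is an extension of it by the radical, hence solvable, hence
contained in the radical. -/
theorem hasTrivialRadical_quotient_radical [FiniteDimensional ℝ L] :
    HasTrivialRadical ℝ (L ⧸ radical ℝ L) := by
  apply hasTrivialRadical_of_no_solvable_ideals
  intro J hJ
  set π := quotHom (radical ℝ L)
  have hk : ∀ k, derivedSeriesOfIdeal ℝ L k (J.comap π) ≤
      (derivedSeriesOfIdeal ℝ (L ⧸ radical ℝ L) k J).comap π := by
    intro k
    induction k with
    | zero => simp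
    | succ k ih =>
      rw [derivedSeriesOfIdeal_succ, derivedSeriesOfIdeal_succ]
      exact (LieSubmodule.mono_lie ih ih).trans (LieIdeal.comap_bracket_le π)
  obtain ⟨k, h1⟩ := (isSolvable_iff ℝ _).mp hJ
  obtain ⟨l, h2⟩ := (isSolvable_iff ℝ _).mp (radicalIsSolvable ℝ L)
  rw [LieIdeal.derivedSeries_eq_bot_iff] at h1 h2
  have h3 : derivedSeriesOfIdeal ℝ L k (J.comap π) ≤ radical ℝ L := by
    refine (hk k).trans ?_
    rw [h1]
    intro x hx
    rw [LieIdeal.mem_comap, LieSubmodule.mem_bot] at hx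
    exact quotHom_eq_zero.mp hx
  have h4 : IsSolvable (J.comap π) := by
    rw [isSolvable_iff ℝ]
    refine ⟨l + k, ?_⟩
    rw [LieIdeal.derivedSeries_eq_bot_iff, derivedSeriesOfIdeal_add, eq_bot_iff, ← h2]
    exact derivedSeriesOfIdeal_mono h3 l
  have h5 := (LieIdeal.solvable_iff_le_radical ℝ L _).mp h4
  rw [LieSubmodule.eq_bot_iff]
  intro y hy
  obtain ⟨x, rfl⟩ := quotHom_surjective _ y
  exact quotHom_eq_zero.mpr (h5 (LieIdeal.mem_comap.mpr hy))

/-- By invariance, the Killing-orthogonal of the derived ideal is central, so it vanishes. -/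
theorem span_lie_eq_top_of_isKilling [FiniteDimensional ℝ L] [IsKilling ℝ L] :
    Submodule.span ℝ {m : L | ∃ x y : L, ⁅x, y⁆ = m} = ⊤ := by
  rw [← LieAlgebra.coe_derivedSeries_one_eq]
  suffices derivedSeries ℝ L 1 = ⊤ by rw [this]; rfl
  set D := derivedSeries ℝ L 1
  have h0 : LieIdeal.killingCompl ℝ L D = ⊥ := by
    rw [LieSubmodule.eq_bot_iff]
    intro x hx
    rw [LieIdeal.mem_killingCompl] at hx
    have hc : x ∈ center ℝ L := by
      rw [LieModule.mem_maxTrivSubmodule]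
      intro y
      apply (IsKilling.killingForm_nondegenerate ℝ L).1
      intro z
      have h1 := hx ⁅z, y⁆ (LieSubmodule.lie_mem_lie (LieSubmodule.mem_top z)
        (LieSubmodule.mem_top y))
      rw [LieModule.traceForm_comm]
      exact (LieModule.traceForm_apply_lie_apply ℝ L L z y x).symm.trans h1
    simpa using hc
  have := LieIdeal.isCompl_killingCompl (K := ℝ) D
  rw [h0] at this
  exact eq_top_of_isCompl_bot this

variable {L}

/-- If the radical is abelian then the adjoint representation is unimodular. -/
theorem traceAd_eq_zero_of_radical_abelian [FiniteDimensional ℝ L]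
    (h : ∀ x ∈ radical ℝ L, ∀ y ∈ radical ℝ L, ⁅x, y⁆ = 0) (x : L) :
    traceAd L x = 0 := by
  have := hasTrivialRadical_quotient_radical L
  have hp := span_lie_eq_top_of_isKilling (L ⧸ radical ℝ L)
  -- The quotient is perfect, so every element is, modulo the radical, a combination of brackets, on
  -- which the trace of `ad` vanishes.
  have h1 : ∀ y : L ⧸ radical ℝ L, ∃ x ∈ Submodule.span ℝ {m : L | ∃ x y : L, ⁅x, y⁆ = m},
      quotHom (radical ℝ L) x = y := by
    intro y
    have hy : y ∈ Submodule.span ℝ {m | ∃ x y : L ⧸ radical ℝ L, ⁅x, y⁆ = m} := by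
      rw [hp]; trivial
    induction hy using Submodule.span_induction with
    | mem y hy =>
      obtain ⟨u, v, rfl⟩ := hy
      obtain ⟨u, rfl⟩ := quotHom_surjective _ u
      obtain ⟨v, rfl⟩ := quotHom_surjective _ v
      exact ⟨⁅u, v⁆, Submodule.subset_span ⟨u, v, rfl⟩, LieHom.map_lie _ _ _⟩
    | zero => exact ⟨0, Submodule.zero_mem _, map_zero _⟩
    | add y z _ _ hy hz =>
      obtain ⟨u, hu, rfl⟩ := hy
      obtain ⟨v, hv, rfl⟩ := hz
      exact ⟨u + v, Submodule.add_mem _ hu hv, map_add _ _ _⟩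
    | smul c y _ hy =>
      obtain ⟨u, hu, rfl⟩ := hy
      exact ⟨c • u, Submodule.smul_mem _ c hu, map_smul _ _ _⟩
  obtain ⟨u, hu, hux⟩ := h1 (quotHom _ x)
  have hr : x - u ∈ radical ℝ L := by
    rw [← quotHom_eq_zero, map_sub, hux, sub_self]
  have h2 := traceAd_eq_zero_of_mem_span hu
  have h3 : traceAd L (x - u) = 0 := by
    rw [traceAd_apply]
    apply IsNilpotent.eq_zero
    apply LinearMap.isNilpotent_trace_of_isNilpotent
    -- `ad (x - u)` sends `L` into the radical, where `x - u` acts by zero, so its square is zero.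
    refine ⟨2, ?_⟩
    ext y
    rw [pow_two]
    exact h _ hr _ (lie_mem_left ℝ L _ _ _ hr)
  rw [map_sub, h2, sub_zero] at h3
  exact h3

end Radical
end FrobeniusEight

/-! ### The two three-dimensional simple algebras, and the dimension of the semisimple quotient -/

namespace FrobeniusEight
open Module LieAlgebra
attribute [local instance 100] LieRing.ofAssociativeRing

/-- `x, y, z` satisfy the relations of a three-dimensional simple algebra: compact for `ε = 1`,
split for `ε = -1`. -/
def IsTriple {Q : Type*} [LieRing Q] [LieAlgebra ℝ Q] (ε : ℝ) (x y z : Q) : Prop :=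
  ⁅x, y⁆ = ε • z ∧ ⁅y, z⁆ = x ∧ ⁅z, x⁆ = y

section Triple
variable {Q : Type*} [LieRing Q] [LieAlgebra ℝ Q]

/-- In a Killing-orthogonal basis, invariance makes each `⁅e i, e j⁆` orthogonal to `e i` and `e j`,
hence a multiple of the third vector. The three coefficients share the numerator `κ(⁅e 0, e 1⁆, e
2)`, which could vanish only in an abelian algebra. -/
theorem exists_orthogonal_brackets [FiniteDimensional ℝ Q] [IsKilling ℝ Q]
    (hQ : finrank ℝ Q = 3) :
    ∃ (e : Basis (Fin 3) ℝ Q) (a b c : ℝ), a ≠ 0 ∧ b ≠ 0 ∧ c ≠ 0 ∧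
      ⁅e 0, e 1⁆ = c • e 2 ∧ ⁅e 1, e 2⁆ = a • e 0 ∧ ⁅e 2, e 0⁆ = b • e 1 := by
  have hnd := IsKilling.killingForm_nondegenerate ℝ Q
  obtain ⟨v, hv⟩ := LinearMap.BilinForm.exists_orthogonal_basis
    (LieModule.traceForm_isSymm ℝ Q Q)
  let e : Basis (Fin 3) ℝ Q := v.reindex (finCongr hQ)
  have hoe : ∀ i j, i ≠ j → killingForm ℝ Q (e i) (e j) = 0 := by
    intro i j hij
    simp only [e, Basis.reindex_apply]
    exact hv (by simpa using hij)
  set κ := killingForm ℝ Q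
  have hd : ∀ i, κ (e i) (e i) ≠ 0 := by
    intro i hi
    apply e.ne_zero i
    apply hnd.1
    intro y
    have : κ (e i) = 0 := e.ext fun j => by
      by_cases hij : i = j
      · rw [← hij, hi]; rfl
      · rw [hoe i j hij]; rfl
    rw [this]; rfl
  have hexp : ∀ x, x = ∑ i, (κ x (e i) / κ (e i) (e i)) • e i := by
    intro x
    have : ∀ j, e.repr x j = κ x (e j) / κ (e j) (e j) := by
      intro j
      rw [eq_div_iff (hd j)]
      conv_rhs => rw [← e.sum_repr x]
      rw [map_sum, LinearMap.sum_apply, Finset.sum_eq_single j]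
      · simp
      · intro i _ hij
        rw [map_smul, LinearMap.smul_apply, hoe i j hij, smul_zero]
      · simp
    conv_lhs => rw [← e.sum_repr x]
    simp only [this]
  have hinv : ∀ x y z, κ ⁅x, y⁆ z = κ x ⁅y, z⁆ := LieModule.traceForm_apply_lie_apply ℝ Q Q
  have hcomm : ∀ x y, κ x y = κ y x := LieModule.traceForm_comm ℝ Q Q
  have hself : ∀ x y, κ ⁅x, y⁆ y = 0 := fun x y => by rw [hinv, lie_self, map_zero]
  have hself' : ∀ x y, κ ⁅x, y⁆ x = 0 := fun x y => by
    rw [← lie_skew, map_neg, LinearMap.neg_apply, hself, neg_zero]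
  set c := κ ⁅e 0, e 1⁆ (e 2) with hcdef
  have h12 : κ ⁅e 1, e 2⁆ (e 0) = c := by rw [hcomm, ← hinv]
  have h20 : κ ⁅e 2, e 0⁆ (e 1) = c := by rw [hinv, hcomm]
  have b01 : ⁅e 0, e 1⁆ = (c / κ (e 2) (e 2)) • e 2 := by
    conv_lhs => rw [hexp ⁅e 0, e 1⁆]
    simp [Fin.sum_univ_three, hself, hself', hcdef]
  have b12 : ⁅e 1, e 2⁆ = (c / κ (e 0) (e 0)) • e 0 := by
    conv_lhs => rw [hexp ⁅e 1, e 2⁆]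
    simp [Fin.sum_univ_three, hself, hself', h12]
  have b20 : ⁅e 2, e 0⁆ = (c / κ (e 1) (e 1)) • e 1 := by
    conv_lhs => rw [hexp ⁅e 2, e 0⁆]
    simp [Fin.sum_univ_three, hself, hself', h20]
  have hc : c ≠ 0 := by
    intro hc
    simp only [hc, zero_div, zero_smul] at b01 b12 b20
    have b10 : ⁅e 1, e 0⁆ = 0 := by rw [← lie_skew, b01, neg_zero]
    have b21 : ⁅e 2, e 1⁆ = 0 := by rw [← lie_skew, b12, neg_zero]
    have b02 : ⁅e 0, e 2⁆ = 0 := by rw [← lie_skew, b20, neg_zero]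
    have hab : ∀ x y : Q, ⁅x, y⁆ = 0 := by
      intro x y
      rw [← e.sum_repr x, ← e.sum_repr y, Fin.sum_univ_three, Fin.sum_univ_three]
      simp only [add_lie, lie_add, smul_lie, lie_smul, lie_self, b01, b12, b20, b10, b21, b02,
        smul_zero, add_zero]
    have : IsLieAbelian Q := ⟨hab⟩
    have := (IsKilling.isLieAbelian_iff_subsingleton ℝ Q).mp this
    rw [finrank_zero_of_subsingleton] at hQ
    omega
  exact ⟨e, _, _, _, div_ne_zero hc (hd 0), div_ne_zero hc (hd 1), div_ne_zero hc (hd 2),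
    b01, b12, b20⟩

/-- A spanning triple `x, y, z` with `⁅x, y⁆ = r z`, `⁅y, z⁆ = p x`, `⁅z, x⁆ = q y`. -/
def HasTriple (Q : Type*) [LieRing Q] [LieAlgebra ℝ Q] (p q r : ℝ) : Prop :=
  ∃ x y z : Q, (∀ w : Q, ∃ a b c : ℝ, w = a • x + b • y + c • z) ∧
    ⁅x, y⁆ = r • z ∧ ⁅y, z⁆ = p • x ∧ ⁅z, x⁆ = q • y

theorem HasTriple.rotate {p q r : ℝ} (h : HasTriple Q p q r) : HasTriple Q q r p := by
  obtain ⟨x, y, z, hs, h1, h2, h3⟩ := h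
  refine ⟨y, z, x, fun w => ?_, h2, h3, h1⟩
  obtain ⟨a, b, c, rfl⟩ := hs w
  exact ⟨b, c, a, by abel⟩

theorem HasTriple.scale {p q r : ℝ} (h : HasTriple Q p q r) {s t u : ℝ} (hs : s ≠ 0)
    (ht : t ≠ 0) (hu : u ≠ 0) : HasTriple Q (t * u * p / s) (u * s * q / t) (s * t * r / u) := by
  obtain ⟨x, y, z, hw, h1, h2, h3⟩ := h
  refine ⟨s • x, t • y, u • z, fun w => ?_, ?_, ?_, ?_⟩
  · obtain ⟨a, b, c, rfl⟩ := hw w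
    exact ⟨a / s, b / t, c / u, by simp only [smul_smul]; field_simp⟩
  · rw [smul_lie, lie_smul, h1]; simp only [smul_smul]; congr 1; field_simp
  · rw [smul_lie, lie_smul, h2]; simp only [smul_smul]; congr 1; field_simp
  · rw [smul_lie, lie_smul, h3]; simp only [smul_smul]; congr 1; field_simp

theorem HasTriple.neg {p q r : ℝ} (h : HasTriple Q p q r) : HasTriple Q (-p) (-q) (-r) := by
  have := h.scale (s := -1) (t := -1) (u := -1) (by norm_num) (by norm_num) (by norm_num)
  convert this using 1 <;> ring

theorem HasTriple.normalize {p q r : ℝ} (h : HasTriple Q p q r) (hp : p ≠ 0) (hq : q ≠ 0)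
    (hr : r ≠ 0) : HasTriple Q (p / |p|) (q / |q|) (r / |r|) := by
  have hp' := abs_pos.mpr hp
  have hq' := abs_pos.mpr hq
  have hr' := abs_pos.mpr hr
  have sp := Real.sqrt_pos.mpr hp'
  have sq := Real.sqrt_pos.mpr hq'
  have sr := Real.sqrt_pos.mpr hr'
  -- With these scales `t * u / s = 1 / |p|`, and cyclically.
  have := h.scale (s := 1 / (√|q| * √|r|)) (t := 1 / (√|r| * √|p|)) (u := 1 / (√|p| * √|q|))
    (by positivity) (by positivity) (by positivity)
  convert this using 1
  · nth_rewrite 1 [← Real.mul_self_sqrt hp'.le]; field_simp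
  · nth_rewrite 1 [← Real.mul_self_sqrt hq'.le]; field_simp
  · nth_rewrite 1 [← Real.mul_self_sqrt hr'.le]; field_simp

theorem HasTriple.isTriple {ε : ℝ} (h : HasTriple Q 1 1 ε) : ∃ x y z : Q,
    (∀ w : Q, ∃ a b c : ℝ, w = a • x + b • y + c • z) ∧ IsTriple ε x y z := by
  obtain ⟨x, y, z, hw, h1, h2, h3⟩ := h
  exact ⟨x, y, z, hw, h1, by simpa using h2, by simpa using h3⟩

/-- Three-dimensional real Lie algebras with non-degenerate Killing form: there are two of them. -/
theorem exists_isTriple [FiniteDimensional ℝ Q] [IsKilling ℝ Q] (hQ : finrank ℝ Q = 3) :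
    ∃ ε : ℝ, (ε = 1 ∨ ε = -1) ∧ ∃ x y z : Q,
      (∀ w : Q, ∃ a b c : ℝ, w = a • x + b • y + c • z) ∧ IsTriple ε x y z := by
  obtain ⟨e, a, b, c, ha, hb, hc, h1, h2, h3⟩ := exists_orthogonal_brackets hQ
  have h : HasTriple Q a b c := ⟨e 0, e 1, e 2, fun w => ⟨e.repr w 0, e.repr w 1, e.repr w 2, by
    conv_lhs => rw [← e.sum_repr w]
    rw [Fin.sum_univ_three]⟩, h1, h2, h3⟩
  have hn := h.normalize ha hb hc
  have hsgn : ∀ t : ℝ, t ≠ 0 → t / |t| = 1 ∨ t / |t| = -1 := by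
    intro t ht
    rcases lt_or_gt_of_ne ht with h | h
    · right; rw [abs_of_neg h]; field_simp
    · left; rw [abs_of_pos h]; field_simp
  -- Negation and cyclic rotation bring the eight sign patterns to `(1, 1, 1)` or `(1, 1, -1)`.
  have hm := hn.neg
  rcases hsgn a ha with h1 | h1 <;> rcases hsgn b hb with h2 | h2 <;>
    rcases hsgn c hc with h3 | h3 <;> rw [h1, h2, h3] at hn hm <;>
    try simp only [neg_neg] at hm
  · exact ⟨1, .inl rfl, hn.isTriple⟩
  · exact ⟨-1, .inr rfl, hn.isTriple⟩
  · exact ⟨-1, .inr rfl, hn.rotate.rotate.isTriple⟩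
  · exact ⟨-1, .inr rfl, hm.rotate.isTriple⟩
  · exact ⟨-1, .inr rfl, hn.rotate.isTriple⟩
  · exact ⟨-1, .inr rfl, hm.rotate.rotate.isTriple⟩
  · exact ⟨-1, .inr rfl, hm.isTriple⟩
  · exact ⟨1, .inl rfl, hm.isTriple⟩

end Triple

section Dimension
variable {L : Type*} [LieRing L] [LieAlgebra ℝ L]

theorem IsFrobenius.exists_isRegularForm (h : IsFrobenius L) :
    ∃ β : Dual ℝ L, IsRegularForm β := by
  obtain ⟨ω, hω, β, hβ⟩ := h
  refine ⟨β, fun x hx => hω.nondegenerate.1 x fun y => ?_⟩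
  rw [hβ, hx, neg_zero]

/-- A quotient of dimension at least six leaves a radical of dimension at most two. This is abelian,
by indecomposability when it is a plane, and then `L` is unimodular, against the existence of a
principal element. A zero quotient would make `L` solvable. -/
theorem finrank_quotient_radical [FiniteDimensional ℝ L] (hdim : finrank ℝ L = 8)
    (hFrob : IsFrobenius L) (hindec : IsIndecomposable L) (hsolv : ¬ IsSolvable L) :
    finrank ℝ (L ⧸ radical ℝ L) = 3 := by
  obtain ⟨β, hβ⟩ := hFrob.exists_isRegularForm
  have := hasTrivialRadical_quotient_radical L
  have hsum : finrank ℝ (L ⧸ radical ℝ L) + finrank ℝ (radical ℝ L) = finrank ℝ L :=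
    Submodule.finrank_quotient_add_finrank (radical ℝ L).toSubmodule
  have hna : ¬ ∀ x ∈ radical ℝ L, ∀ y ∈ radical ℝ L, ⁅x, y⁆ = 0 := by
    intro h
    have h0 : traceAd L = 0 := LinearMap.ext fun x => traceAd_eq_zero_of_radical_abelian h x
    have := hβ.finrank_eq_zero h0
    omega
  rcases finrank_killing (Q := L ⧸ radical ℝ L) with h | h | h
  · exfalso
    have h8 : finrank ℝ (radical ℝ L).toSubmodule = finrank ℝ L := by
      change finrank ℝ (radical ℝ L) = _; omega
    have htop := Submodule.eq_top_of_finrank_eq h8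
    apply hsolv
    have hsur : Function.Surjective (LieIdeal.incl (radical ℝ L)) := fun x =>
      ⟨⟨x, by rw [← LieSubmodule.mem_toSubmodule, htop]; trivial⟩, rfl⟩
    exact hsur.lieAlgebra_isSolvable
  · exact h
  · exfalso
    apply hna
    have hle : finrank ℝ (radical ℝ L) ≤ 2 := by omega
    by_cases h2 : finrank ℝ (radical ℝ L) = 2
    · exact hindec.lie_eq_zero_of_finrank_two (by omega) _ h2
    · have h1 : finrank ℝ (radical ℝ L) ≤ 1 := by omega
      obtain ⟨v, hv⟩ := finrank_le_one_iff.mp h1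
      intro x hx y hy
      obtain ⟨c, hc⟩ := hv ⟨x, hx⟩
      obtain ⟨d, hd⟩ := hv ⟨y, hy⟩
      have hc' : x = c • (v : L) := by simpa using (congrArg Subtype.val hc).symm
      have hd' : y = d • (v : L) := by simpa using (congrArg Subtype.val hd).symm
      rw [hc', hd', smul_lie, lie_smul, lie_self, smul_zero, smul_zero]

end Dimension
end FrobeniusEight

/-! ### The Casimir operator and the lifting of triples -/

namespace FrobeniusEight
open Module LieAlgebra
attribute [local instance 100] LieRing.ofAssociativeRing

section Casimir
variable {V : Type*} [AddCommGroup V] [Module ℝ V]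

/-- The Casimir operator of a triple of endomorphisms. -/
def casimir (ε : ℝ) (X Y Z : Module.End ℝ V) : Module.End ℝ V := X * X + Y * Y + ε • (Z * Z)

variable {ε : ℝ} {X Y Z : Module.End ℝ V}

theorem IsTriple.mul_eq (h : IsTriple ε X Y Z) :
    X * Y = Y * X + ε • Z ∧ Y * Z = Z * Y + X ∧ Z * X = X * Z + Y := by
  obtain ⟨h1, h2, h3⟩ := h
  rw [LieRing.of_associative_ring_bracket] at h1 h2 h3
  exact ⟨by rw [← h1]; abel, by rw [← h2]; abel, by rw [← h3]; abel⟩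

theorem IsTriple.commute_casimir (h : IsTriple ε X Y Z) :
    Commute X (casimir ε X Y Z) ∧ Commute Y (casimir ε X Y Z) ∧ Commute Z (casimir ε X Y Z) := by
  obtain ⟨h1, h2, h3⟩ := h.mul_eq
  have hZ : ε • Z = X * Y - Y * X := by rw [h1]; abel
  have hX : X = Y * Z - Z * Y := by rw [h2]; abel
  have hY : Y = Z * X - X * Z := by rw [h3]; abel
  simp only [casimir, commute_iff_eq]
  refine ⟨?_, ?_, ?_⟩
  · have e1 : X * (Y * Y) - Y * Y * X = ε • (Z * Y) + ε • (Y * Z) := by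
      rw [← smul_mul_assoc, ← mul_smul_comm, hZ]; noncomm_ring
    have e2 : X * (Z * Z) - Z * Z * X = -(Y * Z) - Z * Y := by
      conv_rhs => rw [hY]
      noncomm_ring
    rw [← sub_eq_zero]
    calc _ = (X * (Y * Y) - Y * Y * X) + ε • (X * (Z * Z) - Z * Z * X) := by
            rw [smul_sub, ← mul_smul_comm, ← smul_mul_assoc]; noncomm_ring
      _ = 0 := by rw [e1, e2]; module
  · have e1 : Y * (X * X) - X * X * Y = -(ε • (Z * X)) - ε • (X * Z) := by
      rw [← smul_mul_assoc, ← mul_smul_comm, hZ]; noncomm_ring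
    have e2 : Y * (Z * Z) - Z * Z * Y = X * Z + Z * X := by
      conv_rhs => rw [hX]
      noncomm_ring
    rw [← sub_eq_zero]
    calc _ = (Y * (X * X) - X * X * Y) + ε • (Y * (Z * Z) - Z * Z * Y) := by
            rw [smul_sub, ← mul_smul_comm, ← smul_mul_assoc]; noncomm_ring
      _ = 0 := by rw [e1, e2]; module
  · have e1 : Z * (X * X) - X * X * Z = X * Y + Y * X := by
      conv_rhs => rw [hY]
      noncomm_ring
    have e2 : Z * (Y * Y) - Y * Y * Z = -(X * Y) - Y * X := by
      conv_rhs => rw [hX]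
      noncomm_ring
    rw [← sub_eq_zero]
    calc _ = (Z * (X * X) - X * X * Z) + (Z * (Y * Y) - Y * Y * Z) := by
            rw [mul_add, add_mul, mul_smul_comm, smul_mul_assoc]; noncomm_ring
      _ = 0 := by rw [e1, e2]; module

/-- A triple with nilpotent Casimir operator is zero. -/
theorem IsTriple.eq_zero_of_isNilpotent [FiniteDimensional ℝ V] (h : IsTriple ε X Y Z)
    (hε : ε ≠ 0) (hC : IsNilpotent (casimir ε X Y Z)) : X = 0 ∧ Y = 0 ∧ Z = 0 := by
  obtain ⟨h1, h2, h3⟩ := h.mul_eq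
  have hZ : ε • Z = X * Y - Y * X := by rw [h1]; abel
  have hX : X = Y * Z - Z * Y := by rw [h2]; abel
  have hY : Y = Z * X - X * Z := by rw [h3]; abel
  set τ := LinearMap.trace ℝ V
  have hτ : ∀ A B : Module.End ℝ V, τ (A * B) = τ (B * A) := LinearMap.trace_mul_comm ℝ
  have hbr : ∀ A B D : Module.End ℝ V, τ ((A * B - B * A) * D) = τ (A * (B * D - D * B)) := by
    intro A B D
    rw [sub_mul, mul_sub, map_sub, map_sub, mul_assoc, mul_assoc, hτ B (A * D), mul_assoc]
  have tXY : τ (X * Y) = 0 := by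
    rw [hτ]
    calc τ (Y * X) = τ ((Z * X - X * Z) * X) := by rw [← hY]
      _ = 0 := by rw [hbr, sub_self, mul_zero, map_zero]
  have tYZ : τ (Y * Z) = 0 := by
    calc τ (Y * Z) = -τ ((X * Z - Z * X) * Z) := by
          rw [← neg_sub (Z * X), ← hY, neg_mul, map_neg, neg_neg]
      _ = 0 := by rw [hbr, sub_self, mul_zero, map_zero, neg_zero]
  have tXZ : τ (X * Z) = 0 := by
    calc τ (X * Z) = τ ((Y * Z - Z * Y) * Z) := by rw [← hX]
      _ = 0 := by rw [hbr, sub_self, mul_zero, map_zero]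
  have t1 : ε * τ (Z * Z) = τ (X * X) := by
    rw [← smul_eq_mul, ← map_smul, ← smul_mul_assoc, hZ, hbr, ← hX]
  have t2 : τ (Y * Y) = τ (X * X) := by
    calc τ (Y * Y) = τ ((Z * X - X * Z) * Y) := by rw [← hY]
      _ = τ (X * X) := by rw [hbr, ← hZ, mul_smul_comm, map_smul, smul_eq_mul, t1]
  -- The three terms of the Casimir operator have equal traces, so its trace is three times that of
  -- `X * X`; nilpotency makes it zero.
  have tXX : τ (X * X) = 0 := by
    have := (LinearMap.isNilpotent_trace_of_isNilpotent hC).eq_zero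
    rw [casimir, map_add, map_add, map_smul, smul_eq_mul] at this
    linarith
  have tZZ : τ (Z * Z) = 0 := by
    rw [tXX] at t1
    exact (mul_eq_zero.mp t1).resolve_left hε
  -- The trace form vanishes on the span of the triple, so Cartan's criterion makes the derived
  -- algebra act nilpotently; it contains `X = ⁅Y, Z⁆`.
  let S : LieSubalgebra ℝ (Module.End ℝ V) :=
    { toSubmodule := Submodule.span ℝ {X, Y, Z}
      lie_mem' := by
        intro a b ha hb
        induction ha, hb using Submodule.span_induction₂ with
        | mem_mem a b ha hb =>
          have e1 : ⁅X, Y⁆ ∈ Submodule.span ℝ {X, Y, Z} := by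
            rw [h.1]; exact Submodule.smul_mem _ _ (Submodule.subset_span (by simp))
          have e2 : ⁅Y, Z⁆ ∈ Submodule.span ℝ {X, Y, Z} := by
            rw [h.2.1]; exact Submodule.subset_span (by simp)
          have e3 : ⁅Z, X⁆ ∈ Submodule.span ℝ {X, Y, Z} := by
            rw [h.2.2]; exact Submodule.subset_span (by simp)
          have hneg : ∀ A B : Module.End ℝ V, ⁅A, B⁆ ∈ Submodule.span ℝ {X, Y, Z} →
              ⁅B, A⁆ ∈ Submodule.span ℝ {X, Y, Z} := fun A B hAB => by
            rw [← lie_skew]; exact Submodule.neg_mem _ hAB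
          simp only [Set.mem_insert_iff, Set.mem_singleton_iff] at ha hb
          rcases ha with rfl | rfl | rfl <;> rcases hb with rfl | rfl | rfl <;>
            first
            | (rw [lie_self]; exact Submodule.zero_mem _)
            | assumption
            | (apply hneg; assumption)
        | zero_left b hb => rw [zero_lie]; exact Submodule.zero_mem _
        | zero_right a ha => rw [lie_zero]; exact Submodule.zero_mem _
        | add_left a b c _ _ _ h1 h2 => rw [add_lie]; exact Submodule.add_mem _ h1 h2
        | add_right a b c _ _ _ h1 h2 => rw [lie_add]; exact Submodule.add_mem _ h1 h2
        | smul_left r a b _ _ h1 => rw [smul_lie]; exact Submodule.smul_mem _ _ h1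
        | smul_right r a b _ _ h1 => rw [lie_smul]; exact Submodule.smul_mem _ _ h1 }
  have hXS : X ∈ S := Submodule.subset_span (by simp)
  have hYS : Y ∈ S := Submodule.subset_span (by simp)
  have hZS : Z ∈ S := Submodule.subset_span (by simp)
  have htr : LieModule.traceForm ℝ S V = 0 := by
    have key : ∀ a ∈ Submodule.span ℝ {X, Y, Z}, ∀ b ∈ Submodule.span ℝ {X, Y, Z},
        τ (a * b) = 0 := by
      intro a ha b hb
      induction ha, hb using Submodule.span_induction₂ with
      | mem_mem a b ha hb =>
        simp only [Set.mem_insert_iff, Set.mem_singleton_iff] at ha hb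
        rcases ha with rfl | rfl | rfl <;> rcases hb with rfl | rfl | rfl <;>
          first
          | assumption
          | (rw [hτ]; assumption)
          | (rw [t2]; assumption)
      | zero_left b hb => rw [zero_mul, map_zero]
      | zero_right a ha => rw [mul_zero, map_zero]
      | add_left a b c _ _ _ h1 h2 => rw [add_mul, map_add, h1, h2, add_zero]
      | add_right a b c _ _ _ h1 h2 => rw [mul_add, map_add, h1, h2, add_zero]
      | smul_left r a b _ _ h1 => rw [smul_mul_assoc, map_smul, h1, smul_zero]
      | smul_right r a b _ _ h1 => rw [mul_smul_comm, map_smul, h1, smul_zero]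
    ext a b
    exact key a a.2 b b.2
  have hnil : IsNilpotent X := by
    have h4 := LieModule.isNilpotent_derivedSeries_of_traceForm_eq_zero (R := ℝ) (L := S)
      (M := V) htr
    have h5 : (⟨X, hXS⟩ : S) ∈ derivedSeries ℝ S 1 := by
      have : (⟨X, hXS⟩ : S) = ⁅(⟨Y, hYS⟩ : S), (⟨Z, hZS⟩ : S)⁆ := Subtype.ext h.2.1.symm
      rw [this]
      exact LieSubmodule.lie_mem_lie (LieSubmodule.mem_top _) (LieSubmodule.mem_top _)
    have := LieModule.isNilpotent_toEnd_of_isNilpotent ℝ (derivedSeries ℝ S 1) V ⟨_, h5⟩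
    exact this
  obtain ⟨k, hk⟩ := LieAlgebra.isNilpotent_ad_of_isNilpotent (R := ℝ) (L := S)
    (x := ⟨X, hXS⟩) hnil
  -- `(ad X)²` multiplies `Y` by `-ε ≠ 0`, which is incompatible with nilpotency of `ad X` unless `Y
  -- = 0`.
  have hY0 : Y = 0 := by
    have hyy : ∀ n, (((ad ℝ S ⟨X, hXS⟩) ^ (2 * n)) ⟨Y, hYS⟩ : S) = (-ε) ^ n • (⟨Y, hYS⟩ : S) := by
      have hstep : ⁅(⟨X, hXS⟩ : S), ⁅(⟨X, hXS⟩ : S), (⟨Y, hYS⟩ : S)⁆⁆ = (-ε) • (⟨Y, hYS⟩ : S) := by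
        apply Subtype.ext
        change ⁅X, ⁅X, Y⁆⁆ = (-ε) • Y
        rw [h.1, lie_smul, ← lie_skew, h.2.2, smul_neg, neg_smul]
      intro n
      induction n with
      | zero => simp
      | succ n ih =>
        rw [mul_add, mul_one, pow_add, Module.End.mul_apply, pow_two, Module.End.mul_apply,
          ad_apply, ad_apply, hstep, map_smul, ih, pow_succ, smul_smul, mul_comm]
    have h6 := hyy k
    rw [mul_comm, pow_mul, hk, zero_pow (by norm_num)] at h6
    have h7 : (-ε) ^ k • Y = 0 := (congrArg Subtype.val h6).symm
    exact (smul_eq_zero.mp h7).resolve_left (pow_ne_zero _ (neg_ne_zero.mpr hε))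
  have hX0 : X = 0 := by rw [hX, hY0]; simp
  refine ⟨hX0, hY0, ?_⟩
  rw [hX0, hY0] at hZ
  simpa [hε] using hZ

/-- The Fitting decomposition with respect to the Casimir operator. -/
theorem IsTriple.isCompl_ker_range [FiniteDimensional ℝ V] (h : IsTriple ε X Y Z) (hε : ε ≠ 0) :
    IsCompl (LinearMap.ker (casimir ε X Y Z)) (LinearMap.range (casimir ε X Y Z)) ∧
      ∀ v ∈ LinearMap.ker (casimir ε X Y Z), X v = 0 ∧ Y v = 0 ∧ Z v = 0 := by
  obtain ⟨cX, cY, cZ⟩ := h.commute_casimir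
  set C := casimir ε X Y Z with hCdef
  -- Fitting's lemma gives the splitting for a high power of `C`. On `ker (C ^ n)` the restricted
  -- Casimir operator is nilpotent, so the triple acts by zero and `C` vanishes there; the power can
  -- be removed. An exponent of at least two serves to place `ker (C ^ 2)` in `ker (C ^ n)`.
  obtain ⟨N, hN⟩ := Filter.eventually_atTop.mp C.eventually_isCompl_ker_pow_range_pow
  set n := N + 2
  have hn := hN n (by omega)
  have hmap : ∀ A : Module.End ℝ V, Commute A C →
      ∀ v ∈ LinearMap.ker (C ^ n), A v ∈ LinearMap.ker (C ^ n) := by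
    intro A hA v hv
    rw [LinearMap.mem_ker] at hv ⊢
    rw [← Module.End.mul_apply, ← (hA.pow_right n).eq, Module.End.mul_apply, hv, map_zero]
  have hvan : ∀ v ∈ LinearMap.ker (C ^ n), X v = 0 ∧ Y v = 0 ∧ Z v = 0 := by
    let X' := X.restrict (hmap X cX)
    let Y' := Y.restrict (hmap Y cY)
    let Z' := Z.restrict (hmap Z cZ)
    have hT : IsTriple ε X' Y' Z' := by
      refine ⟨?_, ?_, ?_⟩
      · ext v; exact LinearMap.congr_fun h.1 v
      · ext v; exact LinearMap.congr_fun h.2.1 v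
      · ext v; exact LinearMap.congr_fun h.2.2 v
    have hpow : ∀ (k : ℕ) (v : LinearMap.ker (C ^ n)),
        (((casimir ε X' Y' Z') ^ k) v : V) = (C ^ k) v := by
      intro k
      induction k with
      | zero => intro v; rfl
      | succ k ih =>
        intro v
        rw [pow_succ (casimir ε X' Y' Z'), Module.End.mul_apply, ih, pow_succ C k]
        rfl
    have hnil : IsNilpotent (casimir ε X' Y' Z') := ⟨n, by ext v; rw [hpow]; exact v.2⟩
    obtain ⟨h1, h2, h3⟩ := hT.eq_zero_of_isNilpotent hε hnil
    exact fun v hv => ⟨congrArg Subtype.val (LinearMap.congr_fun h1 ⟨v, hv⟩),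
      congrArg Subtype.val (LinearMap.congr_fun h2 ⟨v, hv⟩),
      congrArg Subtype.val (LinearMap.congr_fun h3 ⟨v, hv⟩)⟩
  have hle : ∀ k, 1 ≤ k → LinearMap.ker C ≤ LinearMap.ker (C ^ k) := by
    intro k hk v hv
    rw [LinearMap.mem_ker] at hv ⊢
    obtain ⟨j, rfl⟩ := Nat.exists_eq_add_of_le' hk
    rw [pow_succ, Module.End.mul_apply, hv, map_zero]
  have hC0 : ∀ v ∈ LinearMap.ker (C ^ n), C v = 0 := by
    intro v hv
    obtain ⟨h1, h2, h3⟩ := hvan v hv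
    simp [hCdef, casimir, h1, h2, h3]
  refine ⟨?_, fun v hv => hvan v (hle n (by omega) hv)⟩
  constructor
  · rw [Submodule.disjoint_def]
    rintro v hv ⟨w, rfl⟩
    apply hC0
    rw [LinearMap.mem_ker] at hv ⊢
    rw [show n = N + 1 + 1 from rfl, pow_succ, pow_succ, Module.End.mul_apply,
      Module.End.mul_apply, hv, map_zero]
  · refine hn.codisjoint.mono hC0 ?_
    rintro _ ⟨w, rfl⟩
    rw [show n = N + 1 + 1 from rfl, pow_succ', Module.End.mul_apply]
    exact ⟨_, rfl⟩

/-- Vanishing of the second cohomology of a triple. -/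
theorem IsTriple.exists_correction [FiniteDimensional ℝ V] (h : IsTriple ε X Y Z) (hε : ε ≠ 0)
    {w₁ w₂ w₃ : V} (hw : X w₁ + Y w₂ + Z w₃ = 0) :
    ∃ v₁ v₂ v₃ : V, v₁ = w₁ + Y v₃ - Z v₂ ∧ v₂ = w₂ + Z v₁ - X v₃ ∧
      ε • v₃ = w₃ + X v₂ - Y v₁ := by
  obtain ⟨hc, hk⟩ := h.isCompl_ker_range hε
  obtain ⟨cX, cY, cZ⟩ := h.commute_casimir
  obtain ⟨h1, h2, h3⟩ := h.mul_eq
  set C := casimir ε X Y Z with hCdef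
  have cX' : ∀ v, X (C v) = C (X v) := LinearMap.congr_fun cX
  have cY' : ∀ v, Y (C v) = C (Y v) := LinearMap.congr_fun cY
  have cZ' : ∀ v, Z (C v) = C (Z v) := LinearMap.congr_fun cZ
  -- Splitting off `C` twice makes the later `u i = C (t i)` lie in the range of `C`, where `C` is
  -- injective; thus the cocycle condition on the `w i` passes to the `u i`.
  have hsplit : ∀ w : V, ∃ s u : V, C s = 0 ∧ w = s + C (C u) := by
    intro w
    obtain ⟨s, hs, _, ⟨t, rfl⟩, rfl⟩ := Submodule.mem_sup.mp
      (show w ∈ LinearMap.ker C ⊔ LinearMap.range C by rw [hc.sup_eq_top]; trivial)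
    obtain ⟨s', hs', _, ⟨u, rfl⟩, rfl⟩ := Submodule.mem_sup.mp
      (show t ∈ LinearMap.ker C ⊔ LinearMap.range C by rw [hc.sup_eq_top]; trivial)
    exact ⟨s, u, hs, by rw [map_add, LinearMap.mem_ker.mp hs', zero_add]⟩
  obtain ⟨s₁, t₁, hs₁, rfl⟩ := hsplit w₁
  obtain ⟨s₂, t₂, hs₂, rfl⟩ := hsplit w₂
  obtain ⟨s₃, t₃, hs₃, rfl⟩ := hsplit w₃
  obtain ⟨k11, k12, k13⟩ := hk s₁ hs₁
  obtain ⟨k21, k22, k23⟩ := hk s₂ hs₂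
  obtain ⟨k31, k32, k33⟩ := hk s₃ hs₃
  have hz : C (X t₁ + Y t₂ + Z t₃) = 0 := by
    have hd := hc.disjoint
    rw [Submodule.disjoint_def] at hd
    apply hd _ _ ⟨_, rfl⟩
    rw [LinearMap.mem_ker]
    simp only [map_add, k11, k22, k33, zero_add, cX', cY', cZ'] at hw
    simpa only [map_add] using hw
  set u₁ := C t₁
  set u₂ := C t₂
  set u₃ := C t₃
  have hu : X u₁ + Y u₂ + Z u₃ = 0 := by
    rw [cX', cY', cZ', ← map_add, ← map_add, hz]
  have hCv : ∀ v, C v = X (X v) + Y (Y v) + ε • Z (Z v) := fun v => rfl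
  have e1 : ∀ v, X (Y v) = Y (X v) + ε • Z v := LinearMap.congr_fun h1
  have e2 : ∀ v, Y (Z v) = Z (Y v) + X v := LinearMap.congr_fun h2
  have e3 : ∀ v, Z (X v) = X (Z v) + Y v := LinearMap.congr_fun h3
  have hX := congrArg X hu
  have hY := congrArg Y hu
  have hZ := congrArg Z hu
  simp only [map_add, map_zero] at hX hY hZ
  -- On the kernel of `C` the triple acts by zero, and the `s i` solve the equations up to the
  -- factor `ε`. On the range, the Casimir operator is null-homotopic: the remaining terms are the
  -- codifferential of `u`, and the equations hold because `X u₁ + Y u₂ + Z u₃ = 0`.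
  refine ⟨s₁ + Y u₃ - ε • Z u₂, s₂ + ε • Z u₁ - X u₃, ε⁻¹ • s₃ + X u₂ - Y u₁, ?_, ?_, ?_⟩
  · simp only [map_add, map_sub, map_smul, k23, k32, hCv, smul_zero, zero_add]
    rw [← sub_eq_zero, ← neg_eq_zero, ← hX, e1 u₂, e3 u₃]
    module
  · simp only [map_add, map_sub, map_smul, k13, k31, hCv, smul_zero, zero_add]
    rw [← sub_eq_zero, ← neg_eq_zero, ← hY, e1 u₁, e2 u₃]
    module
  · simp only [map_add, map_sub, map_smul, k12, k21, hCv, zero_add, smul_add, smul_sub,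
      smul_smul, mul_inv_cancel₀ hε, one_smul]
    rw [← sub_eq_zero, ← neg_eq_zero, ← smul_zero ε, ← hZ, e2 u₂, e3 u₁]
    module

end Casimir

section Levi
variable {L : Type*} [LieRing L] [LieAlgebra ℝ L] [FiniteDimensional ℝ L]

/-- The defects of the three relations form a two-cocycle with values in `A`, by the Jacobi
identity, and commutativity of `A` makes the correction of the triple a linear problem: the cocycle
has to be a coboundary. -/
theorem exists_isTriple_of_abelian {ε : ℝ} (hε : ε ≠ 0) (A : LieIdeal ℝ L)
    (hA : ∀ a ∈ A, ∀ b ∈ A, ⁅a, b⁆ = 0) {x y z : L} (h1 : ⁅x, y⁆ - ε • z ∈ A)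
    (h2 : ⁅y, z⁆ - x ∈ A) (h3 : ⁅z, x⁆ - y ∈ A) :
    ∃ x' y' z' : L, x' - x ∈ A ∧ y' - y ∈ A ∧ z' - z ∈ A ∧ IsTriple ε x' y' z' := by
  let X := LieModule.toEnd ℝ L A x
  let Y := LieModule.toEnd ℝ L A y
  let Z := LieModule.toEnd ℝ L A z
  have htriv : ∀ a ∈ A, LieModule.toEnd ℝ L A a = 0 := by
    intro a ha
    ext v
    exact hA a ha v v.2
  have hT : IsTriple ε X Y Z := by
    refine ⟨?_, ?_, ?_⟩
    · rw [← LieHom.map_lie, ← map_smul, ← sub_eq_zero, ← map_sub]; exact htriv _ h1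
    · rw [← LieHom.map_lie, ← sub_eq_zero, ← map_sub]; exact htriv _ h2
    · rw [← LieHom.map_lie, ← sub_eq_zero, ← map_sub]; exact htriv _ h3
  have hw : X ⟨_, h2⟩ + Y ⟨_, h3⟩ + Z ⟨_, h1⟩ = 0 := by
    apply Subtype.ext
    change ⁅x, ⁅y, z⁆ - x⁆ + ⁅y, ⁅z, x⁆ - y⁆ + ⁅z, ⁅x, y⁆ - ε • z⁆ = 0
    rw [lie_sub, lie_sub, lie_sub, lie_smul, lie_self, lie_self, lie_self, smul_zero, sub_zero,
      sub_zero, sub_zero, lie_jacobi]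
  obtain ⟨v₁, v₂, v₃, e1, e2, e3⟩ := hT.exists_correction hε hw
  have e1' : (v₁ : L) = ⁅y, z⁆ - x + ⁅y, (v₃ : L)⁆ - ⁅z, (v₂ : L)⁆ := congrArg Subtype.val e1
  have e2' : (v₂ : L) = ⁅z, x⁆ - y + ⁅z, (v₁ : L)⁆ - ⁅x, (v₃ : L)⁆ := congrArg Subtype.val e2
  have e3' : ε • (v₃ : L) = ⁅x, y⁆ - ε • z + ⁅x, (v₂ : L)⁆ - ⁅y, (v₁ : L)⁆ :=
    congrArg Subtype.val e3
  refine ⟨x + v₁, y + v₂, z + v₃, by simp, by simp, by simp, ?_, ?_, ?_⟩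
  · rw [smul_add, e3', lie_add, add_lie, add_lie, hA _ v₁.2 _ v₂.2, ← lie_skew (v₁ : L) y]
    abel
  · rw [lie_add, add_lie, add_lie, hA _ v₂.2 _ v₃.2, ← lie_skew (v₂ : L) z]
    conv_rhs => rw [e1']
    abel
  · rw [lie_add, add_lie, add_lie, hA _ v₃.2 _ v₁.2, ← lie_skew (v₃ : L) x]
    conv_rhs => rw [e2']
    abel

/-- Lifting of a triple modulo a solvable ideal. -/
theorem exists_isTriple_of_isSolvable {ε : ℝ} (hε : ε ≠ 0) (I : LieIdeal ℝ L) [IsSolvable I]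
    {x y z : L} (h1 : ⁅x, y⁆ - ε • z ∈ I) (h2 : ⁅y, z⁆ - x ∈ I) (h3 : ⁅z, x⁆ - y ∈ I) :
    ∃ x' y' z' : L, x' - x ∈ I ∧ y' - y ∈ I ∧ z' - z ∈ I ∧ IsTriple ε x' y' z' := by
  -- Induction along the derived series of `I`: modulo the next term the current one is an abelian
  -- ideal, so the defects can be pushed one term further down.
  have key : ∀ k, ∃ x' y' z' : L, x' - x ∈ I ∧ y' - y ∈ I ∧ z' - z ∈ I ∧
      ⁅x', y'⁆ - ε • z' ∈ derivedSeriesOfIdeal ℝ L k I ∧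
      ⁅y', z'⁆ - x' ∈ derivedSeriesOfIdeal ℝ L k I ∧
      ⁅z', x'⁆ - y' ∈ derivedSeriesOfIdeal ℝ L k I := by
    intro k
    induction k with
    | zero => exact ⟨x, y, z, by simp, by simp, by simp, h1, h2, h3⟩
    | succ k ih =>
      obtain ⟨x', y', z', i1, i2, i3, j1, j2, j3⟩ := ih
      set J := derivedSeriesOfIdeal ℝ L k I with hJ
      set J' := derivedSeriesOfIdeal ℝ L (k + 1) I with hJ'
      have hJJ : ∀ a ∈ J, ∀ b ∈ J, ⁅a, b⁆ ∈ J' := by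
        intro a ha b hb
        rw [hJ', derivedSeriesOfIdeal_succ]
        exact LieSubmodule.lie_mem_lie ha hb
      let π := quotHom J'
      have hmem : ∀ a, a ∈ J.map π ↔ ∃ b ∈ J, π b = a := by
        intro a
        constructor
        · intro ha
          obtain ⟨b, rfl⟩ := LieIdeal.mem_map_of_surjective (quotHom_surjective J') ha
          exact ⟨b, b.2, rfl⟩
        · rintro ⟨b, hb, rfl⟩
          exact LieIdeal.mem_map hb
      obtain ⟨a, b, c, ka, kb, kc, hT⟩ := exists_isTriple_of_abelian hε (J.map π)
        (by
          intro a ha b hb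
          obtain ⟨a, ha', rfl⟩ := (hmem a).mp ha
          obtain ⟨b, hb', rfl⟩ := (hmem b).mp hb
          rw [← LieHom.map_lie]
          exact quotHom_eq_zero.mpr (hJJ a ha' b hb'))
        (x := π x') (y := π y') (z := π z')
        ((hmem _).mpr ⟨_, j1, by simp⟩) ((hmem _).mpr ⟨_, j2, by simp⟩)
        ((hmem _).mpr ⟨_, j3, by simp⟩)
      have lift : ∀ a t, a - π t ∈ J.map π → t - t ∈ I → ∃ s, π s = a ∧ s - t ∈ I := by
        intro a t ha _
        obtain ⟨b, hb, hba⟩ := (hmem _).mp ha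
        refine ⟨t + b, by rw [map_add, hba]; abel, ?_⟩
        rw [add_sub_cancel_left]
        exact derivedSeriesOfIdeal_le_self I k hb
      obtain ⟨x'', rfl, l1⟩ := lift _ _ ka (by simp)
      obtain ⟨y'', rfl, l2⟩ := lift _ _ kb (by simp)
      obtain ⟨z'', rfl, l3⟩ := lift _ _ kc (by simp)
      refine ⟨x'', y'', z'', ?_, ?_, ?_, ?_, ?_, ?_⟩
      · simpa using I.add_mem l1 i1
      · simpa using I.add_mem l2 i2
      · simpa using I.add_mem l3 i3
      · rw [← quotHom_eq_zero, map_sub, map_smul, LieHom.map_lie, sub_eq_zero]; exact hT.1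
      · rw [← quotHom_eq_zero, map_sub, LieHom.map_lie, sub_eq_zero]; exact hT.2.1
      · rw [← quotHom_eq_zero, map_sub, LieHom.map_lie, sub_eq_zero]; exact hT.2.2
  obtain ⟨k, hk⟩ := (isSolvable_iff ℝ I).mp inferInstance
  rw [LieIdeal.derivedSeries_eq_bot_iff] at hk
  obtain ⟨x', y', z', i1, i2, i3, j1, j2, j3⟩ := key k
  rw [hk, LieSubmodule.mem_bot, sub_eq_zero] at j1 j2 j3
  exact ⟨x', y', z', i1, i2, i3, j1, j2, j3⟩

end Levi
end FrobeniusEight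

/-! ### Decomposition of the algebra under a Levi triple -/

namespace FrobeniusEight
open Module LieAlgebra
attribute [local instance 100] LieRing.ofAssociativeRing

/-- A decomposition `L = ⟨x, y, z⟩ ⊕ T ⊕ N` where `x, y, z` is a triple, `T` is its centralizer,
`T ⊕ N` is an ideal and `N` is the sum of the non-trivial submodules in it. -/
structure IsLeviDecomposition {L : Type*} [LieRing L] [LieAlgebra ℝ L] (ε : ℝ) (x y z : L)
    (T N : Submodule ℝ L) : Prop where
  sign : ε = 1 ∨ ε = -1
  triple : IsTriple ε x y z
  comm_x : ∀ t ∈ T, ⁅x, t⁆ = 0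
  comm_y : ∀ t ∈ T, ⁅y, t⁆ = 0
  comm_z : ∀ t ∈ T, ⁅z, t⁆ = 0
  stable_x : ∀ u ∈ N, ⁅x, u⁆ ∈ N
  stable_y : ∀ u ∈ N, ⁅y, u⁆ ∈ N
  stable_z : ∀ u ∈ N, ⁅z, u⁆ ∈ N
  lie_T_N : ∀ t ∈ T, ∀ u ∈ N, ⁅t, u⁆ ∈ N
  lie_T_T : ∀ s ∈ T, ∀ t ∈ T, ⁅s, t⁆ ∈ T
  lie_N_N : ∀ u ∈ N, ∀ v ∈ N, ⁅u, v⁆ ∈ T ⊔ N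
  casimir_inj : ∀ u ∈ N, ⁅x, ⁅x, u⁆⁆ + ⁅y, ⁅y, u⁆⁆ + ε • ⁅z, ⁅z, u⁆⁆ = 0 → u = 0
  finrank_add : finrank ℝ T + finrank ℝ N = 5
  decomp : ∀ w : L, ∃ a b c : ℝ, ∃ t ∈ T, ∃ u ∈ N, w = a • x + b • y + c • z + t + u
  indep : ∀ a b c : ℝ, ∀ t ∈ T, ∀ u ∈ N, a • x + b • y + c • z + t + u = 0 →
    a = 0 ∧ b = 0 ∧ c = 0 ∧ t = 0 ∧ u = 0

section
variable {L : Type*} [LieRing L] [LieAlgebra ℝ L] [FiniteDimensional ℝ L]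

/-- `T` is the kernel of the Casimir operator of `ad` and `N` is the part of the radical in its
range. The operator acts on the triple by the scalar `-2ε`. Its kernel commutes with the triple, so
it becomes central in the quotient by the radical and hence lies in the radical; the modular law
then gives that the radical is `T ⊕ N`. -/
theorem exists_isLeviDecomposition (hdim : finrank ℝ L = 8)
    (hq : finrank ℝ (L ⧸ radical ℝ L) = 3) :
    ∃ (ε : ℝ) (x y z : L) (T N : Submodule ℝ L), IsLeviDecomposition ε x y z T N := by
  have := hasTrivialRadical_quotient_radical L
  set r := radical ℝ L
  obtain ⟨ε, hε, x₀, y₀, z₀, hspan, hT₀⟩ := exists_isTriple hq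
  have hε0 : ε ≠ 0 := by rcases hε with rfl | rfl <;> norm_num
  set π := quotHom r
  obtain ⟨x₁, rfl⟩ := quotHom_surjective r x₀
  obtain ⟨y₁, rfl⟩ := quotHom_surjective r y₀
  obtain ⟨z₁, rfl⟩ := quotHom_surjective r z₀
  obtain ⟨x, y, z, hx, hy, hz, hT⟩ := exists_isTriple_of_isSolvable hε0 r
    (x := x₁) (y := y₁) (z := z₁)
    (by rw [← quotHom_eq_zero, map_sub, map_smul, LieHom.map_lie, sub_eq_zero]; exact hT₀.1)
    (by rw [← quotHom_eq_zero, map_sub, LieHom.map_lie, sub_eq_zero]; exact hT₀.2.1)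
    (by rw [← quotHom_eq_zero, map_sub, LieHom.map_lie, sub_eq_zero]; exact hT₀.2.2)
  rw [← quotHom_eq_zero, map_sub, sub_eq_zero] at hx hy hz
  rw [← hx, ← hy, ← hz] at hspan
  clear hT₀ hx hy hz
  have hadT : IsTriple ε (ad ℝ L x) (ad ℝ L y) (ad ℝ L z) :=
    ⟨by rw [← LieHom.map_lie, hT.1, map_smul], by rw [← LieHom.map_lie, hT.2.1],
      by rw [← LieHom.map_lie, hT.2.2]⟩
  obtain ⟨hcompl, hker⟩ := hadT.isCompl_ker_range hε0
  obtain ⟨cX, cY, cZ⟩ := hadT.commute_casimir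
  set C := casimir ε (ad ℝ L x) (ad ℝ L y) (ad ℝ L z) with hC
  have hCv : ∀ v, C v = ⁅x, ⁅x, v⁆⁆ + ⁅y, ⁅y, v⁆⁆ + ε • ⁅z, ⁅z, v⁆⁆ := fun v => rfl
  have cX' : ∀ v, ⁅x, C v⁆ = C ⁅x, v⁆ := LinearMap.congr_fun cX
  have cY' : ∀ v, ⁅y, C v⁆ = C ⁅y, v⁆ := LinearMap.congr_fun cY
  have cZ' : ∀ v, ⁅z, C v⁆ = C ⁅z, v⁆ := LinearMap.congr_fun cZ
  have hyx : ⁅y, x⁆ = -(ε • z) := by rw [← lie_skew, hT.1]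
  have hzy : ⁅z, y⁆ = -x := by rw [← lie_skew, hT.2.1]
  have hxz : ⁅x, z⁆ = -y := by rw [← lie_skew, hT.2.2]
  have hCx : C x = (-2 * ε) • x := by
    rw [hCv, lie_self, hyx, hT.2.2, lie_zero, lie_neg, lie_smul, hT.2.1, hzy]; module
  have hCy : C y = (-2 * ε) • y := by
    rw [hCv, lie_self, hT.1, hzy, lie_zero, lie_neg, lie_smul, hT.2.2, hxz]; module
  have hCz : C z = (-2 * ε) • z := by
    rw [hCv, lie_self, hT.2.1, hxz, lie_zero, lie_neg, hT.1, hyx]; module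
  have hε2 : -2 * ε ≠ 0 := mul_ne_zero (by norm_num) hε0
  have hrange : ∀ a b c : ℝ, a • x + b • y + c • z = C ((-2 * ε)⁻¹ • (a • x + b • y + c • z)) := by
    intro a b c
    rw [map_smul, map_add, map_add, map_smul, map_smul, map_smul, hCx, hCy, hCz]
    simp only [smul_add, smul_smul]
    congr 2 <;> · congr 1; field_simp
  have hrid : ∀ v, ∀ u ∈ r, ⁅v, u⁆ ∈ r := fun v u hu => lie_mem_right ℝ L r v u hu
  have hCr : ∀ u ∈ r, C u ∈ r := by
    intro u hu
    rw [hCv]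
    exact r.add_mem (r.add_mem (hrid _ _ (hrid _ _ hu)) (hrid _ _ (hrid _ _ hu)))
      (r.smul_mem _ (hrid _ _ (hrid _ _ hu)))
  have hker' : ∀ v ∈ LinearMap.ker C, ⁅x, v⁆ = 0 ∧ ⁅y, v⁆ = 0 ∧ ⁅z, v⁆ = 0 := hker
  have hkr : ∀ v, C v = 0 → v ∈ r := by
    intro v hv
    obtain ⟨k1, k2, k3⟩ := hker' v hv
    rw [← quotHom_eq_zero]
    have hc : π v ∈ center ℝ (L ⧸ r) := by
      rw [LieModule.mem_maxTrivSubmodule]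
      intro w
      obtain ⟨a, b, c, rfl⟩ := hspan w
      rw [add_lie, add_lie, smul_lie, smul_lie, smul_lie, ← LieHom.map_lie, ← LieHom.map_lie,
        ← LieHom.map_lie, k1, k2, k3]
      simp
    have hc' : π v = 0 := by simpa using hc
    exact hc'
  have hli : ∀ a b c : ℝ, a • x + b • y + c • z ∈ r → a = 0 ∧ b = 0 ∧ c = 0 := by
    intro a b c h
    have hlin : LinearIndependent ℝ ![π x, π y, π z] := by
      apply linearIndependent_of_top_le_span_of_card_eq_finrank
      · intro w _
        obtain ⟨a, b, c, rfl⟩ := hspan w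
        refine Submodule.add_mem _ (Submodule.add_mem _ ?_ ?_) ?_
        · exact Submodule.smul_mem _ _ (Submodule.subset_span ⟨0, rfl⟩)
        · exact Submodule.smul_mem _ _ (Submodule.subset_span ⟨1, rfl⟩)
        · exact Submodule.smul_mem _ _ (Submodule.subset_span ⟨2, rfl⟩)
      · simpa using hq.symm
    rw [Fintype.linearIndependent_iff] at hlin
    have := hlin ![a, b, c] (by
      rw [← quotHom_eq_zero] at h
      simpa [Fin.sum_univ_three] using h)
    exact ⟨this 0, this 1, this 2⟩
  have hdec : ∀ w : L, ∃ a b c : ℝ, ∃ u ∈ r, w = a • x + b • y + c • z + u := by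
    intro w
    obtain ⟨a, b, c, h⟩ := hspan (π w)
    refine ⟨a, b, c, w - (a • x + b • y + c • z), ?_, by abel⟩
    rw [← quotHom_eq_zero, map_sub, sub_eq_zero]
    simpa using h
  let T : Submodule ℝ L := LinearMap.ker C
  let N : Submodule ℝ L := r.toSubmodule ⊓ LinearMap.range C
  have hTr : T ≤ r.toSubmodule := hkr
  have hdisj : Disjoint T N := hcompl.disjoint.mono_right inf_le_right
  have hsup : T ⊔ N = r.toSubmodule := by
    change T ⊔ r.toSubmodule ⊓ LinearMap.range C = _
    rw [inf_comm, ← sup_inf_assoc_of_le _ hTr, hcompl.sup_eq_top, top_inf_eq]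
  have hfr : finrank ℝ r.toSubmodule = 5 := by
    have := Submodule.finrank_quotient_add_finrank r.toSubmodule
    have hq' : finrank ℝ (L ⧸ r.toSubmodule) = 3 := hq
    omega
  refine ⟨ε, x, y, z, T, N, hε, hT, fun t ht => (hker' t ht).1, fun t ht => (hker' t ht).2.1,
    fun t ht => (hker' t ht).2.2, ?_, ?_, ?_, ?_, ?_, ?_, ?_, ?_, ?_, ?_⟩
  · rintro _ ⟨hu, u, rfl⟩
    exact ⟨hrid _ _ hu, ⁅x, u⁆, (cX' u).symm⟩
  · rintro _ ⟨hu, u, rfl⟩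
    exact ⟨hrid _ _ hu, ⁅y, u⁆, (cY' u).symm⟩
  · rintro _ ⟨hu, u, rfl⟩
    exact ⟨hrid _ _ hu, ⁅z, u⁆, (cZ' u).symm⟩
  · rintro t ht _ ⟨hu, u, rfl⟩
    refine ⟨hrid _ _ hu, ⁅t, u⁆, ?_⟩
    obtain ⟨k1, k2, k3⟩ := hker' t ht
    have hx' : ∀ v : L, ⁅x, ⁅t, v⁆⁆ = ⁅t, ⁅x, v⁆⁆ := fun v => by
      rw [leibniz_lie, k1, zero_lie, zero_add]
    have hy' : ∀ v : L, ⁅y, ⁅t, v⁆⁆ = ⁅t, ⁅y, v⁆⁆ := fun v => by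
      rw [leibniz_lie, k2, zero_lie, zero_add]
    have hz' : ∀ v : L, ⁅z, ⁅t, v⁆⁆ = ⁅t, ⁅z, v⁆⁆ := fun v => by
      rw [leibniz_lie, k3, zero_lie, zero_add]
    simp only [hCv, hx', hy', hz', lie_add, lie_smul]
  · intro s hs t ht
    obtain ⟨k1, k2, k3⟩ := hker' t ht
    obtain ⟨l1, l2, l3⟩ := hker' s hs
    change C ⁅s, t⁆ = 0
    have hx' : ⁅x, ⁅s, t⁆⁆ = 0 := by rw [leibniz_lie, k1, l1, zero_lie, lie_zero, add_zero]
    have hy' : ⁅y, ⁅s, t⁆⁆ = 0 := by rw [leibniz_lie, k2, l2, zero_lie, lie_zero, add_zero]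
    have hz' : ⁅z, ⁅s, t⁆⁆ = 0 := by rw [leibniz_lie, k3, l3, zero_lie, lie_zero, add_zero]
    rw [hCv, hx', hy', hz']; simp
  · intro u hu v hv
    rw [hsup]
    exact hrid _ _ hv.1
  · intro u hu h
    have hd := hcompl.disjoint
    rw [Submodule.disjoint_def] at hd
    exact hd u h hu.2
  · have h1 := Submodule.finrank_sup_add_finrank_inf_eq T N
    rw [hsup, hdisj.eq_bot, finrank_bot, hfr] at h1
    omega
  · intro w
    obtain ⟨a, b, c, u, hu, rfl⟩ := hdec w
    rw [← LieSubmodule.mem_toSubmodule, ← hsup] at hu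
    obtain ⟨t, ht, v, hv, rfl⟩ := Submodule.mem_sup.mp hu
    exact ⟨a, b, c, t, ht, v, hv, by abel⟩
  · intro a b c t ht u hu h
    have h1 : t + u ∈ r := r.add_mem (hTr ht) hu.1
    have h2 : a • x + b • y + c • z = -(t + u) := by
      rw [eq_neg_iff_add_eq_zero, ← h]; abel
    obtain ⟨rfl, rfl, rfl⟩ := hli a b c (by rw [h2]; exact r.neg_mem h1)
    have h3 : t + u = 0 := by
      rw [zero_smul, zero_smul, zero_smul, add_zero, add_zero] at h2
      exact neg_eq_zero.mp h2.symm
    have h4 : t = -u := eq_neg_of_add_eq_zero_left h3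
    have h5 : t = 0 := by
      have hd := hdisj
      rw [Submodule.disjoint_def] at hd
      exact hd t ht (by rw [h4]; exact N.neg_mem hu)
    refine ⟨rfl, rfl, rfl, h5, ?_⟩
    rw [h5, zero_add] at h3
    exact h3

end
end FrobeniusEight

/-! ### Modules of dimension at most three without trivial submodules -/

namespace FrobeniusEight
open Module LieAlgebra
attribute [local instance 100] LieRing.ofAssociativeRing

section LowDimension
variable {V : Type*} [AddCommGroup V] [Module ℝ V]

/-- An endomorphism of an odd-dimensional real space has an eigenvector. -/
theorem exists_eigenvector_of_odd [FiniteDimensional ℝ V] (hV : Odd (finrank ℝ V))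
    (M : Module.End ℝ V) : ∃ (c : ℝ) (v : V), v ≠ 0 ∧ M v = c • v := by
  obtain ⟨c, hc⟩ : ∃ c, (LinearMap.charpoly M).IsRoot c := by
    have htend : ∀ A : Module.End ℝ V,
        Filter.Tendsto (fun t => (LinearMap.charpoly A).eval t) Filter.atTop Filter.atTop := by
      intro A
      apply Polynomial.tendsto_atTop_of_leadingCoeff_nonneg
      · rw [← Polynomial.natDegree_pos_iff_degree_pos, LinearMap.charpoly_natDegree]
        exact hV.pos
      · rw [(LinearMap.charpoly_monic A).leadingCoeff]
        exact zero_le_one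
    have hneg : ∀ t : ℝ, (LinearMap.charpoly M).eval (-t) = -(LinearMap.charpoly (-M)).eval t := by
      intro t
      rw [LinearMap.eval_charpoly, LinearMap.eval_charpoly]
      have : algebraMap ℝ (Module.End ℝ V) (-t) - M = -(algebraMap ℝ (Module.End ℝ V) t - -M) := by
        rw [map_neg]; abel
      rw [this, ← neg_one_smul ℝ (algebraMap ℝ (Module.End ℝ V) t - -M), LinearMap.det_smul,
        hV.neg_one_pow]
      ring
    obtain ⟨a, ha⟩ := ((htend M).eventually_ge_atTop 0).exists
    obtain ⟨b, hb⟩ := ((htend (-M)).eventually_ge_atTop 0).exists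
    have hb' : (LinearMap.charpoly M).eval (-b) ≤ 0 := by rw [hneg]; linarith
    exact mem_range_of_exists_le_of_exists_ge (LinearMap.charpoly M).continuous ⟨_, hb'⟩ ⟨_, ha⟩
  rw [← Module.End.hasEigenvalue_iff_isRoot_charpoly] at hc
  obtain ⟨v, hv⟩ := hc.exists_hasEigenvector
  exact ⟨c, v, hv.2, hv.apply_eq_smul⟩

/-- An alternating form on an odd-dimensional space is degenerate. -/
theorem exists_ne_zero_of_alternating [FiniteDimensional ℝ V] (hV : Odd (finrank ℝ V))
    (B : V →ₗ[ℝ] V →ₗ[ℝ] ℝ) (hB : ∀ v, B v v = 0) : ∃ u, u ≠ 0 ∧ B u = 0 := by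
  by_contra! hcon
  let b := Module.finBasis ℝ V
  have hskew : ∀ u v, B u v = -B v u := by
    intro u v
    have := hB (u + v)
    simp only [map_add, LinearMap.add_apply, hB] at this
    linarith
  have hker : LinearMap.ker B = ⊥ := by
    rw [LinearMap.ker_eq_bot']
    intro u hu
    by_contra h
    exact hcon u h hu
  have hnd : LinearMap.BilinForm.Nondegenerate B := by
    refine ⟨fun u hu => ?_, fun u hu => ?_⟩
    · by_contra h
      exact hcon u h (LinearMap.ext hu)
    · by_contra h
      exact hcon u h (LinearMap.ext fun v => by rw [hskew, hu v]; simp)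
  rw [LinearMap.BilinForm.nondegenerate_iff_det_ne_zero b] at hnd
  apply hnd
  set A := LinearMap.BilinForm.toMatrix b B
  have hA : A.transpose = -A := by
    ext i j
    simp [A, hskew (b j) (b i)]
  have h2 := congrArg Matrix.det hA
  rw [Matrix.det_transpose, Matrix.det_neg, Fintype.card_fin, hV.neg_one_pow] at h2
  linarith

variable {ε : ℝ} {X Y Z : Module.End ℝ V}

theorem casimir_apply (v : V) :
    casimir ε X Y Z v = X (X v) + Y (Y v) + ε • Z (Z v) := rfl

theorem IsTriple.apply (h : IsTriple ε X Y Z) (v : V) :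
    X (Y v) = Y (X v) + ε • Z v ∧ Y (Z v) = Z (Y v) + X v ∧ Z (X v) = X (Z v) + Y v := by
  obtain ⟨h1, h2, h3⟩ := h.mul_eq
  exact ⟨LinearMap.congr_fun h1 v, LinearMap.congr_fun h2 v, LinearMap.congr_fun h3 v⟩

/-- There are no one-dimensional submodules. -/
theorem IsTriple.eq_zero_of_smul (h : IsTriple ε X Y Z)
    (hinj : ∀ v, casimir ε X Y Z v = 0 → v = 0) (hε : ε ≠ 0) {v : V} {a b c : ℝ}
    (hX : X v = a • v) (hY : Y v = b • v) (hZ : Z v = c • v) : v = 0 := by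
  obtain ⟨h1, h2, h3⟩ := h.apply v
  rw [hX, hY, map_smul, map_smul, hX, hY, smul_comm, left_eq_add, smul_eq_zero] at h1
  rw [hY, hZ, map_smul, map_smul, hY, hZ, smul_comm, left_eq_add] at h2
  rw [hX, hZ, map_smul, map_smul, hX, hZ, smul_comm, left_eq_add] at h3
  have h1 := h1.resolve_left hε
  apply hinj
  rw [casimir_apply, h1, h2, h3, map_zero, map_zero, map_zero]
  simp

/-- There are no one-dimensional quotients. -/
theorem IsTriple.eq_zero_of_comp [FiniteDimensional ℝ V] (h : IsTriple ε X Y Z)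
    (hinj : ∀ v, casimir ε X Y Z v = 0 → v = 0) (hε : ε ≠ 0) {φ : V →ₗ[ℝ] ℝ} {a b c : ℝ}
    (hX : ∀ v, φ (X v) = a * φ v) (hY : ∀ v, φ (Y v) = b * φ v) (hZ : ∀ v, φ (Z v) = c * φ v) :
    φ = 0 := by
  have h1 : ∀ v, φ (Z v) = 0 := fun v => by
    have := congrArg φ (h.apply v).1
    rw [map_add, map_smul, hX, hY, hY, hX, smul_eq_mul] at this
    have h0 : ε * φ (Z v) = 0 := by linarith
    exact (mul_eq_zero.mp h0).resolve_left hε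
  have h2 : ∀ v, φ (X v) = 0 := fun v => by
    have := congrArg φ (h.apply v).2.1
    rw [map_add, hY, hZ, hZ, hY] at this
    linarith
  have h3 : ∀ v, φ (Y v) = 0 := fun v => by
    have := congrArg φ (h.apply v).2.2
    rw [map_add, hX, hZ, hZ, hX] at this
    linarith
  have hs : Function.Surjective (casimir ε X Y Z) := by
    rw [← LinearMap.injective_iff_surjective, ← LinearMap.ker_eq_bot, LinearMap.ker_eq_bot']
    exact hinj
  ext v
  obtain ⟨u, rfl⟩ := hs v
  rw [casimir_apply, map_add, map_add, map_smul, h1, h2, h3]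
  simp

theorem IsTriple.finrank_ne_one (h : IsTriple ε X Y Z)
    (hinj : ∀ v, casimir ε X Y Z v = 0 → v = 0) (hε : ε ≠ 0) : finrank ℝ V ≠ 1 := by
  intro hV
  obtain ⟨v, hv, hs⟩ := finrank_eq_one_iff'.mp hV
  obtain ⟨a, ha⟩ := hs (X v)
  obtain ⟨b, hb⟩ := hs (Y v)
  obtain ⟨c, hc⟩ := hs (Z v)
  exact hv (h.eq_zero_of_smul hinj hε ha.symm hb.symm hc.symm)

/-- In dimension two the commutant consists of the homotheties. -/
theorem IsTriple.exists_eq_smul_of_finrank_two (h : IsTriple ε X Y Z)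
    (hinj : ∀ v, casimir ε X Y Z v = 0 → v = 0) (hε : ε ≠ 0) (hV : finrank ℝ V = 2)
    {M : Module.End ℝ V} (hX : ∀ v, M (X v) = X (M v)) (hY : ∀ v, M (Y v) = Y (M v))
    (hZ : ∀ v, M (Z v) = Z (M v)) : ∃ c : ℝ, ∀ v, M v = c • v := by
  by_contra hcon
  have : ∃ v, LinearIndependent ℝ ![v, M v] := by
    by_contra! h'
    obtain ⟨c, hc⟩ := LinearMap.exists_eq_smul_id_of_forall_notLinearIndependent h'
    exact hcon ⟨c, fun v => by rw [hc]; rfl⟩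
  obtain ⟨v, hv⟩ := this
  have htop := hv.span_eq_top_of_card_eq_finrank (by simpa using hV.symm)
  rw [Matrix.range_cons, Matrix.range_cons, Matrix.range_empty, Set.union_empty,
    Set.singleton_union] at htop
  have hspan : ∀ w, ∃ p q : ℝ, p • v + q • M v = w := fun w => by
    rw [← Submodule.mem_span_pair, htop]; trivial
  -- As `v` and `M v` form a basis, everything commuting with `M` has the form `p + q M`. Then `X`,
  -- `Y`, `Z` commute with each other and the relations of the triple make them kill `v`.
  have key : ∀ A : Module.End ℝ V, (∀ v, M (A v) = A (M v)) →
      ∃ p q : ℝ, ∀ w, A w = p • w + q • M w := by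
    intro A hA
    obtain ⟨p, q, hpq⟩ := hspan (A v)
    refine ⟨p, q, fun w => ?_⟩
    obtain ⟨r, s, rfl⟩ := hspan w
    rw [map_add, map_smul, map_smul, ← hA v, ← hpq]
    simp only [map_add, map_smul]
    module
  obtain ⟨a, a', ha⟩ := key X hX
  obtain ⟨b, b', hb⟩ := key Y hY
  obtain ⟨c, c', hc⟩ := key Z hZ
  have h1 : X v = 0 := by
    have := (h.apply v).2.1
    rw [hb (Z v), hc (Y v), hb v, hc v] at this
    simp only [map_add, map_smul] at this
    rw [← sub_eq_zero] at this
    rw [← neg_eq_zero, ← this]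
    module
  have h2 : Y v = 0 := by
    have := (h.apply v).2.2
    rw [hc (X v), ha (Z v), hc v, ha v] at this
    simp only [map_add, map_smul] at this
    rw [← sub_eq_zero] at this
    rw [← neg_eq_zero, ← this]
    module
  have h3 : Z v = 0 := by
    have := (h.apply v).1
    rw [h1, h2, map_zero, map_zero, zero_add] at this
    exact (smul_eq_zero.mp this.symm).resolve_left hε
  have := h.eq_zero_of_smul hinj hε (v := v) (a := 0) (b := 0) (c := 0) (by simp [h1])
    (by simp [h2])
    (by simp [h3])
  exact hv.ne_zero 0 this

/-- In dimension three there are no proper submodules. -/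
theorem IsTriple.eq_top_of_finrank_three [FiniteDimensional ℝ V] (h : IsTriple ε X Y Z)
    (hinj : ∀ v, casimir ε X Y Z v = 0 → v = 0) (hε : ε ≠ 0) (hV : finrank ℝ V = 3)
    {W : Submodule ℝ V} (hX : ∀ v ∈ W, X v ∈ W) (hY : ∀ v ∈ W, Y v ∈ W)
    (hZ : ∀ v ∈ W, Z v ∈ W) (hW : W ≠ ⊥) : W = ⊤ := by
  have h0 : finrank ℝ W ≠ 0 := fun h' => hW (Submodule.finrank_eq_zero.mp h')
  have hle := Submodule.finrank_le W
  have h1 : finrank ℝ W ≠ 1 := by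
    intro h1
    obtain ⟨⟨v, hvW⟩, hv, hs⟩ := finrank_eq_one_iff'.mp h1
    obtain ⟨a, ha⟩ := hs ⟨X v, hX v hvW⟩
    obtain ⟨b, hb⟩ := hs ⟨Y v, hY v hvW⟩
    obtain ⟨c, hc⟩ := hs ⟨Z v, hZ v hvW⟩
    exact hv (Subtype.ext (h.eq_zero_of_smul hinj hε (Subtype.ext_iff.mp ha).symm
      (Subtype.ext_iff.mp hb).symm (Subtype.ext_iff.mp hc).symm))
  -- An invariant plane would yield a one-dimensional quotient, given by a linear form `φ` on which
  -- the triple acts through scalars.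
  have h2 : finrank ℝ W ≠ 2 := by
    intro h2
    have hq : finrank ℝ (V ⧸ W) = 1 := by
      have := Submodule.finrank_quotient_add_finrank W
      omega
    let e : (V ⧸ W) ≃ₗ[ℝ] ℝ := LinearEquiv.ofFinrankEq _ _ (by rw [hq, finrank_self])
    let φ : V →ₗ[ℝ] ℝ := e.toLinearMap ∘ₗ W.mkQ
    have hφ : ∀ v, φ v = 0 ↔ v ∈ W := fun v => by simp [φ]
    have hs : Function.Surjective φ := e.surjective.comp W.mkQ_surjective
    obtain ⟨u, hu⟩ := hs 1
    have key : ∀ A : Module.End ℝ V, (∀ v ∈ W, A v ∈ W) → ∀ v, φ (A v) = φ (A u) * φ v := by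
      intro A hA v
      have h' : v - φ v • u ∈ W := by
        rw [← hφ, map_sub, map_smul, hu]; simp
      have := (hφ _).mpr (hA _ h')
      rw [map_sub, map_sub, map_smul, map_smul, sub_eq_zero, smul_eq_mul] at this
      rw [this, mul_comm]
    have := h.eq_zero_of_comp hinj hε (key X hX) (key Y hY) (key Z hZ)
    rw [this] at hu
    simp at hu
  exact Submodule.eq_top_of_finrank_eq (by omega)

/-- In dimension three the commutant consists of the homotheties. -/
theorem IsTriple.exists_eq_smul_of_finrank_three [FiniteDimensional ℝ V] (h : IsTriple ε X Y Z)
    (hinj : ∀ v, casimir ε X Y Z v = 0 → v = 0) (hε : ε ≠ 0) (hV : finrank ℝ V = 3)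
    {M : Module.End ℝ V} (hX : ∀ v, M (X v) = X (M v)) (hY : ∀ v, M (Y v) = Y (M v))
    (hZ : ∀ v, M (Z v) = Z (M v)) : ∃ c : ℝ, ∀ v, M v = c • v := by
  obtain ⟨c, v, hv, hM⟩ := exists_eigenvector_of_odd (by rw [hV]; decide) M
  have hmem : ∀ w, w ∈ LinearMap.ker (M - c • LinearMap.id) ↔ M w = c • w := fun w => by
    rw [LinearMap.mem_ker, LinearMap.sub_apply, sub_eq_zero]; rfl
  have htop := h.eq_top_of_finrank_three hinj hε hV (W := LinearMap.ker (M - c • LinearMap.id))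
    (fun w hw => by rw [hmem] at hw ⊢; rw [hX, hw, map_smul])
    (fun w hw => by rw [hmem] at hw ⊢; rw [hY, hw, map_smul])
    (fun w hw => by rw [hmem] at hw ⊢; rw [hZ, hw, map_smul])
    (fun h' => hv (by rw [← hmem, h'] at hM; simpa using hM))
  exact ⟨c, fun w => by rw [← hmem, htop]; trivial⟩

/-- In dimension three there is no invariant alternating form. -/
theorem IsTriple.eq_zero_of_invariant [FiniteDimensional ℝ V] (h : IsTriple ε X Y Z)
    (hinj : ∀ v, casimir ε X Y Z v = 0 → v = 0) (hε : ε ≠ 0) (hV : finrank ℝ V = 3)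
    (B : V →ₗ[ℝ] V →ₗ[ℝ] ℝ) (hB : ∀ v, B v v = 0) (hX : ∀ u v, B (X u) v + B u (X v) = 0)
    (hY : ∀ u v, B (Y u) v + B u (Y v) = 0) (hZ : ∀ u v, B (Z u) v + B u (Z v) = 0) : B = 0 := by
  obtain ⟨u, hu, hBu⟩ := exists_ne_zero_of_alternating (by rw [hV]; decide) B hB
  have key : ∀ A : Module.End ℝ V, (∀ u v, B (A u) v + B u (A v) = 0) →
      ∀ v ∈ LinearMap.ker B, A v ∈ LinearMap.ker B := by
    intro A hA v hv
    rw [LinearMap.mem_ker] at hv ⊢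
    ext w
    have := hA v w
    rw [hv, LinearMap.zero_apply, add_zero] at this
    exact this
  have htop := h.eq_top_of_finrank_three hinj hε hV (W := LinearMap.ker B) (key X hX) (key Y hY)
    (key Z hZ) (fun h' => hu (by rw [← LinearMap.mem_ker, h'] at hBu; simpa using hBu))
  exact LinearMap.ker_eq_top.mp htop

end LowDimension
end FrobeniusEight

/-! ### The action of the centralizer on `N` -/

namespace FrobeniusEight
open Module LieAlgebra
attribute [local instance 100] LieRing.ofAssociativeRing

section Levi
variable {L : Type*} [LieRing L] [LieAlgebra ℝ L]
variable {ε : ℝ} {x y z : L} {T N : Submodule ℝ L}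

namespace IsLeviDecomposition

theorem sign_ne_zero (h : IsLeviDecomposition ε x y z T N) : ε ≠ 0 := by
  rcases h.sign with rfl | rfl <;> norm_num

/-- The endomorphism of `N` induced by `ad x`. -/
def adX (h : IsLeviDecomposition ε x y z T N) : Module.End ℝ N :=
  (ad ℝ L x).restrict h.stable_x

/-- The endomorphism of `N` induced by `ad y`. -/
def adY (h : IsLeviDecomposition ε x y z T N) : Module.End ℝ N :=
  (ad ℝ L y).restrict h.stable_y

/-- The endomorphism of `N` induced by `ad z`. -/
def adZ (h : IsLeviDecomposition ε x y z T N) : Module.End ℝ N :=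
  (ad ℝ L z).restrict h.stable_z

/-- The endomorphism of `N` induced by `ad t`, `t ∈ T`. -/
def adT (h : IsLeviDecomposition ε x y z T N) {t : L} (ht : t ∈ T) : Module.End ℝ N :=
  (ad ℝ L t).restrict (h.lie_T_N t ht)

@[simp] theorem coe_adX (h : IsLeviDecomposition ε x y z T N) (u : N) :
    (h.adX u : L) = ⁅x, (u : L)⁆ := rfl

@[simp] theorem coe_adY (h : IsLeviDecomposition ε x y z T N) (u : N) :
    (h.adY u : L) = ⁅y, (u : L)⁆ := rfl

@[simp] theorem coe_adZ (h : IsLeviDecomposition ε x y z T N) (u : N) :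
    (h.adZ u : L) = ⁅z, (u : L)⁆ := rfl

@[simp] theorem coe_adT (h : IsLeviDecomposition ε x y z T N) {t : L} (ht : t ∈ T) (u : N) :
    (h.adT ht u : L) = ⁅t, (u : L)⁆ := rfl

theorem isTriple (h : IsLeviDecomposition ε x y z T N) : IsTriple ε h.adX h.adY h.adZ := by
  obtain ⟨h1, h2, h3⟩ := h.triple
  refine ⟨?_, ?_, ?_⟩
  · ext u
    change ⁅x, ⁅y, (u : L)⁆⁆ - ⁅y, ⁅x, (u : L)⁆⁆ = ε • ⁅z, (u : L)⁆
    rw [← lie_lie, h1, smul_lie]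
  · ext u
    change ⁅y, ⁅z, (u : L)⁆⁆ - ⁅z, ⁅y, (u : L)⁆⁆ = ⁅x, (u : L)⁆
    rw [← lie_lie, h2]
  · ext u
    change ⁅z, ⁅x, (u : L)⁆⁆ - ⁅x, ⁅z, (u : L)⁆⁆ = ⁅y, (u : L)⁆
    rw [← lie_lie, h3]

theorem casimir_eq_zero (h : IsLeviDecomposition ε x y z T N) (u : N)
    (hu : casimir ε h.adX h.adY h.adZ u = 0) : u = 0 :=
  Subtype.ext (h.casimir_inj u u.2 (Subtype.ext_iff.mp hu))

theorem adT_adX (h : IsLeviDecomposition ε x y z T N) {t : L} (ht : t ∈ T) (u : N) :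
    h.adT ht (h.adX u) = h.adX (h.adT ht u) := by
  apply Subtype.ext
  rw [coe_adT, coe_adX, coe_adX, coe_adT, leibniz_lie x, h.comm_x t ht, zero_lie, zero_add]

theorem adT_adY (h : IsLeviDecomposition ε x y z T N) {t : L} (ht : t ∈ T) (u : N) :
    h.adT ht (h.adY u) = h.adY (h.adT ht u) := by
  apply Subtype.ext
  rw [coe_adT, coe_adY, coe_adY, coe_adT, leibniz_lie y, h.comm_y t ht, zero_lie, zero_add]

theorem adT_adZ (h : IsLeviDecomposition ε x y z T N) {t : L} (ht : t ∈ T) (u : N) :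
    h.adT ht (h.adZ u) = h.adZ (h.adT ht u) := by
  apply Subtype.ext
  rw [coe_adT, coe_adZ, coe_adZ, coe_adT, leibniz_lie z, h.comm_z t ht, zero_lie, zero_add]

/-- The Casimir operator is bijective on `N`, so every element of `N` is a combination of brackets.
-/
theorem traceAd_eq_zero_of_mem [FiniteDimensional ℝ L] (h : IsLeviDecomposition ε x y z T N)
    {u : L} (hu : u ∈ N) :
    traceAd L u = 0 := by
  have hs : Function.Surjective (casimir ε h.adX h.adY h.adZ) := by
    rw [← LinearMap.injective_iff_surjective, ← LinearMap.ker_eq_bot, LinearMap.ker_eq_bot']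
    exact h.casimir_eq_zero
  obtain ⟨v, hv⟩ := hs ⟨u, hu⟩
  have : ⁅x, ⁅x, (v : L)⁆⁆ + ⁅y, ⁅y, (v : L)⁆⁆ + ε • ⁅z, ⁅z, (v : L)⁆⁆ = u := Subtype.ext_iff.mp hv
  rw [← this, map_add, map_add, map_smul, traceAd_lie, traceAd_lie, traceAd_lie]
  simp

theorem traceAd_x (h : IsLeviDecomposition ε x y z T N) : traceAd L x = 0 := by
  rw [← h.triple.2.1, traceAd_lie]

theorem traceAd_y (h : IsLeviDecomposition ε x y z T N) : traceAd L y = 0 := by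
  rw [← h.triple.2.2, traceAd_lie]

theorem traceAd_z (h : IsLeviDecomposition ε x y z T N) : traceAd L z = 0 := by
  have := traceAd_lie x y
  rw [h.triple.1, map_smul, smul_eq_mul] at this
  exact (mul_eq_zero.mp this).resolve_left h.sign_ne_zero

/-- The trace vanishes on the triple and on `N` but not on the principal element, so it is detected
on `T`. -/
theorem exists_traceAd_ne_zero [FiniteDimensional ℝ L] (h : IsLeviDecomposition ε x y z T N)
    (hdim : finrank ℝ L = 8)
    {β : Dual ℝ L} (hβ : IsRegularForm β) : ∃ t ∈ T, traceAd L t ≠ 0 := by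
  by_contra! hcon
  have h0 : traceAd L = 0 := by
    ext w
    obtain ⟨a, b, c, t, ht, u, hu, rfl⟩ := h.decomp w
    simp only [map_add, map_smul, h.traceAd_x, h.traceAd_y, h.traceAd_z, hcon t ht,
      h.traceAd_eq_zero_of_mem hu]
    simp
  have := hβ.finrank_eq_zero h0
  omega

/-- The span of `x, y, z` and `N`. -/
def perfectPart (_ : IsLeviDecomposition ε x y z T N) : Submodule ℝ L :=
  Submodule.span ℝ {x, y, z} ⊔ N

theorem mem_perfectPart (h : IsLeviDecomposition ε x y z T N) {w : L} :
    w ∈ h.perfectPart ↔ ∃ a b c : ℝ, ∃ u ∈ N, w = a • x + b • y + c • z + u := by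
  constructor
  · intro hw
    obtain ⟨s, hs, u, hu, rfl⟩ := Submodule.mem_sup.mp hw
    obtain ⟨a, b, c, rfl⟩ := Submodule.mem_span_triple.mp hs
    exact ⟨a, b, c, u, hu, rfl⟩
  · rintro ⟨a, b, c, u, hu, rfl⟩
    exact Submodule.mem_sup.mpr ⟨_, Submodule.mem_span_triple.mpr ⟨a, b, c, rfl⟩, u, hu, rfl⟩

theorem isCompl (h : IsLeviDecomposition ε x y z T N) : IsCompl h.perfectPart T := by
  rw [isCompl_iff, Submodule.disjoint_def, codisjoint_iff, eq_top_iff]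
  constructor
  · intro w hw hwT
    obtain ⟨a, b, c, u, hu, rfl⟩ := h.mem_perfectPart.mp hw
    obtain ⟨-, -, -, h4, -⟩ := h.indep a b c _ (T.neg_mem hwT) u hu (by abel)
    exact neg_eq_zero.mp h4
  · intro w _
    obtain ⟨a, b, c, t, ht, u, hu, rfl⟩ := h.decomp w
    exact Submodule.mem_sup.mpr ⟨a • x + b • y + c • z + u, h.mem_perfectPart.mpr
      ⟨a, b, c, u, hu, rfl⟩, t, ht, by abel⟩

theorem finrank_perfectPart [FiniteDimensional ℝ L] (h : IsLeviDecomposition ε x y z T N)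
    (hdim : finrank ℝ L = 8) :
    finrank ℝ h.perfectPart = 3 + finrank ℝ N := by
  have h1 := Submodule.finrank_sup_add_finrank_inf_eq h.perfectPart T
  rw [h.isCompl.sup_eq_top, h.isCompl.inf_eq_bot, finrank_bot, finrank_top] at h1
  have := h.finrank_add
  omega

theorem lie_mem_of_generators (h : IsLeviDecomposition ε x y z T N) {J : Submodule ℝ L} {g : L}
    (hx : ⁅x, g⁆ ∈ J) (hy : ⁅y, g⁆ ∈ J) (hz : ⁅z, g⁆ ∈ J) (hT : ∀ t ∈ T, ⁅t, g⁆ ∈ J)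
    (hN : ∀ u ∈ N, ⁅u, g⁆ ∈ J) (w : L) : ⁅w, g⁆ ∈ J := by
  obtain ⟨a, b, c, t, ht, u, hu, rfl⟩ := h.decomp w
  rw [add_lie, add_lie, add_lie, add_lie, smul_lie, smul_lie, smul_lie]
  exact J.add_mem (J.add_mem (J.add_mem (J.add_mem (J.smul_mem _ hx) (J.smul_mem _ hy))
    (J.smul_mem _ hz)) (hT t ht)) (hN u hu)

theorem lie_mem_perfectPart (h : IsLeviDecomposition ε x y z T N)
    (hN : ∀ u ∈ N, ∀ v ∈ N, ⁅u, v⁆ ∈ N) (w m : L) (hm : m ∈ h.perfectPart) :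
    ⁅w, m⁆ ∈ h.perfectPart := by
  have hNle : N ≤ h.perfectPart := le_sup_right
  have hS : ∀ a b c : ℝ, a • x + b • y + c • z ∈ h.perfectPart := fun a b c =>
    h.mem_perfectPart.mpr ⟨a, b, c, 0, N.zero_mem, by rw [add_zero]⟩
  have hx : x ∈ h.perfectPart := by simpa using hS 1 0 0
  have hy : y ∈ h.perfectPart := by simpa using hS 0 1 0
  have hz : z ∈ h.perfectPart := by simpa using hS 0 0 1
  have hswap : ∀ {a b : L}, ⁅a, b⁆ ∈ h.perfectPart → ⁅b, a⁆ ∈ h.perfectPart := by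
    intro a b hab
    rw [← lie_skew]
    exact h.perfectPart.neg_mem hab
  obtain ⟨h1, h2, h3⟩ := h.triple
  have hxy : ⁅x, y⁆ ∈ h.perfectPart := by rw [h1]; exact Submodule.smul_mem _ _ hz
  have hyz : ⁅y, z⁆ ∈ h.perfectPart := by rw [h2]; exact hx
  have hzx : ⁅z, x⁆ ∈ h.perfectPart := by rw [h3]; exact hy
  have h0 : ∀ v : L, ⁅v, v⁆ ∈ h.perfectPart := fun v => by rw [lie_self]; exact Submodule.zero_mem _
  obtain ⟨a, b, c, u, hu, rfl⟩ := h.mem_perfectPart.mp hm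
  rw [lie_add, lie_add, lie_add, lie_smul, lie_smul, lie_smul]
  refine Submodule.add_mem _ (Submodule.add_mem _ (Submodule.add_mem _ (Submodule.smul_mem _ _ ?_)
    (Submodule.smul_mem _ _ ?_)) (Submodule.smul_mem _ _ ?_)) ?_
  · exact h.lie_mem_of_generators (h0 x) (hswap hxy) hzx
      (fun t ht => hswap (by rw [h.comm_x t ht]; exact Submodule.zero_mem _))
      (fun u hu => hswap (hNle (h.stable_x u hu))) w
  · exact h.lie_mem_of_generators hxy (h0 y) (hswap hyz)
      (fun t ht => hswap (by rw [h.comm_y t ht]; exact Submodule.zero_mem _))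
      (fun u hu => hswap (hNle (h.stable_y u hu))) w
  · exact h.lie_mem_of_generators (hswap hzx) hyz (h0 z)
      (fun t ht => hswap (by rw [h.comm_z t ht]; exact Submodule.zero_mem _))
      (fun u hu => hswap (hNle (h.stable_z u hu))) w
  · exact h.lie_mem_of_generators (hNle (h.stable_x u hu)) (hNle (h.stable_y u hu))
      (hNle (h.stable_z u hu)) (fun t ht => hNle (h.lie_T_N t ht u hu))
      (fun v hv => hNle (hN v hv u hu)) w

/-- Elements of `T` which commute with `T` and `N` are central, hence zero. -/
theorem eq_zero_of_central (h : IsLeviDecomposition ε x y z T N) {β : Dual ℝ L}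
    (hβ : IsRegularForm β) {t : L} (ht : t ∈ T) (hT : ∀ s ∈ T, ⁅s, t⁆ = 0)
    (hN : ∀ u ∈ N, ⁅u, t⁆ = 0) : t = 0 := by
  apply hβ
  intro w
  have := h.lie_mem_of_generators (J := ⊥) (g := t) (by simp [h.comm_x t ht])
    (by simp [h.comm_y t ht]) (by simp [h.comm_z t ht]) (by simpa using hT) (by simpa using hN) w
  rw [Submodule.mem_bot] at this
  rw [← lie_skew, this, neg_zero, map_zero]

/-- `T` does not act trivially on `N`. -/
theorem exists_lie_ne_zero [FiniteDimensional ℝ L] (h : IsLeviDecomposition ε x y z T N)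
    (hdim : finrank ℝ L = 8)
    {β : Dual ℝ L} (hβ : IsRegularForm β) (hindec : IsIndecomposable L) :
    ∃ t ∈ T, ∃ u ∈ N, ⁅t, u⁆ ≠ 0 := by
  by_contra! hcon
  -- If `T` kills `N`, the `T`-component of a bracket of elements of `N` is central, hence zero.
  -- Consequently `perfectPart` and `T` are complementary ideals, both non-zero.
  have hNN : ∀ u ∈ N, ∀ v ∈ N, ⁅u, v⁆ ∈ N := by
    intro u hu v hv
    obtain ⟨t, ht, n, hn, htn⟩ := Submodule.mem_sup.mp (h.lie_N_N u hu v hv)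
    have ht0 : t = 0 := by
      refine h.eq_zero_of_central hβ ht (fun s hs => ?_) (fun w hw => ?_)
      · have h1 : ⁅s, t + n⁆ = 0 := by
          rw [htn, leibniz_lie, hcon s hs u hu, hcon s hs v hv, zero_lie, lie_zero, add_zero]
        rwa [lie_add, hcon s hs n hn, add_zero] at h1
      · rw [← lie_skew, hcon t ht w hw, neg_zero]
    rw [← htn, ht0, zero_add]
    exact hn
  let J : LieIdeal ℝ L := { h.perfectPart with
    lie_mem := fun {w m} hm => h.lie_mem_perfectPart hNN w m hm }
  let I : LieIdeal ℝ L := { T with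
    lie_mem := fun {w m} hm => h.lie_mem_of_generators (J := T) (g := m)
      (by rw [h.comm_x m hm]; exact T.zero_mem) (by rw [h.comm_y m hm]; exact T.zero_mem)
      (by rw [h.comm_z m hm]; exact T.zero_mem) (fun t ht => h.lie_T_T t ht m hm)
      (fun u hu => by rw [← lie_skew, hcon m hm u hu, neg_zero]; exact T.zero_mem) w }
  have hJI : IsCompl J I := by
    rw [← LieSubmodule.isCompl_toSubmodule]
    exact h.isCompl
  rcases hindec J I hJI with h0 | h0
  · have h1 := h.finrank_perfectPart hdim
    have h2 : h.perfectPart = ⊥ := congrArg LieSubmodule.toSubmodule h0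
    rw [h2, finrank_bot] at h1
    omega
  · obtain ⟨t, ht, hχ⟩ := h.exists_traceAd_ne_zero hdim hβ
    have h2 : T = ⊥ := congrArg LieSubmodule.toSubmodule h0
    rw [h2, Submodule.mem_bot] at ht
    rw [ht, map_zero] at hχ
    exact hχ rfl

/-- If `T` acts on `N` by homotheties, the kernel of the action is an ideal of codimension at most
one in `T`. -/
theorem exists_kernel [FiniteDimensional ℝ L] (h : IsLeviDecomposition ε x y z T N)
    (hscal : ∀ t ∈ T, ∃ c : ℝ, ∀ u ∈ N, ⁅t, u⁆ = c • u) {u₀ : L} (hu₀ : u₀ ∈ N) (hne : u₀ ≠ 0) :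
    ∃ I : LieIdeal ℝ L, finrank ℝ T ≤ finrank ℝ I + 1 ∧
      ∀ t, t ∈ I ↔ t ∈ T ∧ ∀ u ∈ N, ⁅t, u⁆ = 0 := by
  choose c hc using fun t : T => hscal t t.2
  have hinj : ∀ {a b : ℝ}, a • u₀ = b • u₀ → a = b := fun {a b} hab =>
    smul_left_injective ℝ hne hab
  let φ : T →ₗ[ℝ] ℝ :=
    { toFun := c
      map_add' := fun s t => hinj (by
        rw [← hc _ _ hu₀, Submodule.coe_add, add_lie, hc _ _ hu₀, hc _ _ hu₀, add_smul])
      map_smul' := fun r t => hinj (by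
        rw [← hc _ _ hu₀, Submodule.coe_smul, smul_lie, hc _ _ hu₀, RingHom.id_apply, smul_eq_mul,
          mul_smul]) }
  let K : Submodule ℝ L := (LinearMap.ker φ).map T.subtype
  have hK : ∀ t, t ∈ K ↔ t ∈ T ∧ ∀ u ∈ N, ⁅t, u⁆ = 0 := by
    intro t
    constructor
    · rintro ⟨s, hs, rfl⟩
      have hs : c s = 0 := hs
      exact ⟨s.2, fun u hu => by rw [Submodule.subtype_apply, hc s u hu, hs, zero_smul]⟩
    · rintro ⟨ht, hu⟩
      refine ⟨⟨t, ht⟩, hinj (a := c ⟨t, ht⟩) (b := 0) ?_, rfl⟩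
      rw [← hc _ _ hu₀, hu u₀ hu₀, zero_smul]
  have hKT : ∀ t ∈ K, ∀ s ∈ T, ⁅s, t⁆ ∈ K := by
    intro t ht s hs
    rw [hK] at ht ⊢
    refine ⟨h.lie_T_T s hs t ht.1, fun u hu => ?_⟩
    rw [lie_lie, ht.2 u hu, ht.2 _ (h.lie_T_N s hs u hu), lie_zero, sub_zero]
  refine ⟨{ K with
    lie_mem := fun {w m} hm => h.lie_mem_of_generators (J := K) (g := m)
      (by rw [h.comm_x m ((hK m).mp hm).1]; exact K.zero_mem)
      (by rw [h.comm_y m ((hK m).mp hm).1]; exact K.zero_mem)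
      (by rw [h.comm_z m ((hK m).mp hm).1]; exact K.zero_mem) (fun t ht => hKT m hm t ht)
      (fun u hu => by rw [← lie_skew, ((hK m).mp hm).2 u hu, neg_zero]; exact K.zero_mem) w },
    ?_, hK⟩
  change finrank ℝ T ≤ finrank ℝ K + 1
  have h1 := LinearMap.finrank_range_add_finrank_ker φ
  have h2 : finrank ℝ (LinearMap.range φ) ≤ 1 := by
    simpa using Submodule.finrank_le (LinearMap.range φ)
  have h3 : finrank ℝ K = finrank ℝ (LinearMap.ker φ) := Submodule.finrank_map_subtype_eq T _
  omega

end IsLeviDecomposition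
end Levi
end FrobeniusEight

/-! ### Exclusion of the small dimensions of `N` -/

namespace FrobeniusEight
open Module LieAlgebra
attribute [local instance 100] LieRing.ofAssociativeRing

section Levi
variable {L : Type*} [LieRing L] [LieAlgebra ℝ L] [FiniteDimensional ℝ L]
variable {ε : ℝ} {x y z : L} {T N : Submodule ℝ L}

theorem finrank_sup_of_disjoint {V : Type*} [AddCommGroup V] [Module ℝ V] [FiniteDimensional ℝ V]
    {U W : Submodule ℝ V} (h : Disjoint U W) : finrank ℝ ↥(U ⊔ W) = finrank ℝ U + finrank ℝ W := by
  have h1 := Submodule.finrank_sup_add_finrank_inf_eq U W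
  rwa [h.eq_bot, finrank_bot, add_zero] at h1

theorem traceAd_lieIdeal (I : LieIdeal ℝ L) (w : I) : traceAd I w = traceAd L (w : L) := by
  rw [traceAd_apply, traceAd_apply, ← LinearMap.trace_restrict_eq_of_forall_mem I.toSubmodule
    (ad ℝ L w) (fun v => lie_mem_left ℝ L I w v w.2)]
  rfl

namespace IsLeviDecomposition

/-- `T` has dimension three and acts by homotheties, not all zero, so the kernel `I` of the action
is a two-dimensional ideal, abelian by indecomposability. It commutes with the triple, with `N` and
with itself, a space of dimension `3 + 2 + 2`, and `2 + 7 > 8`. -/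
theorem finrank_ne_two (h : IsLeviDecomposition ε x y z T N) (hdim : finrank ℝ L = 8)
    {β : Dual ℝ L} (hβ : IsRegularForm β) (hindec : IsIndecomposable L) : finrank ℝ N ≠ 2 := by
  intro hN
  have hscal : ∀ t ∈ T, ∃ c : ℝ, ∀ u ∈ N, ⁅t, u⁆ = c • u := by
    intro t ht
    obtain ⟨c, hc⟩ := h.isTriple.exists_eq_smul_of_finrank_two h.casimir_eq_zero h.sign_ne_zero hN
      (h.adT_adX ht) (h.adT_adY ht) (h.adT_adZ ht)
    exact ⟨c, fun u hu => Subtype.ext_iff.mp (hc ⟨u, hu⟩)⟩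
  obtain ⟨t, ht, u, hu, htu⟩ := h.exists_lie_ne_zero hdim hβ hindec
  obtain ⟨I, hI, hmem⟩ := h.exists_kernel hscal hu (by rintro rfl; simp at htu)
  have hIT : I.toSubmodule < T := by
    refine lt_of_le_of_ne (fun s hs => ((hmem s).mp hs).1) ?_
    rintro hEq
    have : t ∈ I := by rw [← LieSubmodule.mem_toSubmodule, hEq]; exact ht
    exact htu (((hmem t).mp this).2 u hu)
  have h1 := Submodule.finrank_lt_finrank_of_lt hIT
  have h2 := h.finrank_add
  have hI2 : finrank ℝ I = 2 := by
    have h3 : finrank ℝ I.toSubmodule = finrank ℝ I := rfl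
    omega
  have hab := hindec.lie_eq_zero_of_finrank_two (by omega) I hI2
  have hdisj : Disjoint h.perfectPart I.toSubmodule := h.isCompl.disjoint.mono_right hIT.le
  have h4 := finrank_sup_of_disjoint hdisj
  rw [h.finrank_perfectPart hdim, hN] at h4
  have h5 := hβ.finrank_add_le I.toSubmodule (h.perfectPart ⊔ I.toSubmodule) (by
    intro s hs w hw
    obtain ⟨p, hp, r, hr, rfl⟩ := Submodule.mem_sup.mp hw
    obtain ⟨a, b, c, v, hv, rfl⟩ := h.mem_perfectPart.mp hp
    obtain ⟨hsT, hsN⟩ := (hmem s).mp hs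
    have e1 : ⁅s, x⁆ = 0 := by rw [← lie_skew, h.comm_x s hsT, neg_zero]
    have e2 : ⁅s, y⁆ = 0 := by rw [← lie_skew, h.comm_y s hsT, neg_zero]
    have e3 : ⁅s, z⁆ = 0 := by rw [← lie_skew, h.comm_z s hsT, neg_zero]
    simp [e1, e2, e3, hsN v hv, hab s hs r hr])
  have h6 : finrank ℝ I.toSubmodule = 2 := hI2
  omega

/-- Here `T` is a plane acting by homotheties, so a non-zero `t` in it kills `N`. The `T`-components
of brackets in `N` are invariant alternating forms, hence zero, and the triple with `N` spans a
six-dimensional ideal `J`. This is unimodular, so some non-zero `p` in `J` is orthogonal to `J`. The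
span of `p, t` is then orthogonal to `J` and `t`, and `2 + 7 > 8`. -/
theorem finrank_ne_three (h : IsLeviDecomposition ε x y z T N) (hdim : finrank ℝ L = 8)
    {β : Dual ℝ L} (hβ : IsRegularForm β) (hindec : IsIndecomposable L) : finrank ℝ N ≠ 3 := by
  intro hN
  have hscal : ∀ t ∈ T, ∃ c : ℝ, ∀ u ∈ N, ⁅t, u⁆ = c • u := by
    intro t ht
    obtain ⟨c, hc⟩ := h.isTriple.exists_eq_smul_of_finrank_three h.casimir_eq_zero h.sign_ne_zero
      hN (h.adT_adX ht) (h.adT_adY ht) (h.adT_adZ ht)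
    exact ⟨c, fun u hu => Subtype.ext_iff.mp (hc ⟨u, hu⟩)⟩
  obtain ⟨t₀, ht₀, u₀, hu₀, htu⟩ := h.exists_lie_ne_zero hdim hβ hindec
  obtain ⟨I, hI, hmem⟩ := h.exists_kernel hscal hu₀ (by rintro rfl; simp at htu)
  have h2 := h.finrank_add
  have : Nontrivial I := Module.nontrivial_of_finrank_pos (R := ℝ) (by omega)
  obtain ⟨⟨t, htI⟩, ht0⟩ := exists_ne (0 : I)
  obtain ⟨htT, htN⟩ := (hmem t).mp htI
  have ht0 : t ≠ 0 := fun h' => ht0 (Subtype.ext h')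
  let P : L →ₗ[ℝ] T := T.projectionOnto h.perfectPart h.isCompl.symm
  have hPT : ∀ s (hs : s ∈ T), P s = ⟨s, hs⟩ := fun s hs =>
    Submodule.projectionOnto_apply_left h.isCompl.symm ⟨s, hs⟩
  have hPN : ∀ u ∈ N, P u = 0 := fun u hu =>
    Submodule.projectionOnto_apply_of_mem_right h.isCompl.symm
      ((le_sup_right : N ≤ h.perfectPart) hu)
  have hP0 : ∀ u v : N, P ⁅(u : L), (v : L)⁆ = 0 := by
    intro u v
    rw [← Module.forall_dual_apply_eq_zero_iff ℝ]
    intro f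
    let B : N →ₗ[ℝ] N →ₗ[ℝ] ℝ := LinearMap.mk₂ ℝ (fun u v => f (P ⁅(u : L), (v : L)⁆))
      (by intros; simp) (by intros; simp) (by intros; simp) (by intros; simp)
    have hinv : ∀ g : L, (∀ s ∈ T, ⁅g, s⁆ = 0) → (∀ u ∈ N, ⁅g, u⁆ ∈ N) → ∀ u v : N,
        f (P ⁅⁅g, (u : L)⁆, (v : L)⁆) + f (P ⁅(u : L), ⁅g, (v : L)⁆⁆) = 0 := by
      intro g hgT hgN u v
      rw [← map_add, ← map_add, ← leibniz_lie]
      obtain ⟨s, hs, n, hn, hsn⟩ := Submodule.mem_sup.mp (h.lie_N_N u u.2 v v.2)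
      rw [← hsn, lie_add, hgT s hs, zero_add, hPN _ (hgN n hn), map_zero]
    have hB := h.isTriple.eq_zero_of_invariant h.casimir_eq_zero h.sign_ne_zero hN B
      (fun v => by simp [B]) (hinv x h.comm_x h.stable_x) (hinv y h.comm_y h.stable_y)
      (hinv z h.comm_z h.stable_z)
    exact LinearMap.congr_fun (LinearMap.congr_fun hB u) v
  have hNN : ∀ u ∈ N, ∀ v ∈ N, ⁅u, v⁆ ∈ N := by
    intro u hu v hv
    obtain ⟨s, hs, n, hn, hsn⟩ := Submodule.mem_sup.mp (h.lie_N_N u hu v hv)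
    have h3 := hP0 ⟨u, hu⟩ ⟨v, hv⟩
    rw [← hsn, map_add, hPT s hs, hPN n hn, add_zero] at h3
    have hs0 : s = 0 := Subtype.ext_iff.mp h3
    rw [← hsn, hs0, zero_add]
    exact hn
  let J : LieIdeal ℝ L := { h.perfectPart with
    lie_mem := fun {w m} hm => h.lie_mem_perfectPart hNN w m hm }
  have hJ : finrank ℝ J = 6 := by
    have := h.finrank_perfectPart hdim
    rw [hN] at this
    exact this
  have hχ : traceAd J = 0 := by
    ext ⟨w, hw⟩
    rw [traceAd_lieIdeal]
    obtain ⟨a, b, c, u, hu, rfl⟩ := h.mem_perfectPart.mp hw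
    simp [h.traceAd_x, h.traceAd_y, h.traceAd_z, h.traceAd_eq_zero_of_mem hu]
  obtain ⟨p, hp, hp0⟩ : ∃ p : J, (∀ w : J, β ⁅(p : L), (w : L)⁆ = 0) ∧ p ≠ 0 := by
    by_contra! hcon
    have hreg : IsRegularForm (β ∘ₗ J.toSubmodule.subtype : Dual ℝ J) := fun p hp => hcon p hp
    have := hreg.finrank_eq_zero hχ
    omega
  have hp0 : (p : L) ≠ 0 := fun h' => hp0 (Subtype.ext h')
  have hpJ : (p : L) ∈ h.perfectPart := p.2
  have hspT : Submodule.span ℝ {t} ≤ T := by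
    rw [Submodule.span_le, Set.singleton_subset_iff]; exact htT
  have hspJ : Submodule.span ℝ {(p : L)} ≤ h.perfectPart := by
    rw [Submodule.span_le, Set.singleton_subset_iff]; exact hpJ
  have htJ : ∀ w ∈ h.perfectPart, ⁅t, w⁆ = 0 := by
    intro w hw
    obtain ⟨a, b, c, v, hv, rfl⟩ := h.mem_perfectPart.mp hw
    have e1 : ⁅t, x⁆ = 0 := by rw [← lie_skew, h.comm_x t htT, neg_zero]
    have e2 : ⁅t, y⁆ = 0 := by rw [← lie_skew, h.comm_y t htT, neg_zero]
    have e3 : ⁅t, z⁆ = 0 := by rw [← lie_skew, h.comm_z t htT, neg_zero]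
    simp [e1, e2, e3, htN v hv]
  have h5 := hβ.finrank_add_le (Submodule.span ℝ {(p : L)} ⊔ Submodule.span ℝ {t})
    (h.perfectPart ⊔ Submodule.span ℝ {t}) (by
    intro a ha b hb
    obtain ⟨a₁, ha₁, a₂, ha₂, rfl⟩ := Submodule.mem_sup.mp ha
    obtain ⟨b₁, hb₁, b₂, hb₂, rfl⟩ := Submodule.mem_sup.mp hb
    obtain ⟨r, rfl⟩ := Submodule.mem_span_singleton.mp ha₁
    obtain ⟨r', rfl⟩ := Submodule.mem_span_singleton.mp ha₂
    obtain ⟨r'', rfl⟩ := Submodule.mem_span_singleton.mp hb₂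
    have e1 : ⁅(p : L), t⁆ = 0 := by rw [← lie_skew, htJ _ hpJ, neg_zero]
    have e2 := hp ⟨b₁, hb₁⟩
    simp only at e2
    simp [e1, e2, htJ b₁ hb₁])
  rw [finrank_sup_of_disjoint (h.isCompl.disjoint.mono hspJ hspT),
    finrank_sup_of_disjoint (h.isCompl.disjoint.mono_right hspT), finrank_span_singleton hp0,
    finrank_span_singleton ht0, h.finrank_perfectPart hdim] at h5
  omega

theorem finrank_eq_four (h : IsLeviDecomposition ε x y z T N) (hdim : finrank ℝ L = 8)
    {β : Dual ℝ L} (hβ : IsRegularForm β) (hindec : IsIndecomposable L) : finrank ℝ N = 4 := by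
  have h1 := h.isTriple.finrank_ne_one h.casimir_eq_zero h.sign_ne_zero
  have h2 := h.finrank_ne_two hdim hβ hindec
  have h3 := h.finrank_ne_three hdim hβ hindec
  have h4 := h.finrank_add
  obtain ⟨t, ht, u, hu, htu⟩ := h.exists_lie_ne_zero hdim hβ hindec
  have h0 : finrank ℝ N ≠ 0 := by
    intro h0
    rw [Submodule.finrank_eq_zero.mp h0, Submodule.mem_bot] at hu
    exact htu (by rw [hu, lie_zero])
  have h5 : finrank ℝ T ≠ 0 := by
    intro h0
    rw [Submodule.finrank_eq_zero.mp h0, Submodule.mem_bot] at ht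
    exact htu (by rw [ht, zero_lie])
  omega

end IsLeviDecomposition

/-- A Levi decomposition `L = ⟨x, y, z⟩ ⊕ ⟨d⟩ ⊕ N` with a four-dimensional ideal `N`. -/
structure IsReducedDecomposition {L : Type*} [LieRing L] [LieAlgebra ℝ L] (ε : ℝ) (x y z d : L)
    (N : Submodule ℝ L) : Prop where
  sign : ε = 1 ∨ ε = -1
  triple : IsTriple ε x y z
  comm_x : ⁅x, d⁆ = 0
  comm_y : ⁅y, d⁆ = 0
  comm_z : ⁅z, d⁆ = 0
  stable_x : ∀ u ∈ N, ⁅x, u⁆ ∈ N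
  stable_y : ∀ u ∈ N, ⁅y, u⁆ ∈ N
  stable_z : ∀ u ∈ N, ⁅z, u⁆ ∈ N
  stable_d : ∀ u ∈ N, ⁅d, u⁆ ∈ N
  lie_N_N : ∀ u ∈ N, ∀ v ∈ N, ⁅u, v⁆ ∈ N
  casimir_inj : ∀ u ∈ N, ⁅x, ⁅x, u⁆⁆ + ⁅y, ⁅y, u⁆⁆ + ε • ⁅z, ⁅z, u⁆⁆ = 0 → u = 0
  finrank_eq : finrank ℝ N = 4
  decomp : ∀ w : L, ∃ a b c e : ℝ, ∃ u ∈ N, w = a • x + b • y + c • z + e • d + u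
  traceAd_ne_zero : traceAd L d ≠ 0

/-- `T` is now the line of an element `d` of non-zero trace. Brackets and elements of `N` have trace
zero, so a bracket of elements of `N` has no component along `d`. -/
theorem IsLeviDecomposition.exists_isReducedDecomposition (h : IsLeviDecomposition ε x y z T N)
    (hdim : finrank ℝ L = 8) {β : Dual ℝ L} (hβ : IsRegularForm β) (hindec : IsIndecomposable L) :
    ∃ d, IsReducedDecomposition ε x y z d N := by
  have h4 := h.finrank_eq_four hdim hβ hindec
  obtain ⟨d, hd, hχ⟩ := h.exists_traceAd_ne_zero hdim hβ
  have hd0 : (⟨d, hd⟩ : T) ≠ 0 := by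
    intro h'
    have h'' : d = 0 := Subtype.ext_iff.mp h'
    rw [h'', map_zero] at hχ
    exact hχ rfl
  have hT : finrank ℝ T = 1 := by have := h.finrank_add; omega
  have hspan : ∀ t ∈ T, ∃ e : ℝ, t = e • d := by
    intro t ht
    obtain ⟨e, he⟩ := (finrank_eq_one_iff_of_nonzero' (⟨d, hd⟩ : T) hd0).mp hT ⟨t, ht⟩
    exact ⟨e, (Subtype.ext_iff.mp he).symm⟩
  refine ⟨d, h.sign, h.triple, h.comm_x d hd, h.comm_y d hd, h.comm_z d hd, h.stable_x, h.stable_y,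
    h.stable_z, h.lie_T_N d hd, ?_, h.casimir_inj, h4, ?_, hχ⟩
  · intro u hu v hv
    obtain ⟨s, hs, n, hn, hsn⟩ := Submodule.mem_sup.mp (h.lie_N_N u hu v hv)
    obtain ⟨e, rfl⟩ := hspan s hs
    have h1 := traceAd_lie u v
    rw [← hsn, map_add, map_smul, h.traceAd_eq_zero_of_mem hn, add_zero, smul_eq_mul] at h1
    have he := (mul_eq_zero.mp h1).resolve_right hχ
    rw [← hsn, he, zero_smul, zero_add]
    exact hn
  · intro w
    obtain ⟨a, b, c, t, ht, u, hu, rfl⟩ := h.decomp w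
    obtain ⟨e, rfl⟩ := hspan t ht
    exact ⟨a, b, c, e, u, hu, rfl⟩

end Levi
end FrobeniusEight

/-! ### Four-dimensional `𝔰𝔩₂`-modules without trivial submodules -/

namespace FrobeniusEight
open Module LieAlgebra

section SlTwo
variable {K V : Type*} [Field K] [AddCommGroup V] [Module K V]

/-- Endomorphisms satisfying the relations of the standard basis of `𝔰𝔩₂`, the Casimir operator
being injective. -/
structure IsSlTwoModule (e f h : Module.End K V) : Prop where
  lie_h_e : ∀ v, h (e v) = e (h v) + (2 : K) • e v
  lie_h_f : ∀ v, h (f v) = f (h v) - (2 : K) • f v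
  lie_e_f : ∀ v, e (f v) = f (e v) + h v
  casimir_inj : ∀ v, h (h v) + (2 : K) • h v + (4 : K) • f (e v) = 0 → v = 0

namespace IsSlTwoModule
variable {e f h : Module.End K V}

/-- The Casimir operator `h² + 2h + 4fe` is invariant under this exchange, which converts statements
on highest weights into statements on lowest weights. -/
theorem symm (H : IsSlTwoModule e f h) : IsSlTwoModule f e (-h) where
  lie_h_e v := by
    simp only [LinearMap.neg_apply, map_neg, H.lie_h_f]; module
  lie_h_f v := by
    simp only [LinearMap.neg_apply, map_neg, H.lie_h_e]; module
  lie_e_f v := by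
    simp only [LinearMap.neg_apply, H.lie_e_f]; module
  casimir_inj v hv := H.casimir_inj v (by
    rw [← hv]
    simp only [LinearMap.neg_apply, map_neg, H.lie_e_f]; module)

theorem eq_zero_of_e_h (H : IsSlTwoModule e f h) {v : V} (he : e v = 0) (hh : h v = 0) : v = 0 :=
  H.casimir_inj v (by simp [he, hh])

theorem weights_of_weight_three (H : IsSlTwoModule e f h) {v : V}
    (hh : h v = (3 : K) • v) :
    h (f v) = (1 : K) • f v ∧ h (f (f v)) = (-1 : K) • f (f v) ∧
      h (f (f (f v))) = (-3 : K) • f (f (f v)) := by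
  have h1 : h (f v) = (1 : K) • f v := by rw [H.lie_h_f, hh, map_smul]; module
  have h2 : h (f (f v)) = (-1 : K) • f (f v) := by rw [H.lie_h_f, h1, map_smul]; module
  exact ⟨h1, h2, by rw [H.lie_h_f, h2, map_smul]; module⟩

theorem raising_of_weight_three (H : IsSlTwoModule e f h) {v : V} (he : e v = 0)
    (hh : h v = (3 : K) • v) :
    e (f v) = (3 : K) • v ∧ e (f (f v)) = (4 : K) • f v ∧
      e (f (f (f v))) = (3 : K) • f (f v) := by
  obtain ⟨h1, h2, h3⟩ := H.weights_of_weight_three hh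
  have e1 : e (f v) = (3 : K) • v := by rw [H.lie_e_f, he, map_zero, zero_add, hh]
  have e2 : e (f (f v)) = (4 : K) • f v := by rw [H.lie_e_f, e1, h1, map_smul]; module
  exact ⟨e1, e2, by rw [H.lie_e_f, e2, h2, map_smul]; module⟩

variable [CharZero K]

/-- Non-zero powers `f ^ k` are eigenvectors of the commutator with `h`, with distinct eigenvalues
`-2k`; infinitely many of them cannot be independent. -/
theorem isNilpotent_f [FiniteDimensional K V] (H : IsSlTwoModule e f h) : IsNilpotent f := by
  by_contra hnil
  have hpow : ∀ k : ℕ, f ^ k ≠ 0 := fun k hk => hnil ⟨k, hk⟩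
  let A : Module.End K (Module.End K V) := LinearMap.mulLeft K h - LinearMap.mulRight K h
  have hA : ∀ k : ℕ, A (f ^ k) = (-2 * (k : K)) • f ^ k := by
    intro k
    ext v
    change h ((f ^ k) v) - (f ^ k) (h v) = (-2 * (k : K)) • (f ^ k) v
    induction k with
    | zero => simp
    | succ k ih =>
      rw [pow_succ', Module.End.mul_apply, Module.End.mul_apply, H.lie_h_f]
      have := congrArg f ih
      rw [map_sub, map_smul] at this
      push_cast
      linear_combination (norm := module) this
  have hli := Module.End.eigenvectors_linearIndependent' A (fun k : ℕ => -2 * (k : K))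
    (fun i j hij => by simpa using hij) (fun k => f ^ k)
    (fun k => ⟨Module.End.mem_eigenspace_iff.mpr (hA k), hpow k⟩)
  exact not_finite_iff_infinite.mpr inferInstance hli.finite

theorem f_pow_four [FiniteDimensional K V] (H : IsSlTwoModule e f h) (hV : finrank K V = 4)
    (v : V) : f (f (f (f v))) = 0 := by
  obtain ⟨n, hn⟩ := H.isNilpotent_f
  have h1 := (LinearMap.charpoly_eq_X_pow_iff f).mpr fun m => ⟨n, by rw [hn]; rfl⟩
  have h2 := LinearMap.aeval_self_charpoly f
  rw [h1, map_pow, Polynomial.aeval_X, hV] at h2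
  exact LinearMap.congr_fun h2 v

theorem e_pow_four [FiniteDimensional K V] (H : IsSlTwoModule e f h) (hV : finrank K V = 4)
    (v : V) : e (e (e (e v))) = 0 := H.symm.f_pow_four hV v

/-- On `ker e` one has `e fᵏ = k fᵏ⁻¹ (h - (k - 1))`. Starting from `f⁴ = 0` and applying `e`
repeatedly gives `h (h - 1) (h - 2) (h - 3) v = 0`. The vector `(h - 1) (h - 2) (h - 3) v` is thus
killed by `e` and `h`, hence by the Casimir operator. -/
theorem cubic [FiniteDimensional K V] (H : IsSlTwoModule e f h) (hV : finrank K V = 4)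
    {v : V} (he : e v = 0) :
    h (h (h v)) - (6 : K) • h (h v) + (11 : K) • h v - (6 : K) • v = 0 := by
  have hE : ∀ u, e u = 0 → e (h u) = 0 := by
    intro u hu
    have := H.lie_h_e u
    rw [hu, map_zero, smul_zero, add_zero] at this
    exact this.symm
  have s1 : ∀ u, e u = 0 → e (f u) = h u := fun u hu => by rw [H.lie_e_f, hu, map_zero, zero_add]
  have s2 : ∀ u, e u = 0 → e (f (f u)) = (2 : K) • f (h u - u) := fun u hu => by
    rw [H.lie_e_f, s1 u hu, H.lie_h_f, map_sub]; module
  have s3 : ∀ u, e u = 0 → e (f (f (f u))) = (3 : K) • f (f (h u - (2 : K) • u)) := fun u hu => by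
    rw [H.lie_e_f, s2 u hu, H.lie_h_f, H.lie_h_f]; simp only [map_sub, map_smul]; module
  have s4 : ∀ u, e u = 0 → e (f (f (f (f u)))) = (4 : K) • f (f (f (h u - (3 : K) • u))) :=
    fun u hu => by
      rw [H.lie_e_f, s3 u hu, H.lie_h_f, H.lie_h_f, H.lie_h_f]; simp only [map_sub, map_smul]
      module
  have hE' : ∀ u, e u = 0 → ∀ c : K, e (h u - c • u) = 0 := fun u hu c => by
    rw [map_sub, map_smul, hE u hu, hu, smul_zero, sub_zero]
  have t3 := s4 v he
  rw [H.f_pow_four hV, map_zero, eq_comm, smul_eq_zero_iff_right (by norm_num)] at t3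
  set v3 := h v - (3 : K) • v with hv3
  have e3 := hE' v he 3
  have t2 := s3 v3 e3
  rw [t3, map_zero, eq_comm, smul_eq_zero_iff_right (by norm_num)] at t2
  set v2 := h v3 - (2 : K) • v3 with hv2
  have e2 := hE' v3 e3 2
  have t1 := s2 v2 e2
  rw [t2, map_zero, eq_comm, smul_eq_zero_iff_right (by norm_num)] at t1
  have e1 := hE' v2 e2 1
  rw [one_smul] at e1
  have t0 := s1 _ e1
  rw [t1, map_zero] at t0
  have := H.eq_zero_of_e_h e1 t0.symm
  rw [← this, hv2, hv3]
  simp only [map_sub, map_smul]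
  module

/-- There are no one-dimensional quotients. -/
theorem eq_zero_of_comp [FiniteDimensional K V] (H : IsSlTwoModule e f h) {φ : V →ₗ[K] K}
    {a b : K} (he : ∀ v, φ (e v) = a * φ v) (hf : ∀ v, φ (f v) = b * φ v) : φ = 0 := by
  have h1 : ∀ v, φ (h v) = 0 := fun v => by
    have := congrArg φ (H.lie_e_f v)
    rw [map_add, he, hf, hf, he] at this
    linear_combination -this
  have h2 : ∀ v, φ (e v) = 0 := fun v => by
    have := congrArg φ (H.lie_h_e v)
    rw [map_add, h1, he, h1, map_smul, mul_zero, zero_add, eq_comm,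
      smul_eq_zero_iff_right (by norm_num)] at this
    exact this
  have h3 : ∀ v, φ (f v) = 0 := fun v => by
    have := congrArg φ (H.lie_h_f v)
    rw [map_sub, h1, hf, h1, map_smul, mul_zero, zero_sub, eq_comm, neg_eq_zero,
      smul_eq_zero_iff_right (by norm_num)] at this
    exact this
  let C : Module.End K V := h * h + (2 : K) • h + (4 : K) • (f * e)
  have hs : Function.Surjective C := by
    rw [← LinearMap.injective_iff_surjective, ← LinearMap.ker_eq_bot, LinearMap.ker_eq_bot']
    exact H.casimir_inj
  ext v
  obtain ⟨u, rfl⟩ := hs v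
  change φ (h (h u) + (2 : K) • h u + (4 : K) • f (e u)) = 0
  rw [map_add, map_add, map_smul, map_smul, h1, h1, h3]
  simp

/-- There is no highest weight vector of weight two. -/
theorem eq_zero_of_weight_two [FiniteDimensional K V] (H : IsSlTwoModule e f h)
    (hV : finrank K V = 4) {v : V} (he : e v = 0) (hh : h v = (2 : K) • v) : v = 0 := by
  by_contra hv
  have h1 : h (f v) = 0 := by rw [H.lie_h_f, hh, map_smul, sub_self]
  have h2 : h (f (f v)) = (-2 : K) • f (f v) := by rw [H.lie_h_f, h1, map_zero]; module
  have e1 : e (f v) = (2 : K) • v := by rw [H.lie_e_f, he, map_zero, zero_add, hh]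
  have e2 : e (f (f v)) = (2 : K) • f v := by rw [H.lie_e_f, e1, h1, map_smul, add_zero]
  have e3 : e (f (f (f v))) = 0 := by rw [H.lie_e_f, e2, h2, map_smul]; module
  have h3 : h (f (f (f v))) = (-4 : K) • f (f (f v)) := by rw [H.lie_h_f, h2, map_smul]; module
  -- This vector is killed by `e` and has weight `-4`, where the polynomial of `cubic` takes the
  -- value `-210`. So the string stops after three vectors, and its span is a submodule of
  -- codimension one, giving a forbidden one-dimensional quotient.
  have f3 : f (f (f v)) = 0 := by
    have := H.cubic hV e3
    simp only [h3, map_smul, smul_smul] at this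
    have h' : (-210 : K) • f (f (f v)) = 0 := by rw [← this]; module
    exact (smul_eq_zero.mp h').resolve_left (by norm_num)
  have hfv : f v ≠ 0 := by
    intro h0
    rw [h0, map_zero, eq_comm, smul_eq_zero_iff_right (by norm_num)] at e1
    exact hv e1
  have hffv : f (f v) ≠ 0 := by
    intro h0
    rw [h0, map_zero, eq_comm, smul_eq_zero_iff_right (by norm_num)] at e2
    exact hfv e2
  let W : Submodule K V := Submodule.span K {v, f v, f (f v)}
  have hli : LinearIndependent K ![v, f v, f (f v)] := by
    apply Module.End.eigenvectors_linearIndependent' h (![2, 0, -2] : Fin 3 → K)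
    · intro i j hij
      fin_cases i <;> fin_cases j <;> first | rfl | (exfalso; revert hij; norm_num)
    · intro i
      fin_cases i
      · exact ⟨Module.End.mem_eigenspace_iff.mpr hh, hv⟩
      · exact ⟨Module.End.mem_eigenspace_iff.mpr (by simpa using h1), hfv⟩
      · exact ⟨Module.End.mem_eigenspace_iff.mpr h2, hffv⟩
  have hrange : Submodule.span K (Set.range ![v, f v, f (f v)]) = W := by
    congr 1
    rw [Matrix.range_cons, Matrix.range_cons, Matrix.range_cons, Matrix.range_empty,
      Set.union_empty]
    rfl
  have hW : finrank K W = 3 := by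
    rw [← hrange, finrank_span_eq_card hli, Fintype.card_fin]
  have hvW : v ∈ W := Submodule.subset_span (by simp)
  have hfvW : f v ∈ W := Submodule.subset_span (by simp)
  have hffvW : f (f v) ∈ W := Submodule.subset_span (by simp)
  have stable : ∀ A : Module.End K V, A v ∈ W → A (f v) ∈ W → A (f (f v)) ∈ W →
      ∀ w ∈ W, A w ∈ W := by
    intro A a1 a2 a3 w hw
    obtain ⟨p, q, r, rfl⟩ := Submodule.mem_span_triple.mp hw
    simp only [map_add, map_smul]
    exact W.add_mem (W.add_mem (W.smul_mem _ a1) (W.smul_mem _ a2)) (W.smul_mem _ a3)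
  have hq : finrank K (V ⧸ W) = 1 := by
    have := Submodule.finrank_quotient_add_finrank W
    omega
  let ψ : (V ⧸ W) ≃ₗ[K] K := LinearEquiv.ofFinrankEq _ _ (by rw [hq, finrank_self])
  let φ : V →ₗ[K] K := ψ.toLinearMap ∘ₗ W.mkQ
  have hφ : ∀ v, φ v = 0 ↔ v ∈ W := fun v => by simp [φ]
  have hs : Function.Surjective φ := ψ.surjective.comp W.mkQ_surjective
  obtain ⟨u, hu⟩ := hs 1
  have key : ∀ A : Module.End K V, (∀ v ∈ W, A v ∈ W) → ∀ v, φ (A v) = φ (A u) * φ v := by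
    intro A hA v
    have h' : v - φ v • u ∈ W := by
      rw [← hφ, map_sub, map_smul, hu]; simp
    have := (hφ _).mpr (hA _ h')
    rw [map_sub, map_sub, map_smul, map_smul, sub_eq_zero, smul_eq_mul] at this
    rw [this, mul_comm]
  have := H.eq_zero_of_comp
    (key e (stable e (by rw [he]; exact W.zero_mem) (by rw [e1]; exact W.smul_mem _ hvW)
      (by rw [e2]; exact W.smul_mem _ hfvW)))
    (key f (stable f hfvW hffvW (by rw [f3]; exact W.zero_mem)))
  rw [this] at hu
  simp at hu

/-- Of the three possible highest weights 1, 2, 3 in `cubic`, weight two never occurs and weight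
three is excluded by hypothesis. -/
theorem weight_one_of_ker [FiniteDimensional K V] (H : IsSlTwoModule e f h)
    (hV : finrank K V = 4) (h3 : ∀ v, e v = 0 → h v = (3 : K) • v → v = 0) {v : V}
    (he : e v = 0) : h v = v := by
  have hE : ∀ u, e u = 0 → ∀ c : K, e (h u - c • u) = 0 := fun u hu c => by
    have := H.lie_h_e u
    rw [hu, map_zero, smul_zero, add_zero] at this
    rw [map_sub, map_smul, hu, ← this, smul_zero, sub_zero]
  have hc := H.cubic hV he
  have h2 : h (h v - (3 : K) • v) - (1 : K) • (h v - (3 : K) • v) = 0 := by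
    apply H.eq_zero_of_weight_two hV (hE _ (hE _ he _) _)
    rw [← sub_eq_zero, ← hc]
    simp only [map_sub, map_smul]
    module
  have h4 : h v - (1 : K) • v = 0 := by
    apply h3 _ (hE _ he _)
    rw [← sub_eq_zero, ← h2]
    simp only [map_sub, map_smul]
    module
  rwa [one_smul, sub_eq_zero] at h4

/-- Climbing the filtration by the kernels of powers of `e`: `h - 1` vanishes on `ker e`, and since
`h e = e (h + 2)` each further step contributes one factor, `h + 1`, `h + 3`, `h + 5`. As `e⁴ = 0`,
the product of all four vanishes. -/
theorem quartic [FiniteDimensional K V] (H : IsSlTwoModule e f h)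
    (hV : finrank K V = 4) (h3 : ∀ v, e v = 0 → h v = (3 : K) • v → v = 0) (v : V) :
    h (h (h (h v) - v)) + (8 : K) • h (h (h v) - v) + (15 : K) • (h (h v) - v) = 0 := by
  have k1 : ∀ v, e v = 0 → h v - v = 0 := fun v hv => by
    rw [H.weight_one_of_ker hV h3 hv, sub_self]
  have k2 : ∀ v, e (e v) = 0 → h (h v) - v = 0 := by
    intro v hv
    have := k1 _ hv
    rw [H.lie_h_e] at this
    have := k1 (h v + v) (by rw [← this, map_add]; module)
    rw [← this, map_add]
    module
  have k3 : ∀ v, e (e (e v)) = 0 → h (h (h v)) + (3 : K) • h (h v) - h v - (3 : K) • v = 0 := by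
    intro v hv
    have := k2 _ hv
    rw [H.lie_h_e, map_add, map_smul, H.lie_h_e, H.lie_h_e] at this
    have := k1 (h (h v) + (4 : K) • h v + (3 : K) • v) (by
      rw [← this, map_add, map_add, map_smul, map_smul]; module)
    rw [← this, map_add, map_add, map_smul, map_smul]
    module
  have := k3 _ (H.e_pow_four hV v)
  simp only [H.lie_h_e, map_add, map_smul] at this
  have := k1 (h (h (h v)) + (9 : K) • h (h v) + (23 : K) • h v + (15 : K) • v) (by
    rw [← this]; simp only [map_add, map_smul]; module)
  rw [← this]
  simp only [map_add, map_sub, map_smul]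
  module

/-- Without a highest weight vector of weight three, `h` is an involution. -/
theorem h_h_eq [FiniteDimensional K V] (H : IsSlTwoModule e f h)
    (hV : finrank K V = 4) (h3 : ∀ v, e v = 0 → h v = (3 : K) • v → v = 0) (v : V) :
    h (h v) = v := by
  -- A lowest weight vector of weight `-3`, raised three times, is a highest weight vector of weight
  -- three, hence zero. Lowering it back involves the non-zero coefficients 3, 4, 3, so the vector
  -- itself is zero.
  have h3' : ∀ v, f v = 0 → (-h) v = (3 : K) • v → v = 0 := by
    intro w hf hh
    have hh : h w = (-3 : K) • w := by
      rw [LinearMap.neg_apply] at hh; rw [← neg_neg (h w), hh]; module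
    have m1 : h (e w) = (-1 : K) • e w := by rw [H.lie_h_e, hh, map_smul]; module
    have m2 : h (e (e w)) = (1 : K) • e (e w) := by rw [H.lie_h_e, m1, map_smul]; module
    have m3 : h (e (e (e w))) = (3 : K) • e (e (e w)) := by rw [H.lie_h_e, m2, map_smul]; module
    have m4 := h3 _ (H.e_pow_four hV w) m3
    have hfe : ∀ u, f (e u) = e (f u) - h u := fun u => by rw [H.lie_e_f]; abel
    have n1 : f (e w) = (3 : K) • w := by rw [hfe, hf, hh, map_zero]; module
    have n2 : f (e (e w)) = (4 : K) • e w := by rw [hfe, n1, m1, map_smul]; module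
    have n3 : f (e (e (e w))) = (3 : K) • e (e w) := by rw [hfe, n2, m2, map_smul]; module
    rw [m4, map_zero, eq_comm, smul_eq_zero_iff_right (by norm_num)] at n3
    rw [n3, map_zero, eq_comm, smul_eq_zero_iff_right (by norm_num)] at n2
    rw [n2, map_zero, eq_comm, smul_eq_zero_iff_right (by norm_num)] at n1
    exact n1
  have q1 := H.quartic hV h3 v
  have q2 := H.symm.quartic hV h3' v
  simp only [LinearMap.neg_apply, map_neg, neg_neg] at q2
  set w := h (h v) - v
  have e1 : h w = 0 := by
    -- On `w = (h² - 1) v` the two quartics read `h² + 8h + 15` and `h² - 8h + 15`; their difference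
    -- is `16h`.
    have : (16 : K) • h w = 0 := by
      linear_combination (norm := module) q1 - q2
    exact (smul_eq_zero.mp this).resolve_left (by norm_num)
  rw [e1, map_zero, smul_zero, add_zero, zero_add, smul_eq_zero_iff_right (by norm_num)] at q1
  exact sub_eq_zero.mp q1

section WeightThree
variable {v : V}

theorem ne_zero_of_weight_three (H : IsSlTwoModule e f h) (he : e v = 0)
    (hh : h v = (3 : K) • v) (hv : v ≠ 0) : f v ≠ 0 ∧ f (f v) ≠ 0 ∧ f (f (f v)) ≠ 0 := by
  obtain ⟨e1, e2, e3⟩ := H.raising_of_weight_three he hh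
  have h1 : f v ≠ 0 := by
    intro h0
    rw [h0, map_zero, eq_comm, smul_eq_zero_iff_right (by norm_num)] at e1
    exact hv e1
  have h2 : f (f v) ≠ 0 := by
    intro h0
    rw [h0, map_zero, eq_comm, smul_eq_zero_iff_right (by norm_num)] at e2
    exact h1 e2
  refine ⟨h1, h2, fun h0 => h2 ?_⟩
  rwa [h0, map_zero, eq_comm, smul_eq_zero_iff_right (by norm_num)] at e3

/-- A highest weight vector of weight three generates the module. -/
theorem exists_combination [FiniteDimensional K V] (H : IsSlTwoModule e f h)
    (hV : finrank K V = 4) (he : e v = 0) (hh : h v = (3 : K) • v) (hv : v ≠ 0) (w : V) :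
    ∃ a b c d : K, w = a • v + b • f v + c • f (f v) + d • f (f (f v)) := by
  obtain ⟨h1, h2, h3⟩ := H.weights_of_weight_three hh
  obtain ⟨n1, n2, n3⟩ := H.ne_zero_of_weight_three he hh hv
  have hli : LinearIndependent K ![v, f v, f (f v), f (f (f v))] := by
    apply Module.End.eigenvectors_linearIndependent' h (![3, 1, -1, -3] : Fin 4 → K)
    · intro i j hij
      fin_cases i <;> fin_cases j <;> first | rfl | (exfalso; revert hij; norm_num)
    · intro i
      fin_cases i
      · exact ⟨Module.End.mem_eigenspace_iff.mpr hh, hv⟩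
      · exact ⟨Module.End.mem_eigenspace_iff.mpr h1, n1⟩
      · exact ⟨Module.End.mem_eigenspace_iff.mpr h2, n2⟩
      · exact ⟨Module.End.mem_eigenspace_iff.mpr h3, n3⟩
  have htop := hli.span_eq_top_of_card_eq_finrank (by simpa using hV.symm)
  have hw : w ∈ Submodule.span K (Set.range ![v, f v, f (f v), f (f (f v))]) := by
    rw [htop]; trivial
  obtain ⟨c, rfl⟩ := (Submodule.mem_span_range_iff_exists_fun K).mp hw
  exact ⟨c 0, c 1, c 2, c 3, by simp [Fin.sum_univ_four]⟩

end WeightThree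

end IsSlTwoModule
end SlTwo
end FrobeniusEight

/-! ### From real triples to `𝔰𝔩₂`: the split form, and the compact form after complexification -/

namespace FrobeniusEight
open Module LieAlgebra TensorProduct
attribute [local instance 100] LieRing.ofAssociativeRing

section RealForms
variable {V : Type*} [AddCommGroup V] [Module ℝ V] {X Y Z : Module.End ℝ V}

/-- With this dictionary `h² + 2h + 4fe` is four times the Casimir operator of the triple. -/
theorem IsTriple.isSlTwoModule (h : IsTriple (-1) X Y Z)
    (hinj : ∀ v, casimir (-1) X Y Z v = 0 → v = 0) :
    IsSlTwoModule (Y - Z) (Y + Z) ((2 : ℝ) • X) where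
  lie_h_e v := by
    obtain ⟨h1, h2, h3⟩ := h.apply v
    simp only [LinearMap.smul_apply, LinearMap.sub_apply, map_sub, map_smul]
    linear_combination (norm := module) (2 : ℝ) • h1 + (2 : ℝ) • h3
  lie_h_f v := by
    obtain ⟨h1, h2, h3⟩ := h.apply v
    simp only [LinearMap.smul_apply, LinearMap.add_apply, map_add, map_smul]
    linear_combination (norm := module) (2 : ℝ) • h1 - (2 : ℝ) • h3
  lie_e_f v := by
    obtain ⟨h1, h2, h3⟩ := h.apply v
    simp only [LinearMap.smul_apply, LinearMap.add_apply, LinearMap.sub_apply, map_add, map_sub]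
    linear_combination (norm := module) (2 : ℝ) • h2
  casimir_inj v hv := hinj v (by
    obtain ⟨h1, h2, h3⟩ := h.apply v
    rw [casimir_apply]
    simp only [LinearMap.smul_apply, LinearMap.add_apply, LinearMap.sub_apply, map_sub,
      map_smul] at hv
    linear_combination (norm := module) (1 / 4 : ℝ) • hv + h2)

/-- Complex conjugation on the complexification. -/
noncomputable def conjugation (V : Type*) [AddCommGroup V] [Module ℝ V] :
    ℂ ⊗[ℝ] V →ₗ[ℝ] ℂ ⊗[ℝ] V := LinearMap.rTensor V Complex.conjAe.toLinearMap

@[simp] theorem conjugation_tmul (c : ℂ) (v : V) :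
    conjugation V (c ⊗ₜ v) = (starRingEnd ℂ c) ⊗ₜ v := rfl

theorem conjugation_smul (c : ℂ) (w : ℂ ⊗[ℝ] V) :
    conjugation V (c • w) = starRingEnd ℂ c • conjugation V w := by
  induction w with
  | zero => simp
  | tmul a v => simp [smul_tmul']
  | add a b ha hb => rw [smul_add, map_add, ha, hb, map_add, smul_add]

theorem conjugation_conjugation (w : ℂ ⊗[ℝ] V) : conjugation V (conjugation V w) = w := by
  induction w with
  | zero => simp
  | tmul a v => simp
  | add a b ha hb => rw [map_add, map_add, ha, hb]

theorem conjugation_baseChange (A : Module.End ℝ V) (w : ℂ ⊗[ℝ] V) :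
    conjugation V (A.baseChange ℂ w) = A.baseChange ℂ (conjugation V w) := by
  induction w with
  | zero => simp
  | tmul a v => simp
  | add a b ha hb => rw [map_add, map_add, map_add, map_add, ha, hb]

/-- Here `h² + 2h + 4fe` is `-4` times the complexified Casimir operator. Complex conjugation
exchanges `e` with `-f` and `h` with `-h`. -/
theorem IsTriple.isSlTwoModule_baseChange [FiniteDimensional ℝ V] (h : IsTriple 1 X Y Z)
    (hinj : ∀ v, casimir 1 X Y Z v = 0 → v = 0) :
    IsSlTwoModule (Y.baseChange ℂ + Complex.I • Z.baseChange ℂ)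
      (-(Y.baseChange ℂ - Complex.I • Z.baseChange ℂ)) ((2 * Complex.I) • X.baseChange ℂ) := by
  obtain ⟨h1, h2, h3⟩ := h.mul_eq
  have hI : Complex.I * Complex.I = -1 := Complex.I_mul_I
  have b1 : ∀ v, X.baseChange ℂ (Y.baseChange ℂ v) = Y.baseChange ℂ (X.baseChange ℂ v)
      + Z.baseChange ℂ v := fun v => by
    have := congrArg (fun A : Module.End ℝ V => A.baseChange ℂ v) h1
    simpa [LinearMap.baseChange_add, LinearMap.baseChange_mul] using this
  have b2 : ∀ v, Y.baseChange ℂ (Z.baseChange ℂ v) = Z.baseChange ℂ (Y.baseChange ℂ v)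
      + X.baseChange ℂ v := fun v => by
    have := congrArg (fun A : Module.End ℝ V => A.baseChange ℂ v) h2
    simpa [LinearMap.baseChange_add, LinearMap.baseChange_mul] using this
  have b3 : ∀ v, Z.baseChange ℂ (X.baseChange ℂ v) = X.baseChange ℂ (Z.baseChange ℂ v)
      + Y.baseChange ℂ v := fun v => by
    have := congrArg (fun A : Module.End ℝ V => A.baseChange ℂ v) h3
    simpa [LinearMap.baseChange_add, LinearMap.baseChange_mul] using this
  refine ⟨fun v => ?_, fun v => ?_, fun v => ?_, fun v hv => ?_⟩
  · simp only [LinearMap.smul_apply, LinearMap.add_apply, map_add, map_smul, smul_add, smul_smul,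
      mul_assoc, hI]
    linear_combination (norm := skip) (2 * Complex.I) • b1 v + (2 : ℂ) • b3 v
    match_scalars <;>
      first | ring1 | linear_combination (2 : ℂ) * hI
  · simp only [LinearMap.smul_apply, LinearMap.neg_apply, LinearMap.sub_apply, map_neg, map_sub,
      map_smul, smul_sub, smul_neg, smul_smul, mul_assoc, hI]
    linear_combination (norm := skip) (-2 * Complex.I) • b1 v + (2 : ℂ) • b3 v
    match_scalars <;>
      first | ring1 | linear_combination (2 : ℂ) * hI
  · simp only [LinearMap.smul_apply, LinearMap.neg_apply, LinearMap.sub_apply,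
      LinearMap.add_apply, map_neg, map_sub,
      map_add, map_smul, smul_sub, smul_add, smul_neg, smul_smul, hI]
    linear_combination (norm := module) (2 * Complex.I) • b2 v
  · have hs : Function.Injective (casimir 1 X Y Z) := by
      rw [← LinearMap.ker_eq_bot, LinearMap.ker_eq_bot']
      exact hinj
    have hs' : Function.Injective ((casimir 1 X Y Z).baseChange ℂ) :=
      Module.Flat.lTensor_preserves_injective_linearMap (M := ℂ) _ hs
    apply hs'
    rw [map_zero]
    have e1 : (casimir 1 X Y Z).baseChange ℂ v = X.baseChange ℂ (X.baseChange ℂ v)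
        + Y.baseChange ℂ (Y.baseChange ℂ v) + Z.baseChange ℂ (Z.baseChange ℂ v) := by
      simp [casimir, LinearMap.baseChange_add, LinearMap.baseChange_mul]
    rw [e1]
    simp only [LinearMap.smul_apply, LinearMap.neg_apply, LinearMap.sub_apply,
      LinearMap.add_apply, map_add, map_smul, smul_sub, smul_add, smul_neg, smul_smul, mul_assoc, hI] at hv
    linear_combination (norm := skip) (-(1 / 4) : ℂ) • hv - Complex.I • b2 v
    match_scalars <;>
      first | ring1 | linear_combination (2 : ℂ) * hI | linear_combination (-2 : ℂ) * hI |
        linear_combination (1 / 4 : ℂ) * hI | linear_combination hI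

/-- The irreducible module of highest weight three is of quaternionic type, so it has no real form.
Concretely, conjugation `σ` reverses weights, so `σ (f v) = c • f² v`. Applying `e` and using `e σ =
-σ f` and `σ² = 1` gives `(1 + 4|c|²) f v = 0`. -/
theorem IsTriple.no_highest_weight_three [FiniteDimensional ℝ V] (h : IsTriple 1 X Y Z)
    (hinj : ∀ v, casimir 1 X Y Z v = 0 → v = 0) (hV : finrank ℝ V = 4) (v : ℂ ⊗[ℝ] V)
    (he : (Y.baseChange ℂ + Complex.I • Z.baseChange ℂ) v = 0)
    (hh : ((2 * Complex.I) • X.baseChange ℂ) v = (3 : ℂ) • v) : v = 0 := by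
  by_contra hv
  have H := h.isSlTwoModule_baseChange hinj
  have hV' : finrank ℂ (ℂ ⊗[ℝ] V) = 4 := by rw [Module.finrank_baseChange, hV]
  have σe : ∀ w, (Y.baseChange ℂ + Complex.I • Z.baseChange ℂ) (conjugation V w) =
      -conjugation V ((-(Y.baseChange ℂ - Complex.I • Z.baseChange ℂ)) w) := by
    intro w
    simp only [LinearMap.smul_apply, LinearMap.neg_apply, LinearMap.sub_apply,
      LinearMap.add_apply, map_neg, map_sub, conjugation_smul, conjugation_baseChange,
      Complex.conj_I]
    module
  have σh : ∀ w, ((2 * Complex.I) • X.baseChange ℂ) (conjugation V w) =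
      -conjugation V (((2 * Complex.I) • X.baseChange ℂ) w) := by
    intro w
    simp only [LinearMap.smul_apply, conjugation_smul, conjugation_baseChange, map_mul,
      Complex.conj_I, Complex.conj_ofNat]
    module
  have hcomb := H.exists_combination hV' he hh hv
  obtain ⟨w1, w2, w3⟩ := H.weights_of_weight_three hh
  obtain ⟨r1, r2, r3⟩ := H.raising_of_weight_three he hh
  obtain ⟨n1, n2, n3⟩ := H.ne_zero_of_weight_three he hh hv
  set e := Y.baseChange ℂ + Complex.I • Z.baseChange ℂ
  set f := -(Y.baseChange ℂ - Complex.I • Z.baseChange ℂ)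
  set g := (2 * Complex.I) • X.baseChange ℂ
  have hu : g (conjugation V (f v)) = -conjugation V (f v) := by rw [σh, w1, one_smul]
  obtain ⟨a, b, c, d, habcd⟩ := hcomb (conjugation V (f v))
  have hu2 : conjugation V (f v) = c • f (f v) := by
    -- `(t - 1) (t² - 9)` vanishes at the other weights 1, 3, -3 and equals 16 at -1, so it isolates
    -- the component of weight -1.
    have p1 : ∀ u, g u = (-1 : ℂ) • u →
        g (g (g u)) - g (g u) - (9 : ℂ) • g u + (9 : ℂ) • u = (16 : ℂ) • u := by
      intro u hu
      simp only [hu, map_smul]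
      module
    have p2 := p1 (conjugation V (f v)) (by rw [hu]; module)
    rw [habcd] at p2 ⊢
    simp only [map_add, map_smul, hh, w1, w2, w3] at p2
    linear_combination (norm := module) (-1 / 16 : ℂ) • p2
  have h1 : e (conjugation V (f v)) = (4 * c) • f v := by
    rw [hu2, map_smul, r2, smul_smul, mul_comm]
  have h2 : f v = (starRingEnd ℂ c) • conjugation V (f (f v)) := by
    rw [← conjugation_smul, ← hu2, conjugation_conjugation]
  rw [← neg_neg (conjugation V (f (f v))), ← σe, h1] at h2
  have h3 : (1 + 4 * (starRingEnd ℂ c * c)) • f v = 0 := by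
    linear_combination (norm := module) h2
  have h4 := (smul_eq_zero.mp h3).resolve_right n1
  rw [← Complex.normSq_eq_conj_mul_self] at h4
  have h5 : (1 + 4 * Complex.normSq c : ℝ) = 0 := by exact_mod_cast h4
  have := Complex.normSq_nonneg c
  linarith

/-- A compact triple without trivial submodules acts on a four-dimensional space through the
quaternions. -/
theorem IsTriple.sq_of_compact [FiniteDimensional ℝ V] (h : IsTriple 1 X Y Z)
    (hinj : ∀ v, casimir 1 X Y Z v = 0 → v = 0) (hV : finrank ℝ V = 4) (v : V) :
    X (X v) = (-(1 / 4) : ℝ) • v := by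
  have H := h.isSlTwoModule_baseChange hinj
  have hV' : finrank ℂ (ℂ ⊗[ℝ] V) = 4 := by rw [Module.finrank_baseChange, hV]
  have hsq := H.h_h_eq hV' (h.no_highest_weight_three hinj hV)
  have hI : Complex.I * Complex.I = -1 := Complex.I_mul_I
  have h0 : LinearMap.baseChangeHom ℝ ℂ V V ((4 : ℝ) • (X * X) + 1) = 0 := by
    refine LinearMap.ext fun w => ?_
    have h1 := hsq w
    have h2 : ((4 : ℝ) • (X * X) + 1 : Module.End ℝ V).baseChange ℂ w =
        (4 : ℂ) • X.baseChange ℂ (X.baseChange ℂ w) + w := by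
      simp [LinearMap.baseChange_add, LinearMap.baseChange_mul, LinearMap.baseChange_smul]
      have := algebraMap_smul ℂ (4 : ℝ) (X.baseChange ℂ (X.baseChange ℂ w))
      rw [map_ofNat] at this
      exact this.symm
    change ((4 : ℝ) • (X * X) + 1 : Module.End ℝ V).baseChange ℂ w = 0
    rw [h2]
    simp only [LinearMap.smul_apply, map_smul, smul_smul] at h1
    linear_combination (norm := skip) -h1
    match_scalars <;>
      first | ring1 | linear_combination (4 : ℂ) * hI
  have h1 := LinearMap.baseChangeHom_injective ℝ V ℂ (h0.trans (map_zero _).symm)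
  have h2 := LinearMap.congr_fun h1 v
  change (4 : ℝ) • X (X v) + v = 0 at h2
  linear_combination (norm := module) (1 / 4 : ℝ) • h2

end RealForms
end FrobeniusEight

/-! ### Lagrangian extensions: structure constants, left-symmetry and exactness -/

namespace FrobeniusEight
open Module LieAlgebra
attribute [local instance 100] LieRing.ofAssociativeRing

section Extension
variable {L : Type*} [LieRing L] [LieAlgebra ℝ L]

/-- The basis of `ℝ⁴ ⊕ (ℝ⁴)*` formed by the standard basis and its dual. -/
noncomputable def doubleBasis : Basis (Fin 4 ⊕ Fin 4) ℝ ((Fin 4 → ℝ) × Dual ℝ (Fin 4 → ℝ)) :=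
  (Pi.basisFun ℝ (Fin 4)).prod (Pi.basisFun ℝ (Fin 4)).dualBasis

theorem doubleBasis_inl (i : Fin 4) : doubleBasis (Sum.inl i) = (stdVec i, 0) := by
  simp [doubleBasis, stdVec]

theorem doubleBasis_inr (i : Fin 4) : doubleBasis (Sum.inr i) = (0, LinearMap.proj i) := by
  rw [doubleBasis, Basis.prod_apply, Sum.elim_inr, Function.comp_apply]
  refine Prod.ext rfl ?_
  refine LinearMap.ext fun v => ?_
  simp

variable {m : (Fin 4 → ℝ) →ₗ[ℝ] (Fin 4 → ℝ) →ₗ[ℝ] (Fin 4 → ℝ)}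

variable (m) in
/-- The bracket of the Lagrangian extension with zero two-cochain as a bilinear map. -/
noncomputable def extensionBilin :
    ((Fin 4 → ℝ) × Dual ℝ (Fin 4 → ℝ)) →ₗ[ℝ] ((Fin 4 → ℝ) × Dual ℝ (Fin 4 → ℝ)) →ₗ[ℝ]
      ((Fin 4 → ℝ) × Dual ℝ (Fin 4 → ℝ)) :=
  LinearMap.mk₂ ℝ (extensionBracket m 0)
    (by
      intro u u' v
      refine Prod.ext ?_ (LinearMap.ext fun w => ?_)
      · simp only [extensionBracket, Prod.fst_add, map_add, LinearMap.add_apply]; abel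
      · simp [extensionBracket, dualRep]; ring)
    (by
      intro c u v
      refine Prod.ext ?_ (LinearMap.ext fun w => ?_)
      · simp [extensionBracket, smul_sub]
      · simp [extensionBracket, dualRep, sub_eq_add_neg])
    (by
      intro u v v'
      refine Prod.ext ?_ (LinearMap.ext fun w => ?_)
      · simp only [extensionBracket, Prod.fst_add, map_add, LinearMap.add_apply]; abel
      · simp [extensionBracket, dualRep]; ring)
    (by
      intro c u v
      refine Prod.ext ?_ (LinearMap.ext fun w => ?_)
      · simp [extensionBracket, smul_sub]
      · simp [extensionBracket, dualRep, sub_eq_add_neg])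

/-- The dual pairing as a bilinear map. -/
noncomputable def pairingBilin :
    ((Fin 4 → ℝ) × Dual ℝ (Fin 4 → ℝ)) →ₗ[ℝ] ((Fin 4 → ℝ) × Dual ℝ (Fin 4 → ℝ)) →ₗ[ℝ] ℝ :=
  LinearMap.mk₂ ℝ pairingForm
    (by intro u u' v; simp [pairingForm]; ring) (by intro c u v; simp [pairingForm]; ring)
    (by intro u v v'; simp [pairingForm]; ring) (by intro c u v; simp [pairingForm]; ring)

theorem proj_comp_eq_sum (m : (Fin 4 → ℝ) →ₗ[ℝ] (Fin 4 → ℝ) →ₗ[ℝ] (Fin 4 → ℝ)) (i j : Fin 4) :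
    dualRep m (stdVec i) (LinearMap.proj j) =
      ∑ k, (-(m (stdVec i) (stdVec k) j)) • (LinearMap.proj k : Dual ℝ (Fin 4 → ℝ)) := by
  apply (Pi.basisFun ℝ (Fin 4)).ext
  intro k
  simp only [dualRep, LinearMap.neg_apply, LinearMap.dualMap_apply, LinearMap.sum_apply,
    LinearMap.smul_apply, LinearMap.proj_apply, Pi.basisFun_apply, stdVec, smul_eq_mul]
  simp [Pi.single_apply]

/-- A criterion for Lagrangian extensions in terms of structure constants. -/
theorem isLagrangianExtension_of_brackets (f : Basis (Fin 8) ℝ L)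
    (h₁ : ∀ i j : Fin 4, i < j → ⁅f (Fin.castAdd 4 i), f (Fin.castAdd 4 j)⁆ =
      ∑ k, (m (stdVec i) (stdVec j) k - m (stdVec j) (stdVec i) k) • f (Fin.castAdd 4 k))
    (h₂ : ∀ i j : Fin 4, ⁅f (Fin.castAdd 4 i), f (Fin.natAdd 4 j)⁆ =
      ∑ k, (-(m (stdVec i) (stdVec k) j)) • f (Fin.natAdd 4 k))
    (h₃ : ∀ i j : Fin 4, i < j → ⁅f (Fin.natAdd 4 i), f (Fin.natAdd 4 j)⁆ = 0) :
    IsLagrangianExtension f m 0 := by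
  let Φ : ((Fin 4 → ℝ) × Dual ℝ (Fin 4 → ℝ)) ≃ₗ[ℝ] L := doubleBasis.equiv f finSumFinEquiv
  have Φl : ∀ i, Φ (stdVec i, 0) = f (Fin.castAdd 4 i) := fun i => by
    rw [← doubleBasis_inl, Basis.equiv_apply, finSumFinEquiv_apply_left]
  have Φr : ∀ i, Φ (0, LinearMap.proj i) = f (Fin.natAdd 4 i) := fun i => by
    rw [← doubleBasis_inr, Basis.equiv_apply, finSumFinEquiv_apply_right]
  have h₁' : ∀ i j : Fin 4, ⁅f (Fin.castAdd 4 i), f (Fin.castAdd 4 j)⁆ =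
      ∑ k, (m (stdVec i) (stdVec j) k - m (stdVec j) (stdVec i) k) • f (Fin.castAdd 4 k) := by
    intro i j
    rcases lt_trichotomy i j with hij | rfl | hij
    · exact h₁ i j hij
    · simp
    · rw [← lie_skew, h₁ j i hij, ← Finset.sum_neg_distrib]
      exact Finset.sum_congr rfl fun k _ => by rw [← neg_smul, neg_sub]
  have h₃' : ∀ i j : Fin 4, ⁅f (Fin.natAdd 4 i), f (Fin.natAdd 4 j)⁆ = 0 := by
    intro i j
    rcases lt_trichotomy i j with hij | rfl | hij
    · exact h₃ i j hij
    · simp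
    · rw [← lie_skew, h₃ j i hij, neg_zero]
  have Φvec : ∀ x : Fin 4 → ℝ, Φ (x, 0) = ∑ k, x k • f (Fin.castAdd 4 k) := by
    intro x
    have hx : (x, (0 : Dual ℝ (Fin 4 → ℝ))) = ∑ k, x k • (stdVec k, 0) := by
      refine Prod.ext ?_ ?_
      · simp only [Prod.fst_sum, Prod.smul_fst, stdVec]
        exact pi_eq_sum_univ' x
      · simp [Prod.snd_sum]
    rw [hx, map_sum]
    exact Finset.sum_congr rfl fun k _ => by rw [map_smul, Φl]
  have Φdual : ∀ c : Fin 4 → ℝ, Φ (0, ∑ k, c k • (LinearMap.proj k : Dual ℝ (Fin 4 → ℝ))) =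
      ∑ k, c k • f (Fin.natAdd 4 k) := by
    intro c
    have hx : ((0 : Fin 4 → ℝ), ∑ k, c k • (LinearMap.proj k : Dual ℝ (Fin 4 → ℝ))) =
        ∑ k, c k • ((0 : Fin 4 → ℝ), (LinearMap.proj k : Dual ℝ (Fin 4 → ℝ))) := by
      refine Prod.ext ?_ ?_
      · simp [Prod.fst_sum]
      · simp [Prod.snd_sum]
    rw [hx, map_sum]
    exact Finset.sum_congr rfl fun k _ => by rw [map_smul, Φr]
  refine ⟨Φ, Φl, Φr, ?_, ?_⟩
  · have key : (extensionBilin m).compr₂ Φ.toLinearMap =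
        ((LieModule.toEnd ℝ L L).toLinearMap.compl₁₂ Φ.toLinearMap Φ.toLinearMap :
          _ →ₗ[ℝ] _ →ₗ[ℝ] L) := by
      refine LinearMap.ext_basis doubleBasis doubleBasis ?_
      rintro (i | i) (j | j)
      · simp only [doubleBasis_inl]
        change Φ (extensionBracket m 0 (stdVec i, 0) (stdVec j, 0)) =
          ⁅Φ (stdVec i, 0), Φ (stdVec j, 0)⁆
        rw [Φl, Φl, h₁', ← Φvec (fun k => m (stdVec i) (stdVec j) k - m (stdVec j) (stdVec i) k)]
        congr 1
        refine Prod.ext rfl ?_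
        simp [extensionBracket]
      · simp only [doubleBasis_inl, doubleBasis_inr]
        change Φ (extensionBracket m 0 (stdVec i, 0) (0, LinearMap.proj j)) =
          ⁅Φ (stdVec i, 0), Φ (0, LinearMap.proj j)⁆
        rw [Φl, Φr, h₂, ← Φdual, ← proj_comp_eq_sum]
        congr 1
        refine Prod.ext ?_ ?_ <;> simp [extensionBracket, dualRep]
      · simp only [doubleBasis_inl, doubleBasis_inr]
        change Φ (extensionBracket m 0 (0, LinearMap.proj i) (stdVec j, 0)) =
          ⁅Φ (0, LinearMap.proj i), Φ (stdVec j, 0)⁆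
        rw [Φl, Φr, ← lie_skew, h₂, ← Φdual, ← proj_comp_eq_sum, ← map_neg]
        congr 1
        refine Prod.ext ?_ ?_ <;> simp [extensionBracket, dualRep]
      · simp only [doubleBasis_inr]
        change Φ (extensionBracket m 0 (0, LinearMap.proj i) (0, LinearMap.proj j)) =
          ⁅Φ (0, LinearMap.proj i), Φ (0, LinearMap.proj j)⁆
        rw [Φr, Φr, h₃', ← map_zero Φ]
        congr 1
        refine Prod.ext ?_ (LinearMap.ext fun w => ?_) <;> simp [extensionBracket, dualRep]
    exact fun u v => LinearMap.congr_fun (LinearMap.congr_fun key u) v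
  · have key : pairingBilin = (omegaZero f).compl₁₂ Φ.toLinearMap Φ.toLinearMap := by
      refine LinearMap.ext_basis doubleBasis doubleBasis ?_
      have hΦ : ∀ s, Φ (doubleBasis s) = f (finSumFinEquiv s) := fun s => Basis.equiv_apply _ _ _ _
      have hcl : ∀ (i : Fin 4) (s : Fin 4 ⊕ Fin 4),
          f.coord (Fin.castAdd 4 i) (f (finSumFinEquiv s)) =
          if s = Sum.inl i then 1 else 0 := by
        intro i s
        rw [← finSumFinEquiv_apply_left, Basis.coord_apply, Basis.repr_self, Finsupp.single_apply]
        simp only [EmbeddingLike.apply_eq_iff_eq]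
      have hcr : ∀ (i : Fin 4) (s : Fin 4 ⊕ Fin 4),
          f.coord (Fin.natAdd 4 i) (f (finSumFinEquiv s)) =
          if s = Sum.inr i then 1 else 0 := by
        intro i s
        rw [← finSumFinEquiv_apply_right, Basis.coord_apply, Basis.repr_self, Finsupp.single_apply]
        simp only [EmbeddingLike.apply_eq_iff_eq]
      intro s t
      change pairingForm (doubleBasis s) (doubleBasis t) =
        omegaZero f (Φ (doubleBasis s)) (Φ (doubleBasis t))
      rw [hΦ, hΦ, omegaZero, LinearMap.mk₂_apply]
      simp only [hcl, hcr]
      rcases s with i | i <;> rcases t with j | j <;>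
        simp [doubleBasis_inl, doubleBasis_inr, pairingForm, stdVec, Pi.single_apply, eq_comm]
    exact fun u v => (LinearMap.congr_fun (LinearMap.congr_fun key u) v).symm

/-- The product of a Lagrangian extension with zero two-cochain is left-symmetric. -/
theorem IsLagrangianExtension.isLeftSymmetric {f : Basis (Fin 8) ℝ L}
    (h : IsLagrangianExtension f m 0) : IsLeftSymmetric m := by
  obtain ⟨Φ, -, -, hΦ, -⟩ := h
  have jac : ∀ u v w, extensionBracket m 0 u (extensionBracket m 0 v w) =
      extensionBracket m 0 (extensionBracket m 0 u v) w +
        extensionBracket m 0 v (extensionBracket m 0 u w) := by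
    intro u v w
    apply Φ.injective
    rw [map_add, hΦ, hΦ, hΦ, hΦ, hΦ, hΦ, leibniz_lie]
  intro x y z
  rw [← sub_eq_zero, ← Module.forall_dual_apply_eq_zero_iff ℝ]
  intro ξ
  -- The dual component of the Jacobi identity for two elements of `𝔥` and one covector `ξ`,
  -- evaluated at `z`, is left-symmetry tested against `ξ`.
  have := LinearMap.congr_fun (congrArg Prod.snd (jac (x, 0) (y, 0) (0, ξ))) z
  simp [extensionBracket, dualRep] at this ⊢
  linarith

/-- With a right unit `e`, evaluation `(x, ξ) ↦ ξ e` is a primitive: `(ρ(x) ξ)(e) = -ξ (x · e) = -ξ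
x`, and the bracket of two elements of `𝔥` has no dual component. -/
theorem IsLagrangianExtension.isExactForm {f : Basis (Fin 8) ℝ L}
    (h : IsLagrangianExtension f m 0) {e : Fin 4 → ℝ} (he : ∀ i, m (stdVec i) e = stdVec i) :
    IsExactForm (omegaZero f) := by
  obtain ⟨Φ, -, -, hΦ, hω⟩ := h
  have he' : ∀ x, m x e = x := by
    have : m.flip e = LinearMap.id := (Pi.basisFun ℝ (Fin 4)).ext fun i => by
      simpa [stdVec] using he i
    exact fun x => LinearMap.congr_fun this x
  refine ⟨Dual.eval ℝ _ e ∘ₗ LinearMap.snd ℝ _ _ ∘ₗ Φ.symm.toLinearMap, fun p q => ?_⟩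
  obtain ⟨u, rfl⟩ := Φ.surjective p
  obtain ⟨v, rfl⟩ := Φ.surjective q
  rw [hω, ← hΦ]
  simp [extensionBracket, dualRep, pairingForm, he']
  ring

theorem isSymplecticForm_omegaZero (f : Basis (Fin 8) ℝ L) (h : IsExactForm (omegaZero f)) :
    IsSymplecticForm (omegaZero f) := by
  have hc : ∀ x y, omegaZero f x y = ∑ i : Fin 4,
      (f.coord (Fin.castAdd 4 i) x * f.coord (Fin.natAdd 4 i) y
        - f.coord (Fin.castAdd 4 i) y * f.coord (Fin.natAdd 4 i) x) := fun x y => rfl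
  have halt : ∀ x, omegaZero f x x = 0 := fun x => by rw [hc]; simp
  have hskew : ∀ x y, omegaZero f x y = -omegaZero f y x := fun x y => by
    rw [hc, hc, ← Finset.sum_neg_distrib]
    exact Finset.sum_congr rfl fun i _ => by ring
  have hnd : ∀ x, (∀ y, omegaZero f x y = 0) → x = 0 := by
    intro x hx
    have hne : ∀ i j : Fin 4, Fin.castAdd 4 i ≠ Fin.natAdd 4 j := fun i j => by
      simp [Fin.ext_iff]; omega
    have c₁ : ∀ i j : Fin 4, f.coord (Fin.castAdd 4 i) (f (Fin.castAdd 4 j)) =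
        if j = i then 1 else 0 := fun i j => by
      rw [Basis.coord_apply, Basis.repr_self, Finsupp.single_apply]
      simp only [(Fin.castAdd_injective 4 4).eq_iff]
    have c₂ : ∀ i j : Fin 4, f.coord (Fin.castAdd 4 i) (f (Fin.natAdd 4 j)) = 0 := fun i j => by
      rw [Basis.coord_apply, Basis.repr_self, Finsupp.single_apply, if_neg (hne i j).symm]
    have c₃ : ∀ i j : Fin 4, f.coord (Fin.natAdd 4 i) (f (Fin.castAdd 4 j)) = 0 := fun i j => by
      rw [Basis.coord_apply, Basis.repr_self, Finsupp.single_apply, if_neg (hne j i)]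
    have c₄ : ∀ i j : Fin 4, f.coord (Fin.natAdd 4 i) (f (Fin.natAdd 4 j)) =
        if j = i then 1 else 0 := fun i j => by
      rw [Basis.coord_apply, Basis.repr_self, Finsupp.single_apply]
      simp only [(Fin.natAdd_injective 4 4).eq_iff]
    have hl : ∀ j : Fin 4, f.coord (Fin.castAdd 4 j) x = 0 := by
      intro j
      have := hx (f (Fin.natAdd 4 j))
      rw [hc] at this
      simp only [c₂, c₄] at this
      simpa using this
    have hr : ∀ j : Fin 4, f.coord (Fin.natAdd 4 j) x = 0 := by
      intro j
      have := hx (f (Fin.castAdd 4 j))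
      rw [hc] at this
      simp only [c₁, c₃] at this
      simpa using this
    apply f.ext_elem
    intro i
    rw [map_zero, Finsupp.zero_apply]
    exact Fin.addCases (m := 4) (n := 4) (motive := fun i => f.repr x i = 0) hl hr i
  obtain ⟨β, hβ⟩ := h
  refine ⟨halt, ⟨hnd, fun y hy => hnd y fun x => by rw [hskew, hy, neg_zero]⟩, fun x y z => ?_⟩
  rw [hβ, hβ, hβ, ← neg_add, ← neg_add, ← map_add, ← map_add, neg_eq_zero]
  have := lie_jacobi x y z
  rw [← lie_skew ⁅x, y⁆ z, ← lie_skew ⁅y, z⁆ x, ← lie_skew ⁅z, x⁆ y]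
  have h0 : -⁅z, ⁅x, y⁆⁆ + -⁅x, ⁅y, z⁆⁆ + -⁅y, ⁅z, x⁆⁆ = 0 := by
    rw [← neg_eq_zero, ← this]; abel
  rw [h0, map_zero]

end Extension
end FrobeniusEight

/-! ### The six families: product tables, right units, reduction to brackets -/

namespace FrobeniusEight
open Module LieAlgebra

section Families
variable {L : Type*} [LieRing L] [LieAlgebra ℝ L]

theorem Family.product_stdVec (F : Family) (i j : Fin 4) :
    F.product (stdVec i) (stdVec j) = F.productTable i j := by
  simp [Family.product, stdVec, Pi.single_apply]

theorem Family.product_stdVec_apply (F : Family) (i : Fin 4) (e : Fin 4 → ℝ) :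
    F.product (stdVec i) e = ∑ j, e j • F.productTable i j := by
  simp [Family.product, stdVec, Pi.single_apply]

theorem isLagrangianExtension_of_table (F : Family) (f : Basis (Fin 8) ℝ L)
    (habel : AbelianBrackets (f 4) (f 5) (f 6) (f 7))
    (s01 : ⁅f 0, f 1⁆ = (F.productTable 0 1 0 - F.productTable 1 0 0) • f 0 +
      (F.productTable 0 1 1 - F.productTable 1 0 1) • f 1 +
      (F.productTable 0 1 2 - F.productTable 1 0 2) • f 2 +
      (F.productTable 0 1 3 - F.productTable 1 0 3) • f 3)
    (s02 : ⁅f 0, f 2⁆ = (F.productTable 0 2 0 - F.productTable 2 0 0) • f 0 +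
      (F.productTable 0 2 1 - F.productTable 2 0 1) • f 1 +
      (F.productTable 0 2 2 - F.productTable 2 0 2) • f 2 +
      (F.productTable 0 2 3 - F.productTable 2 0 3) • f 3)
    (s03 : ⁅f 0, f 3⁆ = (F.productTable 0 3 0 - F.productTable 3 0 0) • f 0 +
      (F.productTable 0 3 1 - F.productTable 3 0 1) • f 1 +
      (F.productTable 0 3 2 - F.productTable 3 0 2) • f 2 +
      (F.productTable 0 3 3 - F.productTable 3 0 3) • f 3)
    (s12 : ⁅f 1, f 2⁆ = (F.productTable 1 2 0 - F.productTable 2 1 0) • f 0 +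
      (F.productTable 1 2 1 - F.productTable 2 1 1) • f 1 +
      (F.productTable 1 2 2 - F.productTable 2 1 2) • f 2 +
      (F.productTable 1 2 3 - F.productTable 2 1 3) • f 3)
    (s13 : ⁅f 1, f 3⁆ = (F.productTable 1 3 0 - F.productTable 3 1 0) • f 0 +
      (F.productTable 1 3 1 - F.productTable 3 1 1) • f 1 +
      (F.productTable 1 3 2 - F.productTable 3 1 2) • f 2 +
      (F.productTable 1 3 3 - F.productTable 3 1 3) • f 3)
    (s23 : ⁅f 2, f 3⁆ = (F.productTable 2 3 0 - F.productTable 3 2 0) • f 0 +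
      (F.productTable 2 3 1 - F.productTable 3 2 1) • f 1 +
      (F.productTable 2 3 2 - F.productTable 3 2 2) • f 2 +
      (F.productTable 2 3 3 - F.productTable 3 2 3) • f 3)
    (d00 : ⁅f 0, f 4⁆ = (-F.productTable 0 0 0) • f 4 +
      (-F.productTable 0 1 0) • f 5 +
      (-F.productTable 0 2 0) • f 6 +
      (-F.productTable 0 3 0) • f 7)
    (d01 : ⁅f 0, f 5⁆ = (-F.productTable 0 0 1) • f 4 +
      (-F.productTable 0 1 1) • f 5 +
      (-F.productTable 0 2 1) • f 6 +
      (-F.productTable 0 3 1) • f 7)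
    (d02 : ⁅f 0, f 6⁆ = (-F.productTable 0 0 2) • f 4 +
      (-F.productTable 0 1 2) • f 5 +
      (-F.productTable 0 2 2) • f 6 +
      (-F.productTable 0 3 2) • f 7)
    (d03 : ⁅f 0, f 7⁆ = (-F.productTable 0 0 3) • f 4 +
      (-F.productTable 0 1 3) • f 5 +
      (-F.productTable 0 2 3) • f 6 +
      (-F.productTable 0 3 3) • f 7)
    (d10 : ⁅f 1, f 4⁆ = (-F.productTable 1 0 0) • f 4 +
      (-F.productTable 1 1 0) • f 5 +
      (-F.productTable 1 2 0) • f 6 +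
      (-F.productTable 1 3 0) • f 7)
    (d11 : ⁅f 1, f 5⁆ = (-F.productTable 1 0 1) • f 4 +
      (-F.productTable 1 1 1) • f 5 +
      (-F.productTable 1 2 1) • f 6 +
      (-F.productTable 1 3 1) • f 7)
    (d12 : ⁅f 1, f 6⁆ = (-F.productTable 1 0 2) • f 4 +
      (-F.productTable 1 1 2) • f 5 +
      (-F.productTable 1 2 2) • f 6 +
      (-F.productTable 1 3 2) • f 7)
    (d13 : ⁅f 1, f 7⁆ = (-F.productTable 1 0 3) • f 4 +
      (-F.productTable 1 1 3) • f 5 +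
      (-F.productTable 1 2 3) • f 6 +
      (-F.productTable 1 3 3) • f 7)
    (d20 : ⁅f 2, f 4⁆ = (-F.productTable 2 0 0) • f 4 +
      (-F.productTable 2 1 0) • f 5 +
      (-F.productTable 2 2 0) • f 6 +
      (-F.productTable 2 3 0) • f 7)
    (d21 : ⁅f 2, f 5⁆ = (-F.productTable 2 0 1) • f 4 +
      (-F.productTable 2 1 1) • f 5 +
      (-F.productTable 2 2 1) • f 6 +
      (-F.productTable 2 3 1) • f 7)
    (d22 : ⁅f 2, f 6⁆ = (-F.productTable 2 0 2) • f 4 +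
      (-F.productTable 2 1 2) • f 5 +
      (-F.productTable 2 2 2) • f 6 +
      (-F.productTable 2 3 2) • f 7)
    (d23 : ⁅f 2, f 7⁆ = (-F.productTable 2 0 3) • f 4 +
      (-F.productTable 2 1 3) • f 5 +
      (-F.productTable 2 2 3) • f 6 +
      (-F.productTable 2 3 3) • f 7)
    (d30 : ⁅f 3, f 4⁆ = (-F.productTable 3 0 0) • f 4 +
      (-F.productTable 3 1 0) • f 5 +
      (-F.productTable 3 2 0) • f 6 +
      (-F.productTable 3 3 0) • f 7)
    (d31 : ⁅f 3, f 5⁆ = (-F.productTable 3 0 1) • f 4 +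
      (-F.productTable 3 1 1) • f 5 +
      (-F.productTable 3 2 1) • f 6 +
      (-F.productTable 3 3 1) • f 7)
    (d32 : ⁅f 3, f 6⁆ = (-F.productTable 3 0 2) • f 4 +
      (-F.productTable 3 1 2) • f 5 +
      (-F.productTable 3 2 2) • f 6 +
      (-F.productTable 3 3 2) • f 7)
    (d33 : ⁅f 3, f 7⁆ = (-F.productTable 3 0 3) • f 4 +
      (-F.productTable 3 1 3) • f 5 +
      (-F.productTable 3 2 3) • f 6 +
      (-F.productTable 3 3 3) • f 7) :
    IsLagrangianExtension f F.product 0 := by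
  obtain ⟨a1, a2, a3, a4, a5, a6⟩ := habel
  apply isLagrangianExtension_of_brackets
  · simp only [Family.product_stdVec, Fin.sum_univ_four]
    intro i j hij
    fin_cases i <;> fin_cases j
    all_goals first
      | exact absurd hij (by decide) | exact s01 | exact s02 | exact s03 | exact s12 | exact s13
      | exact s23
  · simp only [Family.product_stdVec, Fin.sum_univ_four]
    intro i j
    fin_cases i <;> fin_cases j
    all_goals first
      | exact d00 | exact d01 | exact d02 | exact d03
      | exact d10 | exact d11 | exact d12 | exact d13
      | exact d20 | exact d21 | exact d22 | exact d23
      | exact d30 | exact d31 | exact d32 | exact d33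
  · intro i j hij
    fin_cases i <;> fin_cases j
    all_goals first
      | exact absurd hij (by decide) | exact a1 | exact a2 | exact a3 | exact a4 | exact a5
      | exact a6


theorem Family.isLagrangianExtension_one (f : Basis (Fin 8) ℝ L)
    (hb : (Family.one).HasBrackets f) :
    IsLagrangianExtension f (Family.one).product 0 := by
  obtain ⟨hab, ⟨s01, s02, s12, s03, s13, s23⟩, d00, d01, d02, d03, d10, d11, d12, d13, d20,
    d21, d22, d23, d30, d31, d32, d33⟩ := hb
  apply isLagrangianExtension_of_table _ f hab
  all_goals
    simp only [s01, s02, s12, s03, s13, s23, d00, d01, d02, d03, d10, d11, d12, d13, d20,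
    d21, d22,   d23, d30, d31, d32, d33]
    simp [Family.productTable, stdVec]
    try module

theorem Family.product_unit_one :
    ∀ i, (Family.one).product (stdVec i) (stdVec 0 + stdVec 3) = stdVec i := by
  intro i
  rw [Family.product_stdVec_apply, Fin.sum_univ_four]
  ext k
  fin_cases i <;> fin_cases k <;> simp [Family.productTable, stdVec]

theorem Family.isLagrangianExtension_two (lam : ℝ) (f : Basis (Fin 8) ℝ L)
    (hb : (Family.two lam).HasBrackets f) :
    IsLagrangianExtension f (Family.two lam).product 0 := by
  obtain ⟨hab, ⟨s01, s02, s12, s03, s13, s23⟩, d00, d01, d02, d03, d10, d11, d12, d13, d20,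
    d21, d22, d23, d30, d31, d32, d33⟩ := hb
  apply isLagrangianExtension_of_table _ f hab
  all_goals
    simp only [s01, s02, s12, s03, s13, s23, d00, d01, d02, d03, d10, d11, d12, d13, d20,
    d21, d22,   d23, d30, d31, d32, d33]
    simp [Family.productTable, stdVec]
    try module

theorem Family.product_unit_two (lam : ℝ) :
    ∀ i, (Family.two lam).product (stdVec i) (lam • stdVec 2 + stdVec 3) = stdVec i := by
  intro i
  rw [Family.product_stdVec_apply, Fin.sum_univ_four]
  ext k
  fin_cases i <;> fin_cases k <;> simp [Family.productTable, stdVec] <;> ring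

theorem Family.isLagrangianExtension_three (f : Basis (Fin 8) ℝ L)
    (hb : (Family.three).HasBrackets f) :
    IsLagrangianExtension f (Family.three).product 0 := by
  obtain ⟨hab, ⟨s01, s02, s12, s03, s13, s23⟩, d00, d01, d02, d03, d10, d11, d12, d13, d20,
    d21, d22, d23, d30, d31, d32, d33⟩ := hb
  apply isLagrangianExtension_of_table _ f hab
  all_goals
    simp only [s01, s02, s12, s03, s13, s23, d00, d01, d02, d03, d10, d11, d12, d13, d20,
    d21, d22,   d23, d30, d31, d32, d33]
    simp [Family.productTable, stdVec]
    try module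

theorem Family.product_unit_three :
    ∀ i, (Family.three).product (stdVec i) (stdVec 3) = stdVec i := by
  intro i
  rw [Family.product_stdVec_apply, Fin.sum_univ_four]
  ext k
  fin_cases i <;> fin_cases k <;> simp [Family.productTable, stdVec]

theorem Family.isLagrangianExtension_four (nu : ℝ) (f : Basis (Fin 8) ℝ L)
    (hb : (Family.four nu).HasBrackets f) :
    IsLagrangianExtension f (Family.four nu).product 0 := by
  obtain ⟨hab, ⟨s01, s02, s12, s03, s13, s23⟩, d00, d01, d02, d03, d10, d11, d12, d13, d20,
    d21, d22, d23, d30, d31, d32, d33⟩ := hb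
  apply isLagrangianExtension_of_table _ f hab
  all_goals
    simp only [s01, s02, s12, s03, s13, s23, d00, d01, d02, d03, d10, d11, d12, d13, d20,
    d21, d22,   d23, d30, d31, d32, d33]
    simp [Family.productTable, stdVec]
    try module

theorem Family.product_unit_four (nu : ℝ) :
    ∀ i, (Family.four nu).product (stdVec i) (stdVec 0 + nu • stdVec 1 + stdVec 3) = stdVec i := by
  intro i
  rw [Family.product_stdVec_apply, Fin.sum_univ_four]
  ext k
  fin_cases i <;> fin_cases k <;> simp [Family.productTable, stdVec] <;> ring

theorem Family.isLagrangianExtension_five (mu : ℝ) (f : Basis (Fin 8) ℝ L)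
    (hb : (Family.five mu).HasBrackets f) :
    IsLagrangianExtension f (Family.five mu).product 0 := by
  obtain ⟨hab, ⟨s01, s02, s12, s03, s13, s23⟩, d00, d01, d02, d03, d10, d11, d12, d13, d20,
    d21, d22, d23, d30, d31, d32, d33⟩ := hb
  apply isLagrangianExtension_of_table _ f hab
  all_goals
    simp only [s01, s02, s12, s03, s13, s23, d00, d01, d02, d03, d10, d11, d12, d13, d20,
    d21, d22,   d23, d30, d31, d32, d33]
    simp [Family.productTable, stdVec]
    try module

theorem Family.product_unit_five (mu : ℝ) :
    ∀ i, (Family.five mu).product (stdVec i) (mu • stdVec 0 + stdVec 3) = stdVec i := by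
  intro i
  rw [Family.product_stdVec_apply, Fin.sum_univ_four]
  ext k
  fin_cases i <;> fin_cases k <;> simp [Family.productTable, stdVec] <;> ring

theorem Family.isLagrangianExtension_six (f : Basis (Fin 8) ℝ L)
    (hb : (Family.six).HasBrackets f) :
    IsLagrangianExtension f (Family.six).product 0 := by
  obtain ⟨hab, ⟨s01, s02, s12, s03, s13, s23⟩, d00, d01, d02, d03, d10, d11, d12, d13, d20,
    d21, d22, d23, d30, d31, d32, d33⟩ := hb
  apply isLagrangianExtension_of_table _ f hab
  all_goals
    simp only [s01, s02, s12, s03, s13, s23, d00, d01, d02, d03, d10, d11, d12, d13, d20,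
    d21, d22,   d23, d30, d31, d32, d33]
    simp [Family.productTable, stdVec]
    try module

theorem Family.product_unit_six :
    ∀ i, (Family.six).product (stdVec i) (stdVec 3) = stdVec i := by
  intro i
  rw [Family.product_stdVec_apply, Fin.sum_univ_four]
  ext k
  fin_cases i <;> fin_cases k <;> simp [Family.productTable, stdVec]

theorem Family.HasBrackets.isLagrangianExtension {F : Family} {f : Basis (Fin 8) ℝ L}
    (hb : F.HasBrackets f) : IsLagrangianExtension f F.product 0 := by
  cases F with
  | one => exact Family.isLagrangianExtension_one f hb
  | two lam => exact Family.isLagrangianExtension_two lam f hb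
  | three => exact Family.isLagrangianExtension_three f hb
  | four nu => exact Family.isLagrangianExtension_four nu f hb
  | five mu => exact Family.isLagrangianExtension_five mu f hb
  | six => exact Family.isLagrangianExtension_six f hb

theorem Family.exists_unit (F : Family) : ∃ e, ∀ i, F.product (stdVec i) e = stdVec i := by
  cases F with
  | one => exact ⟨_, Family.product_unit_one⟩
  | two lam => exact ⟨_, Family.product_unit_two lam⟩
  | three => exact ⟨_, Family.product_unit_three⟩
  | four nu => exact ⟨_, Family.product_unit_four nu⟩
  | five mu => exact ⟨_, Family.product_unit_five mu⟩
  | six => exact ⟨_, Family.product_unit_six⟩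

variable (L) in
/-- `L` has a basis in which it belongs to one of the six families. -/
def HasNormalForm : Prop :=
  ∃ f : Basis (Fin 8) ℝ L, IsSymplecticForm (omegaZero f) ∧ IsExactForm (omegaZero f) ∧
    ∃ F : Family, F.Admissible ∧ F.HasBrackets f ∧ IsLeftSymmetric F.product ∧
      IsLagrangianExtension f F.product 0

/-- Only the brackets have to be verified. They match the product table, the Jacobi identity of `L`
yields left-symmetry, the right unit yields exactness, and an exact form is closed. -/
theorem HasNormalForm.of_brackets (hdim : finrank ℝ L = 8) {F : Family} (hF : F.Admissible)
    {g : Fin 8 → L} (hb : F.HasBrackets g) (hspan : Submodule.span ℝ (Set.range g) = ⊤) :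
    HasNormalForm L := by
  let f : Basis (Fin 8) ℝ L := basisOfTopLeSpanOfCardEqFinrank g hspan.ge (by simp [hdim])
  have hf : ⇑f = g := coe_basisOfTopLeSpanOfCardEqFinrank _ _ _
  rw [← hf] at hb
  obtain ⟨e, he⟩ := F.exists_unit
  have hext := hb.isLagrangianExtension
  have hex := hext.isExactForm he
  exact ⟨f, isSymplecticForm_omegaZero f hex, hex, F, hF, hb, hext.isLeftSymmetric, hext⟩

end Families
end FrobeniusEight

/-! ### Adapted bases for each type of module -/

namespace FrobeniusEight
open Module LieAlgebra

section NormalForms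
variable {L : Type*} [LieRing L] [LieAlgebra ℝ L]

/-- `a, b, c, d` together with the four commuting vectors `v i` span `L`. -/
structure IsSpanningSystem (a b c d : L) (v : Fin 4 → L) : Prop where
  abelian : ∀ i j, ⁅v i, v j⁆ = 0
  span : ∀ S : Submodule ℝ L, a ∈ S → b ∈ S → c ∈ S → d ∈ S → (∀ i, v i ∈ S) → S = ⊤

variable {a b c d : L} {v : Fin 4 → L}

theorem IsSpanningSystem.hasNormalForm (H : IsSpanningSystem a b c d v)
    (hdim : finrank ℝ L = 8) {F : Family} (hF : F.Admissible) {g : Fin 8 → L}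
    (hb : F.HasBrackets g) (ha : g 0 = a) (hb' : g 1 = b) (hc : g 2 = c) (hd : g 3 = d)
    (hv : ∀ i, ∃ p q r s : ℝ, v i = p • g 4 + q • g 5 + r • g 6 + s • g 7) : HasNormalForm L := by
  refine HasNormalForm.of_brackets hdim hF hb ?_
  have hg : ∀ i, g i ∈ Submodule.span ℝ (Set.range g) := fun i => Submodule.subset_span ⟨i, rfl⟩
  refine H.span _ (ha ▸ hg 0) (hb' ▸ hg 1) (hc ▸ hg 2) (hd ▸ hg 3) fun i => ?_
  obtain ⟨p, q, r, s, h⟩ := hv i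
  rw [h]
  exact Submodule.add_mem _ (Submodule.add_mem _ (Submodule.add_mem _ (Submodule.smul_mem _ _
    (hg 4)) (Submodule.smul_mem _ _ (hg 5))) (Submodule.smul_mem _ _ (hg 6)))
    (Submodule.smul_mem _ _ (hg 7))

/-- The vectors `f₅, …, f₈` are dual to `f₁, …, f₄` for the pairing `-β ⁅·, ·⁆`, where `β` on the
module is minus the sum of the coordinates along `v 1` and `v 3`. The bases of the next three lemmas
arise in the same way from other `β`. -/
theorem IsSpanningSystem.hasNormalForm_three (H : IsSpanningSystem a b c d v)
    (hdim : finrank ℝ L = 8) (hsl : SlBrackets a b c d)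
    (a0 : ⁅a, v 0⁆ = 0) (a1 : ⁅a, v 1⁆ = (3 : ℝ) • v 0) (a2 : ⁅a, v 2⁆ = (4 : ℝ) • v 1)
    (a3 : ⁅a, v 3⁆ = (3 : ℝ) • v 2)
    (b0 : ⁅b, v 0⁆ = v 1) (b1 : ⁅b, v 1⁆ = v 2) (b2 : ⁅b, v 2⁆ = v 3) (b3 : ⁅b, v 3⁆ = 0)
    (c0 : ⁅c, v 0⁆ = (3 : ℝ) • v 0) (c1 : ⁅c, v 1⁆ = (1 : ℝ) • v 1)
    (c2 : ⁅c, v 2⁆ = (-1 : ℝ) • v 2) (c3 : ⁅c, v 3⁆ = (-3 : ℝ) • v 3)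
    (hd : ∀ i, ⁅d, v i⁆ = -v i) : HasNormalForm L := by
  refine H.hasNormalForm hdim (F := .three) trivial
    (g := ![a, b, c, d, (1 / 4 : ℝ) • (v 2 - v 0), v 0, (1 / 4 : ℝ) • (v 1 - v 3),
      (1 / 4 : ℝ) • ((-3 : ℝ) • v 1 - v 3)]) ?_ rfl rfl rfl rfl ?_
  · refine ⟨?_, hsl, ?_⟩
    · refine ⟨?_, ?_, ?_, ?_, ?_, ?_⟩ <;> simp [H.abelian]
    · refine ⟨?_, ?_, ?_, ?_, ?_, ?_, ?_, ?_, ?_, ?_, ?_, ?_, ?_, ?_, ?_, ?_⟩ <;>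
        simp only [Matrix.cons_val, lie_smul, lie_sub, a0, a1, a2, a3, b0, b1, b2, b3,
          c0, c1, c2, c3, hd] <;> module
  · intro i
    fin_cases i
    · exact ⟨0, 1, 0, 0, by simp⟩
    · exact ⟨0, 0, 1, -1, by simp only [Matrix.cons_val]; simp; module⟩
    · exact ⟨4, 1, 0, 0, by simp only [Matrix.cons_val]; simp⟩
    · exact ⟨0, 0, -3, -1, by simp only [Matrix.cons_val]; simp; module⟩

/-- The action of `𝔰𝔩₂` on a sum of two standard modules with highest weight vectors `v 0, v 1`. -/
structure IsDoubleStandard (a b c : L) (v : Fin 4 → L) : Prop where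
  a0 : ⁅a, v 0⁆ = 0
  a1 : ⁅a, v 1⁆ = 0
  a2 : ⁅a, v 2⁆ = v 0
  a3 : ⁅a, v 3⁆ = v 1
  b0 : ⁅b, v 0⁆ = v 2
  b1 : ⁅b, v 1⁆ = v 3
  b2 : ⁅b, v 2⁆ = 0
  b3 : ⁅b, v 3⁆ = 0
  c0 : ⁅c, v 0⁆ = v 0
  c1 : ⁅c, v 1⁆ = v 1
  c2 : ⁅c, v 2⁆ = -v 2
  c3 : ⁅c, v 3⁆ = -v 3

/-- The dual basis belongs to minus the sum of the coordinates along `v 0` and `v 3`. -/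
theorem IsSpanningSystem.hasNormalForm_two (H : IsSpanningSystem a b c d v)
    (hdim : finrank ℝ L = 8) (hsl : SlBrackets a b c d) (hv : IsDoubleStandard a b c v) {lam : ℝ}
    (hlam : 0 ≤ lam) (d0 : ⁅d, v 0⁆ = -v 0 - lam • v 0) (d1 : ⁅d, v 1⁆ = -v 1 + lam • v 1)
    (d2 : ⁅d, v 2⁆ = -v 2 - lam • v 2) (d3 : ⁅d, v 3⁆ = -v 3 + lam • v 3) : HasNormalForm L := by
  obtain ⟨a0, a1, a2, a3, b0, b1, b2, b3, c0, c1, c2, c3⟩ := hv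
  refine H.hasNormalForm hdim (F := .two lam) hlam
    (g := ![a, b, c, d, v 2, v 1, v 0 - ((1 + lam) / 2) • (v 0 + v 3),
      (-(1 / 2) : ℝ) • (v 0 + v 3)]) ?_ rfl rfl rfl rfl ?_
  · refine ⟨?_, hsl, ?_⟩
    · refine ⟨?_, ?_, ?_, ?_, ?_, ?_⟩ <;> simp [H.abelian]
    · refine ⟨?_, ?_, ?_, ?_, ?_, ?_, ?_, ?_, ?_, ?_, ?_, ?_, ?_, ?_, ?_, ?_⟩ <;>
        simp only [Matrix.cons_val, lie_smul, lie_sub, lie_add, a0, a1, a2, a3, b0, b1, b2, b3,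
          c0, c1, c2, c3, d0, d1, d2, d3] <;> module
  · intro i
    fin_cases i
    · exact ⟨0, 0, 1, -(1 + lam), by simp only [Matrix.cons_val]; simp; module⟩
    · exact ⟨0, 1, 0, 0, by simp⟩
    · exact ⟨1, 0, 0, 0, by simp⟩
    · exact ⟨0, 0, -1, lam - 1, by simp only [Matrix.cons_val]; simp; module⟩

/-- The dual basis belongs to the coordinate along `v 3` minus that along `v 0`. At `nu = 0` the
brackets are those of family one. -/
theorem IsSpanningSystem.hasNormalForm_four (H : IsSpanningSystem a b c d v)
    (hdim : finrank ℝ L = 8) (hsl : SlBrackets a b c d) (hv : IsDoubleStandard a b c v) {nu : ℝ}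
    (hnu : nu ≤ 0) (d0 : ⁅d, v 0⁆ = -v 0 + v 1) (d1 : ⁅d, v 1⁆ = -v 1 + nu • v 0)
    (d2 : ⁅d, v 2⁆ = -v 2 + v 3) (d3 : ⁅d, v 3⁆ = -v 3 + nu • v 2) : HasNormalForm L := by
  obtain ⟨a0, a1, a2, a3, b0, b1, b2, b3, c0, c1, c2, c3⟩ := hv
  have hspan : ∀ i, ∃ p q r s : ℝ, v i = p • (v 2 + (1 / 2 : ℝ) • (v 3 - v 0)) +
      q • (-v 1 - (nu / 2) • v 0 + (nu / 2) • v 3) + r • ((1 / 2 : ℝ) • (v 3 + v 0)) +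
        s • ((1 / 2 : ℝ) • (v 3 - v 0)) := by
    intro i
    fin_cases i
    · exact ⟨0, 0, 1, -1, by simp; module⟩
    · exact ⟨0, -1, 0, nu, by simp; module⟩
    · exact ⟨1, 0, 0, -1, by simp⟩
    · exact ⟨0, 0, 1, 1, by simp; module⟩
  rcases hnu.lt_or_eq with hnu | rfl
  · refine H.hasNormalForm hdim (F := .four nu) hnu
      (g := ![a, b, c, d, v 2 + (1 / 2 : ℝ) • (v 3 - v 0),
        -v 1 - (nu / 2) • v 0 + (nu / 2) • v 3, (1 / 2 : ℝ) • (v 3 + v 0),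
        (1 / 2 : ℝ) • (v 3 - v 0)]) ?_ rfl rfl rfl rfl hspan
    refine ⟨?_, hsl, ?_⟩
    · refine ⟨?_, ?_, ?_, ?_, ?_, ?_⟩ <;> simp [H.abelian]
    · refine ⟨?_, ?_, ?_, ?_, ?_, ?_, ?_, ?_, ?_, ?_, ?_, ?_, ?_, ?_, ?_, ?_⟩ <;>
        simp only [Matrix.cons_val, lie_smul, lie_sub, lie_add, lie_neg, a0, a1, a2, a3, b0, b1,
          b2, b3, c0, c1, c2, c3, d0, d1, d2, d3] <;> module
  · refine H.hasNormalForm hdim (F := .one) trivial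
      (g := ![a, b, c, d, v 2 + (1 / 2 : ℝ) • (v 3 - v 0),
        -v 1 - ((0 : ℝ) / 2) • v 0 + ((0 : ℝ) / 2) • v 3, (1 / 2 : ℝ) • (v 3 + v 0),
        (1 / 2 : ℝ) • (v 3 - v 0)]) ?_ rfl rfl rfl rfl hspan
    refine ⟨?_, hsl, ?_⟩
    · refine ⟨?_, ?_, ?_, ?_, ?_, ?_⟩ <;> simp [H.abelian]
    · refine ⟨?_, ?_, ?_, ?_, ?_, ?_, ?_, ?_, ?_, ?_, ?_, ?_, ?_, ?_, ?_, ?_⟩ <;>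
        simp only [Matrix.cons_val, lie_smul, lie_sub, lie_add, lie_neg, a0, a1, a2, a3, b0, b1,
          b2, b3, c0, c1, c2, c3, d0, d1, d2, d3] <;> module

/-- The dual basis belongs to the coordinate along `v 0`. At `mu = 0` the brackets are those of
family six. -/
theorem IsSpanningSystem.hasNormalForm_five (H : IsSpanningSystem a b c d v)
    (hdim : finrank ℝ L = 8) (hso : SoBrackets a b c d)
    (a0 : ⁅a, v 0⁆ = v 1) (a1 : ⁅a, v 1⁆ = (-(1 / 4) : ℝ) • v 0)
    (a2 : ⁅a, v 2⁆ = (1 / 2 : ℝ) • v 3) (a3 : ⁅a, v 3⁆ = (-(1 / 2) : ℝ) • v 2)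
    (b0 : ⁅b, v 0⁆ = v 2) (b1 : ⁅b, v 1⁆ = (-(1 / 2) : ℝ) • v 3)
    (b2 : ⁅b, v 2⁆ = (-(1 / 4) : ℝ) • v 0) (b3 : ⁅b, v 3⁆ = (1 / 2 : ℝ) • v 1)
    (c0 : ⁅c, v 0⁆ = v 3) (c1 : ⁅c, v 1⁆ = (1 / 2 : ℝ) • v 2)
    (c2 : ⁅c, v 2⁆ = (-(1 / 2) : ℝ) • v 1) (c3 : ⁅c, v 3⁆ = (-(1 / 4) : ℝ) • v 0)
    {mu : ℝ} (hmu : 0 ≤ mu)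
    (d0 : ⁅d, v 0⁆ = -v 0 - mu • v 1) (d1 : ⁅d, v 1⁆ = -v 1 + (mu / 4) • v 0)
    (d2 : ⁅d, v 2⁆ = -v 2 + (mu / 2) • v 3) (d3 : ⁅d, v 3⁆ = -v 3 - (mu / 2) • v 2) :
    HasNormalForm L := by
  have hspan : ∀ i, ∃ p q r s : ℝ, v i = p • ((4 : ℝ) • v 1 + mu • v 0) + q • ((4 : ℝ) • v 2) +
      r • ((4 : ℝ) • v 3) + s • v 0 := by
    intro i
    fin_cases i
    · exact ⟨0, 0, 0, 1, by simp⟩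
    · exact ⟨1 / 4, 0, 0, -(mu / 4), by simp; module⟩
    · exact ⟨0, 1 / 4, 0, 0, by simp⟩
    · exact ⟨0, 0, 1 / 4, 0, by simp⟩
  rcases hmu.lt_or_eq with hmu | rfl
  · refine H.hasNormalForm hdim (F := .five mu) hmu
      (g := ![a, b, c, d, (4 : ℝ) • v 1 + mu • v 0, (4 : ℝ) • v 2, (4 : ℝ) • v 3, v 0])
      ?_ rfl rfl rfl rfl hspan
    refine ⟨?_, hso, ?_⟩
    · refine ⟨?_, ?_, ?_, ?_, ?_, ?_⟩ <;> simp [H.abelian]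
    · refine ⟨?_, ?_, ?_, ?_, ?_, ?_, ?_, ?_, ?_, ?_, ?_, ?_, ?_, ?_, ?_, ?_⟩ <;>
        simp only [Matrix.cons_val, lie_smul, lie_add, a0, a1, a2, a3, b0, b1,
          b2, b3, c0, c1, c2, c3, d0, d1, d2, d3] <;> module
  · refine H.hasNormalForm hdim (F := .six) trivial
      (g := ![a, b, c, d, (4 : ℝ) • v 1 + (0 : ℝ) • v 0, (4 : ℝ) • v 2, (4 : ℝ) • v 3, v 0])
      ?_ rfl rfl rfl rfl hspan
    refine ⟨?_, hso, ?_⟩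
    · refine ⟨?_, ?_, ?_, ?_, ?_, ?_⟩ <;> simp [H.abelian]
    · refine ⟨?_, ?_, ?_, ?_, ?_, ?_, ?_, ?_, ?_, ?_, ?_, ?_, ?_, ?_, ?_, ?_⟩ <;>
        simp only [Matrix.cons_val, lie_smul, lie_add, a0, a1, a2, a3, b0, b1,
          b2, b3, c0, c1, c2, c3, d0, d1, d2, d3] <;> module

end NormalForms
end FrobeniusEight

/-! ### Commutativity of `N` and normalization of `d` -/

namespace FrobeniusEight
open Module LieAlgebra
attribute [local instance 100] LieRing.ofAssociativeRing

section Trace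
variable {V : Type*} [AddCommGroup V] [Module ℝ V]

/-- The trace of an endomorphism of a four-dimensional space in terms of a spanning family. -/
theorem trace_eq_of_spanning [FiniteDimensional ℝ V] (hV : finrank ℝ V = 4) {M : Module.End ℝ V}
    {b : Fin 4 → V} (hb : ∀ w, ∃ c : Fin 4 → ℝ, w = ∑ i, c i • b i) {m : Fin 4 → Fin 4 → ℝ}
    (hM : ∀ i, M (b i) = ∑ j, m i j • b j) : LinearMap.trace ℝ V M = ∑ i, m i i := by
  have hspan : ⊤ ≤ Submodule.span ℝ (Set.range b) := fun w _ =>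
    (Submodule.mem_span_range_iff_exists_fun ℝ).mpr ((hb w).imp fun c hc => hc.symm)
  let B : Basis (Fin 4) ℝ V := basisOfTopLeSpanOfCardEqFinrank b hspan (by simp [hV])
  have hB : ∀ i, b i = B i := fun i =>
    (congrFun (coe_basisOfTopLeSpanOfCardEqFinrank b hspan (by simp [hV])) i).symm
  rw [LinearMap.trace_eq_matrix_trace ℝ B, Matrix.trace]
  refine Finset.sum_congr rfl fun i _ => ?_
  rw [Matrix.diag_apply, LinearMap.toMatrix_apply, ← hB, hM]
  simp [hB, Finsupp.single_apply]

theorem eq_zero_of_trace_eq_zero [FiniteDimensional ℝ V] (hV : finrank ℝ V = 4)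
    {M : Module.End ℝ V} (htr : LinearMap.trace ℝ V M = 0) {c : ℝ} (hc : ∀ v, M v = c • v)
    (v : V) : M v = 0 := by
  have h1 : M = c • LinearMap.id := LinearMap.ext hc
  rw [h1, map_smul, LinearMap.trace_id, hV, smul_eq_mul] at htr
  have : c = 0 := by simpa using htr
  rw [hc, this, zero_smul]

end Trace

section Reduced
variable {L : Type*} [LieRing L] [LieAlgebra ℝ L] {N : Submodule ℝ L}

/-- If an element acts on the ideal `N` with a non-zero scalar square, then `N` is abelian. -/
theorem lie_eq_zero_of_sq (hN : ∀ u ∈ N, ∀ v ∈ N, ⁅u, v⁆ ∈ N) {a : L} {s : ℝ} (hs : s ≠ 0)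
    (ha : ∀ u ∈ N, ⁅a, u⁆ ∈ N) (hsq : ∀ u ∈ N, ⁅a, ⁅a, u⁆⁆ = s • u) :
    ∀ u ∈ N, ∀ v ∈ N, ⁅u, v⁆ = 0 := by
  -- Apply the derivation `ad a` twice to `⁅u, v⁆`. A second use of the resulting identity gives `s²
  -- = s² / 4` on brackets. In terms of eigenvalues, a sum of two square roots of `s` is never a
  -- square root of `s`.
  have key : ∀ u ∈ N, ∀ v ∈ N, ⁅⁅a, u⁆, ⁅a, v⁆⁆ = (-(s / 2)) • ⁅u, v⁆ := by
    intro u hu v hv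
    have h1 := hsq _ (hN u hu v hv)
    rw [leibniz_lie a u v, lie_add, leibniz_lie a ⁅a, u⁆ v, leibniz_lie a u ⁅a, v⁆, hsq u hu,
      hsq v hv, smul_lie, lie_smul] at h1
    linear_combination (norm := module) (1 / 2 : ℝ) • h1
  intro u hu v hv
  have h1 := key _ (ha u hu) _ (ha v hv)
  rw [hsq u hu, hsq v hv, key u hu v hv, smul_lie, lie_smul, smul_smul, smul_smul] at h1
  have h2 : (s * s * (3 / 4)) • ⁅u, v⁆ = 0 := by
    linear_combination (norm := module) h1
  exact (smul_eq_zero.mp h2).resolve_left (by positivity)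

/-- If `h` acts on the ideal `N` with weights `±1, ±3`, then vectors of odd weight commute. -/
theorem lie_eq_zero_of_odd_weights (hN : ∀ u ∈ N, ∀ v ∈ N, ⁅u, v⁆ ∈ N) {h : L}
    (hh : ∀ u ∈ N, ⁅h, ⁅h, ⁅h, ⁅h, u⁆⁆⁆⁆ - (10 : ℝ) • ⁅h, ⁅h, u⁆⁆ + (9 : ℝ) • u = 0) {u v : L}
    (hu : u ∈ N) (hv : v ∈ N) {m n : ℤ} (hm : ⁅h, u⁆ = ((2 * m + 1 : ℤ) : ℝ) • u)
    (hn : ⁅h, v⁆ = ((2 * n + 1 : ℤ) : ℝ) • v) : ⁅u, v⁆ = 0 := by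
  set k : ℤ := m + n + 1
  have h1 : ⁅h, ⁅u, v⁆⁆ = ((2 * k : ℤ) : ℝ) • ⁅u, v⁆ := by
    rw [leibniz_lie, hm, hn, smul_lie, lie_smul, ← add_smul]
    congr 1
    push_cast [k]
    ring
  have h2 := hh _ (hN u hu v hv)
  simp only [h1, lie_smul] at h2
  -- The bracket has even weight `2k`, where `(t² - 1) (t² - 9)` takes an odd integer value, hence a
  -- non-zero one.
  have h3 : ((16 * k ^ 4 - 40 * k ^ 2 + 9 : ℤ) : ℝ) • ⁅u, v⁆ = 0 := by
    rw [← h2]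
    push_cast
    module
  refine (smul_eq_zero.mp h3).resolve_left ?_
  rw [Int.cast_eq_zero]
  intro h0
  have : (2 : ℤ) ∣ 9 := ⟨-(8 * k ^ 4 - 20 * k ^ 2), by linarith⟩
  norm_num at this

namespace IsReducedDecomposition
variable {ε : ℝ} {x y z d : L}

/-- The endomorphism of `N` induced by `ad x`. -/
def adX (h : IsReducedDecomposition ε x y z d N) : Module.End ℝ N :=
  (ad ℝ L x).restrict h.stable_x

/-- The endomorphism of `N` induced by `ad y`. -/
def adY (h : IsReducedDecomposition ε x y z d N) : Module.End ℝ N :=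
  (ad ℝ L y).restrict h.stable_y

/-- The endomorphism of `N` induced by `ad z`. -/
def adZ (h : IsReducedDecomposition ε x y z d N) : Module.End ℝ N :=
  (ad ℝ L z).restrict h.stable_z

/-- The endomorphism of `N` induced by `ad d + 1`. -/
def adM (h : IsReducedDecomposition ε x y z d N) : Module.End ℝ N :=
  (ad ℝ L d).restrict h.stable_d + LinearMap.id

theorem coe_adM (h : IsReducedDecomposition ε x y z d N) (u : N) :
    (h.adM u : L) = ⁅d, (u : L)⁆ + u := rfl

theorem lie_d (h : IsReducedDecomposition ε x y z d N) (u : N) :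
    ⁅d, (u : L)⁆ = -u + h.adM u := by rw [coe_adM]; abel

theorem isTriple (h : IsReducedDecomposition ε x y z d N) : IsTriple ε h.adX h.adY h.adZ := by
  obtain ⟨h1, h2, h3⟩ := h.triple
  refine ⟨?_, ?_, ?_⟩
  · ext u
    change ⁅x, ⁅y, (u : L)⁆⁆ - ⁅y, ⁅x, (u : L)⁆⁆ = ε • ⁅z, (u : L)⁆
    rw [← lie_lie, h1, smul_lie]
  · ext u
    change ⁅y, ⁅z, (u : L)⁆⁆ - ⁅z, ⁅y, (u : L)⁆⁆ = ⁅x, (u : L)⁆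
    rw [← lie_lie, h2]
  · ext u
    change ⁅z, ⁅x, (u : L)⁆⁆ - ⁅x, ⁅z, (u : L)⁆⁆ = ⁅y, (u : L)⁆
    rw [← lie_lie, h3]

theorem casimir_eq_zero (h : IsReducedDecomposition ε x y z d N) (u : N)
    (hu : casimir ε h.adX h.adY h.adZ u = 0) : u = 0 :=
  Subtype.ext (h.casimir_inj u u.2 (Subtype.ext_iff.mp hu))

theorem adM_adX (h : IsReducedDecomposition ε x y z d N) (u : N) :
    h.adM (h.adX u) = h.adX (h.adM u) := by
  apply Subtype.ext
  change ⁅d, ⁅x, (u : L)⁆⁆ + ⁅x, (u : L)⁆ = ⁅x, ⁅d, (u : L)⁆ + u⁆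
  rw [lie_add, leibniz_lie x, h.comm_x, zero_lie, zero_add]

theorem adM_adY (h : IsReducedDecomposition ε x y z d N) (u : N) :
    h.adM (h.adY u) = h.adY (h.adM u) := by
  apply Subtype.ext
  change ⁅d, ⁅y, (u : L)⁆⁆ + ⁅y, (u : L)⁆ = ⁅y, ⁅d, (u : L)⁆ + u⁆
  rw [lie_add, leibniz_lie y, h.comm_y, zero_lie, zero_add]

theorem adM_adZ (h : IsReducedDecomposition ε x y z d N) (u : N) :
    h.adM (h.adZ u) = h.adZ (h.adM u) := by
  apply Subtype.ext
  change ⁅d, ⁅z, (u : L)⁆⁆ + ⁅z, (u : L)⁆ = ⁅z, ⁅d, (u : L)⁆ + u⁆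
  rw [lie_add, leibniz_lie z, h.comm_z, zero_lie, zero_add]

/-- Rescaling `d`. -/
theorem smul (h : IsReducedDecomposition ε x y z d N) {r : ℝ} (hr : r ≠ 0) :
    IsReducedDecomposition ε x y z (r • d) N :=
  { h with
    comm_x := by rw [lie_smul, h.comm_x, smul_zero]
    comm_y := by rw [lie_smul, h.comm_y, smul_zero]
    comm_z := by rw [lie_smul, h.comm_z, smul_zero]
    stable_d := fun u hu => by rw [smul_lie]; exact N.smul_mem _ (h.stable_d u hu)
    decomp := fun w => by
      obtain ⟨a, b, c, e, u, hu, rfl⟩ := h.decomp w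
      refine ⟨a, b, c, e / r, u, hu, ?_⟩
      rw [smul_smul, div_mul_cancel₀ _ hr]
    traceAd_ne_zero := by
      rw [map_smul]
      exact smul_ne_zero hr h.traceAd_ne_zero }

theorem trace_adM [FiniteDimensional ℝ L] (h : IsReducedDecomposition ε x y z d N) :
    LinearMap.trace ℝ N h.adM = traceAd L d + 4 := by
  have hmem : ∀ w, ad ℝ L d w ∈ N := by
    intro w
    obtain ⟨a, b, c, e, u, hu, rfl⟩ := h.decomp w
    have e1 : ⁅d, x⁆ = 0 := by rw [← lie_skew, h.comm_x, neg_zero]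
    have e2 : ⁅d, y⁆ = 0 := by rw [← lie_skew, h.comm_y, neg_zero]
    have e3 : ⁅d, z⁆ = 0 := by rw [← lie_skew, h.comm_z, neg_zero]
    simpa [e1, e2, e3] using h.stable_d u hu
  rw [adM, map_add, LinearMap.trace_id, h.finrank_eq, traceAd_apply,
    LinearMap.trace_restrict_eq_of_forall_mem N (ad ℝ L d) hmem]
  norm_num

/-- `ad d` maps `L` into `N`, so its trace on `N` is `traceAd L d`, which is non-zero. Rescaling
makes it `-4`, which cancels the trace of the identity of `N`. -/
theorem exists_trace_adM_eq_zero [FiniteDimensional ℝ L]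
    (h : IsReducedDecomposition ε x y z d N) :
    ∃ (d' : L) (h' : IsReducedDecomposition ε x y z d' N), LinearMap.trace ℝ N h'.adM = 0 := by
  have hχ := h.traceAd_ne_zero
  have hr : -4 / traceAd L d ≠ 0 := div_ne_zero (by norm_num) hχ
  refine ⟨_, h.smul hr, ?_⟩
  rw [trace_adM, map_smul, smul_eq_mul, div_mul_cancel₀ _ hχ]
  norm_num

theorem isSpanningSystem (h : IsReducedDecomposition ε x y z d N)
    (hab : ∀ u ∈ N, ∀ v ∈ N, ⁅u, v⁆ = 0) {a b c : L}
    (hspan : ∀ S : Submodule ℝ L, a ∈ S → b ∈ S → c ∈ S → x ∈ S ∧ y ∈ S ∧ z ∈ S)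
    {v : Fin 4 → N} (hv : ∀ w, ∃ c : Fin 4 → ℝ, w = ∑ i, c i • v i) :
    IsSpanningSystem a b c d (fun i => (v i : L)) where
  abelian i j := hab _ (v i).2 _ (v j).2
  span S ha hb hc hd hvS := by
    rw [eq_top_iff]
    intro w _
    obtain ⟨p, q, r, e, u, hu, rfl⟩ := h.decomp w
    obtain ⟨hx, hy, hz⟩ := hspan S ha hb hc
    obtain ⟨k, hk⟩ := hv ⟨u, hu⟩
    have hu' : u = ∑ i, k i • (v i : L) := by
      have := congrArg N.subtype hk
      simpa only [map_sum, map_smul, Submodule.subtype_apply] using this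
    refine S.add_mem (S.add_mem (S.add_mem (S.add_mem (S.smul_mem _ hx) (S.smul_mem _ hy))
      (S.smul_mem _ hz)) (S.smul_mem _ hd)) ?_
    rw [hu']
    exact S.sum_mem fun i _ => S.smul_mem _ (hvS i)

end IsReducedDecomposition
end Reduced
end FrobeniusEight

/-! ### The compact case: quaternions -/

namespace FrobeniusEight
open Module LieAlgebra
attribute [local instance 100] LieRing.ofAssociativeRing

section Compact
variable {V : Type*} [AddCommGroup V] [Module ℝ V] {X Y Z : Module.End ℝ V}

theorem IsTriple.rotate (h : IsTriple 1 X Y Z) : IsTriple 1 Y Z X :=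
  ⟨by rw [one_smul]; exact h.2.1, h.2.2, by rw [h.1, one_smul]⟩

theorem IsTriple.casimir_rotate (hinj : ∀ v, casimir 1 X Y Z v = 0 → v = 0) (v : V)
    (hv : casimir 1 Y Z X v = 0) : v = 0 :=
  hinj v (by rw [← hv, casimir_apply, casimir_apply]; module)

/-- Anticommutation in a compact triple. -/
theorem IsTriple.comp_of_sq (h : IsTriple 1 X Y Z) (hsq : ∀ v, X (X v) = (-(1 / 4) : ℝ) • v)
    (v : V) : X (Y v) = (1 / 2 : ℝ) • Z v ∧ Y (X v) = (-(1 / 2) : ℝ) • Z v := by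
  obtain ⟨h1, -, h3⟩ := h.apply v
  have h4 := (h.apply (X v)).2.2
  rw [hsq, h3, map_smul, map_add, hsq] at h4
  constructor
  · linear_combination (norm := module) (1 / 2 : ℝ) • h1 - (1 / 2 : ℝ) • h4
  · linear_combination (norm := module) (-(1 / 2) : ℝ) • h1 - (1 / 2 : ℝ) • h4

/-- The multiplication table of a compact triple acting through the quaternions. -/
structure IsQuaternionic (X Y Z : Module.End ℝ V) : Prop where
  xx : ∀ v, X (X v) = (-(1 / 4) : ℝ) • v
  yy : ∀ v, Y (Y v) = (-(1 / 4) : ℝ) • v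
  zz : ∀ v, Z (Z v) = (-(1 / 4) : ℝ) • v
  xy : ∀ v, X (Y v) = (1 / 2 : ℝ) • Z v
  yx : ∀ v, Y (X v) = (-(1 / 2) : ℝ) • Z v
  yz : ∀ v, Y (Z v) = (1 / 2 : ℝ) • X v
  zy : ∀ v, Z (Y v) = (-(1 / 2) : ℝ) • X v
  zx : ∀ v, Z (X v) = (1 / 2 : ℝ) • Y v
  xz : ∀ v, X (Z v) = (-(1 / 2) : ℝ) • Y v

theorem IsTriple.isQuaternionic [FiniteDimensional ℝ V] (h : IsTriple 1 X Y Z)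
    (hinj : ∀ v, casimir 1 X Y Z v = 0 → v = 0) (hV : finrank ℝ V = 4) :
    IsQuaternionic X Y Z := by
  have i1 := IsTriple.casimir_rotate hinj
  have i2 := IsTriple.casimir_rotate i1
  have s1 := h.sq_of_compact hinj hV
  have s2 := h.rotate.sq_of_compact i1 hV
  have s3 := h.rotate.rotate.sq_of_compact i2 hV
  exact ⟨s1, s2, s3, fun v => (h.comp_of_sq s1 v).1, fun v => (h.comp_of_sq s1 v).2,
    fun v => (h.rotate.comp_of_sq s2 v).1, fun v => (h.rotate.comp_of_sq s2 v).2,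
    fun v => (h.rotate.rotate.comp_of_sq s3 v).1, fun v => (h.rotate.rotate.comp_of_sq s3 v).2⟩

theorem IsQuaternionic.exists_combination (h : IsQuaternionic X Y Z) (hV : finrank ℝ V = 4)
    {v : V} (hv : v ≠ 0) (w : V) : ∃ c : Fin 4 → ℝ, w = ∑ i, c i • (![v, X v, Y v, Z v] i) := by
  have hli : LinearIndependent ℝ ![v, X v, Y v, Z v] := by
    rw [Fintype.linearIndependent_iff]
    intro g hg
    rw [Fin.sum_univ_four] at hg
    simp only [Matrix.cons_val] at hg
    have hX := congrArg X hg
    have hY := congrArg Y hg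
    have hZ := congrArg Z hg
    simp only [map_add, map_smul, map_zero, h.xx, h.xy, h.xz] at hX
    simp only [map_add, map_smul, map_zero, h.yx, h.yy, h.yz] at hY
    simp only [map_add, map_smul, map_zero, h.zx, h.zy, h.zz] at hZ
    -- Multiplication of the relation by the conjugate quaternion leaves the norm, a positive
    -- definite form in the coefficients.
    have h0 : (g 0 ^ 2 + (g 1 ^ 2 + g 2 ^ 2 + g 3 ^ 2) / 4) • v = 0 := by
      linear_combination (norm := module) g 0 • hg - g 1 • hX - g 2 • hY - g 3 • hZ
    have h1 := (smul_eq_zero.mp h0).resolve_right hv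
    intro i
    have h2 : g i ^ 2 = 0 := by
      have p0 := sq_nonneg (g 0)
      have p1 := sq_nonneg (g 1)
      have p2 := sq_nonneg (g 2)
      have p3 := sq_nonneg (g 3)
      fin_cases i <;> simp only [Fin.zero_eta, Fin.mk_one, Fin.reduceFinMk] <;> linarith
    exact pow_eq_zero_iff two_ne_zero |>.mp h2
  have htop := hli.span_eq_top_of_card_eq_finrank (by simpa using hV.symm)
  have hw : w ∈ Submodule.span ℝ (Set.range ![v, X v, Y v, Z v]) := by rw [htop]; trivial
  obtain ⟨c, hc⟩ := (Submodule.mem_span_range_iff_exists_fun ℝ).mp hw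
  exact ⟨c, hc.symm⟩

/-- A traceless endomorphism commuting with a quaternionic triple agrees with a multiple of `X` on
some vector. -/
theorem IsQuaternionic.exists_eq_smul [FiniteDimensional ℝ V] (h : IsQuaternionic X Y Z)
    (hV : finrank ℝ V = 4) {M : Module.End ℝ V} (htr : LinearMap.trace ℝ V M = 0)
    (hX : ∀ v, M (X v) = X (M v)) (hY : ∀ v, M (Y v) = Y (M v)) (hZ : ∀ v, M (Z v) = Z (M v)) :
    ∃ mu : ℝ, 0 ≤ mu ∧ ∃ v, v ≠ 0 ∧ M v = -(mu • X v) := by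
  have : Nontrivial V := Module.nontrivial_of_finrank_pos (R := ℝ) (by omega)
  obtain ⟨w, hw⟩ := exists_ne (0 : V)
  have hcomb := h.exists_combination hV hw
  obtain ⟨g, hg⟩ := hcomb (M w)
  rw [Fin.sum_univ_four] at hg
  simp only [Matrix.cons_val] at hg
  -- Since `M` commutes with the triple, `M w` determines its matrix on `w, X w, Y w, Z w`; every
  -- diagonal entry is `g 0`, so the trace condition makes `M` purely imaginary.
  have h0 := trace_eq_of_spanning hV hcomb (M := M)
    (m := ![![g 0, g 1, g 2, g 3], ![-(g 1) / 4, g 0, -(g 3) / 2, g 2 / 2],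
      ![-(g 2) / 4, g 3 / 2, g 0, -(g 1) / 2], ![-(g 3) / 4, -(g 2) / 2, g 1 / 2, g 0]]) (by
    intro i
    rw [Fin.sum_univ_four]
    fin_cases i
    · simpa using hg
    · simp only [Fin.mk_one, Matrix.cons_val, hX, hg, map_add, map_smul, h.xx, h.xy, h.xz]
      module
    · simp only [Fin.reduceFinMk, Matrix.cons_val, hY, hg, map_add, map_smul, h.yx, h.yy, h.yz]
      module
    · simp only [Fin.reduceFinMk, Matrix.cons_val, hZ, hg, map_add, map_smul, h.zx, h.zy, h.zz]
      module)
  rw [htr, Fin.sum_univ_four] at h0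
  simp only [Matrix.cons_val] at h0
  have h0 : g 0 = 0 := by linarith
  rw [h0, zero_smul, zero_add] at hg
  set mu := Real.sqrt (g 1 ^ 2 + g 2 ^ 2 + g 3 ^ 2)
  have hmu : mu ^ 2 = g 1 ^ 2 + g 2 ^ 2 + g 3 ^ 2 := Real.sq_sqrt (by positivity)
  refine ⟨mu, Real.sqrt_nonneg _, ?_⟩
  -- As `M² = -mu² / 4 = mu² X²`, one has `(M + mu X) (M - mu X) w = 0`, so `M w - mu X w` is a
  -- solution when it is non-zero. Otherwise `Y w` is one, because `Y` anticommutes with `X`.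
  by_cases hcase : M w = mu • X w
  · refine ⟨Y w, fun h' => hw ?_, ?_⟩
    · have := h.yy w
      rw [h', map_zero, eq_comm, smul_eq_zero_iff_right (by norm_num)] at this
      exact this
    · rw [hY, hcase, map_smul, h.yx, h.xy]; module
  · refine ⟨M w - mu • X w, sub_ne_zero.mpr hcase, ?_⟩
    have hMM : M (M w) = (-(mu ^ 2 / 4)) • w := by
      rw [hmu, hg]
      simp only [map_add, map_smul, hX, hY, hZ, hg, h.xx, h.xy, h.xz, h.yx, h.yy, h.yz, h.zx, h.zy,
        h.zz]
      module
    rw [map_sub, map_smul, hMM, hX, map_sub, map_smul, h.xx]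
    module

end Compact

section Conclusion
variable {L : Type*} [LieRing L] [LieAlgebra ℝ L] [FiniteDimensional ℝ L] {N : Submodule ℝ L}
variable {x y z d : L}

namespace IsReducedDecomposition

theorem hasNormalForm_of_compact (h : IsReducedDecomposition 1 x y z d N)
    (hdim : finrank ℝ L = 8) (htr : LinearMap.trace ℝ N h.adM = 0) : HasNormalForm L := by
  have hq := h.isTriple.isQuaternionic h.casimir_eq_zero h.finrank_eq
  have hab := lie_eq_zero_of_sq h.lie_N_N (s := -(1 / 4)) (by norm_num) h.stable_x
    fun u hu => Subtype.ext_iff.mp (hq.xx ⟨u, hu⟩)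
  obtain ⟨mu, hmu, v, hv, hM⟩ := hq.exists_eq_smul h.finrank_eq htr h.adM_adX h.adM_adY h.adM_adZ
  have hsys := h.isSpanningSystem hab (a := x) (b := y) (c := z) (fun S ha hb hc => ⟨ha, hb, hc⟩)
    (hq.exists_combination h.finrank_eq hv)
  have hso : SoBrackets x y z d :=
    ⟨by rw [h.triple.1, one_smul], by rw [← lie_skew, h.triple.2.2], h.triple.2.1, h.comm_x,
      h.comm_y, h.comm_z⟩
  have m1 : h.adM (h.adX v) = (mu / 4) • v := by
    rw [h.adM_adX, hM, map_neg, map_smul, hq.xx]; module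
  have m2 : h.adM (h.adY v) = (mu / 2) • h.adZ v := by
    rw [h.adM_adY, hM, map_neg, map_smul, hq.yx]; module
  have m3 : h.adM (h.adZ v) = -((mu / 2) • h.adY v) := by
    rw [h.adM_adZ, hM, map_neg, map_smul, hq.zx]; module
  refine hsys.hasNormalForm_five hdim hso rfl ?_ ?_ ?_ rfl ?_ ?_ ?_ rfl ?_ ?_ ?_ hmu ?_ ?_ ?_ ?_
  · exact Subtype.ext_iff.mp (hq.xx v)
  · exact Subtype.ext_iff.mp (hq.xy v)
  · exact Subtype.ext_iff.mp (hq.xz v)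
  · exact Subtype.ext_iff.mp (hq.yx v)
  · exact Subtype.ext_iff.mp (hq.yy v)
  · exact Subtype.ext_iff.mp (hq.yz v)
  · exact Subtype.ext_iff.mp (hq.zx v)
  · exact Subtype.ext_iff.mp (hq.zy v)
  · exact Subtype.ext_iff.mp (hq.zz v)
  · exact (h.lie_d v).trans (by rw [hM, sub_eq_add_neg]; rfl)
  · exact (h.lie_d (h.adX v)).trans (by rw [m1]; rfl)
  · exact (h.lie_d (h.adY v)).trans (by rw [m2]; rfl)
  · exact (h.lie_d (h.adZ v)).trans (by rw [m3, sub_eq_add_neg]; rfl)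

end IsReducedDecomposition
end Conclusion
end FrobeniusEight

/-! ### The split case: irreducible modules and sums of two standard modules -/

namespace FrobeniusEight
open Module LieAlgebra
attribute [local instance 100] LieRing.ofAssociativeRing

namespace IsSlTwoModule
variable {V : Type*} [AddCommGroup V] [Module ℝ V] {e f h : Module.End ℝ V}

/-- The table of an involutive `𝔰𝔩₂`-module on vectors of weight one. -/
theorem table_of_involutive (H : IsSlTwoModule e f h) (hsq : ∀ v, h (h v) = v) {p : V}
    (hp : h p = p) : e p = 0 ∧ e (f p) = p ∧ f (f p) = 0 ∧ h (f p) = -f p := by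
  have h1 : e p = 0 := by
    have h2 := H.lie_h_e p
    have h3 := hsq (e p)
    rw [h2, map_add, map_smul, h2, hp, h2, hp] at h3
    have h4 : (8 : ℝ) • e p = 0 := by linear_combination (norm := module) h3
    exact (smul_eq_zero.mp h4).resolve_left (by norm_num)
  have h2 : h (f p) = -f p := by rw [H.lie_h_f, hp]; module
  refine ⟨h1, by rw [H.lie_e_f, h1, map_zero, zero_add, hp], ?_, h2⟩
  have h3 := hsq (f (f p))
  rw [H.lie_h_f, h2, map_neg, map_sub, map_neg, map_smul, H.lie_h_f, h2, map_neg] at h3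
  have h4 : (8 : ℝ) • f (f p) = 0 := by linear_combination (norm := module) h3
  exact (smul_eq_zero.mp h4).resolve_left (by norm_num)

theorem f_e_of_involutive (H : IsSlTwoModule e f h) (hsq : ∀ v, h (h v) = v) {p : V}
    (hp : h p = -p) : f (e p) = p ∧ h (e p) = e p := by
  have hneg : ∀ v, (-h) ((-h) v) = v := fun v => by simp [hsq]
  obtain ⟨-, h1, -, h2⟩ := H.symm.table_of_involutive hneg (p := p) (by simp [hp])
  refine ⟨h1, ?_⟩
  rw [LinearMap.neg_apply] at h2
  exact neg_injective h2

/-- `f` maps the weight-one space `W` isomorphically onto the space of weight `-1`, with inverse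
`e`, so the module is `W ⊕ f W`. -/
theorem finrank_weight_one [FiniteDimensional ℝ V] (H : IsSlTwoModule e f h)
    (hsq : ∀ v, h (h v) = v) (hV : finrank ℝ V = 4) :
    finrank ℝ (LinearMap.ker (h - LinearMap.id)) = 2 := by
  set W := LinearMap.ker (h - LinearMap.id)
  have hW : ∀ v, v ∈ W ↔ h v = v := fun v => by
    rw [LinearMap.mem_ker, LinearMap.sub_apply, sub_eq_zero]; rfl
  let Ψ : (W × W) →ₗ[ℝ] V := W.subtype.coprod (f ∘ₗ W.subtype)
  have hΨ : ∀ p q : W, Ψ (p, q) = (p : V) + f q := fun p q => by simp [Ψ]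
  have hbij : Function.Bijective Ψ := by
    constructor
    · rw [← LinearMap.ker_eq_bot, LinearMap.ker_eq_bot']
      rintro ⟨⟨p, hp⟩, ⟨q, hq⟩⟩ h0
      rw [hΨ] at h0
      obtain ⟨-, e1, -, e2⟩ := H.table_of_involutive hsq ((hW q).mp hq)
      have h1 := congrArg h h0
      simp only [map_add, map_zero, (hW p).mp hp, e2] at h0 h1
      have hp0 : p = 0 := by
        have h3 : (2 : ℝ) • p = 0 := by linear_combination (norm := module) h0 + h1
        exact (smul_eq_zero.mp h3).resolve_left (by norm_num)
      have hq0 : q = 0 := by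
        rw [hp0, zero_add] at h0
        rw [← e1, h0, map_zero]
      subst hp0 hq0
      rfl
    · intro u
      have h1 : h ((1 / 2 : ℝ) • (u + h u)) = (1 / 2 : ℝ) • (u + h u) := by
        rw [map_smul, map_add, hsq, add_comm]
      obtain ⟨h2, h3⟩ := H.f_e_of_involutive hsq (p := (1 / 2 : ℝ) • (u - h u)) (by
        rw [map_smul, map_sub, hsq]; module)
      refine ⟨(⟨_, (hW _).mpr h1⟩, ⟨_, (hW _).mpr h3⟩), ?_⟩
      rw [hΨ]
      simp only [h2]
      module
  have := (LinearEquiv.ofBijective Ψ hbij).finrank_eq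
  rw [Module.finrank_prod, hV] at this
  omega

theorem exists_combination_of_involutive (H : IsSlTwoModule e f h) (hsq : ∀ v, h (h v) = v)
    {p q : V} (hpq : ∀ w, h w = w → ∃ a b : ℝ, w = a • p + b • q) (u : V) :
    ∃ c : Fin 4 → ℝ, u = ∑ i, c i • (![p, q, f p, f q] i) := by
  obtain ⟨a, b, hab⟩ := hpq ((1 / 2 : ℝ) • (u + h u)) (by rw [map_smul, map_add, hsq, add_comm])
  obtain ⟨h2, h3⟩ := H.f_e_of_involutive hsq (p := (1 / 2 : ℝ) • (u - h u)) (by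
    rw [map_smul, map_sub, hsq]; module)
  obtain ⟨a', b', hab'⟩ := hpq _ h3
  refine ⟨![a, b, a', b'], ?_⟩
  rw [Fin.sum_univ_four]
  simp only [Matrix.cons_val]
  have h4 := congrArg f hab'
  rw [h2, map_add, map_smul, map_smul] at h4
  linear_combination (norm := module) hab + h4

end IsSlTwoModule

section Conclusion
variable {L : Type*} [LieRing L] [LieAlgebra ℝ L] {N : Submodule ℝ L}
variable {x y z d : L}

namespace IsReducedDecomposition

/-- The raising operator. -/
def adE (h : IsReducedDecomposition (-1) x y z d N) : Module.End ℝ N := h.adY - h.adZ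

/-- The lowering operator. -/
def adF (h : IsReducedDecomposition (-1) x y z d N) : Module.End ℝ N := h.adY + h.adZ

/-- The weight operator. -/
def adH (h : IsReducedDecomposition (-1) x y z d N) : Module.End ℝ N := (2 : ℝ) • h.adX

theorem isSlTwoModule (h : IsReducedDecomposition (-1) x y z d N) :
    IsSlTwoModule h.adE h.adF h.adH := h.isTriple.isSlTwoModule h.casimir_eq_zero

theorem coe_adE (h : IsReducedDecomposition (-1) x y z d N) (u : N) :
    (h.adE u : L) = ⁅y - z, (u : L)⁆ := by rw [sub_lie]; rfl

theorem coe_adF (h : IsReducedDecomposition (-1) x y z d N) (u : N) :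
    (h.adF u : L) = ⁅y + z, (u : L)⁆ := by rw [add_lie]; rfl

theorem coe_adH (h : IsReducedDecomposition (-1) x y z d N) (u : N) :
    (h.adH u : L) = ⁅(2 : ℝ) • x, (u : L)⁆ := by rw [smul_lie]; rfl

theorem adM_adF (h : IsReducedDecomposition (-1) x y z d N) (u : N) :
    h.adM (h.adF u) = h.adF (h.adM u) := by
  simp only [adF, LinearMap.add_apply, map_add, adM_adY, adM_adZ]

theorem adM_adH (h : IsReducedDecomposition (-1) x y z d N) (u : N) :
    h.adM (h.adH u) = h.adH (h.adM u) := by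
  simp only [adH, LinearMap.smul_apply, map_smul, adM_adX]

theorem slBrackets (h : IsReducedDecomposition (-1) x y z d N) :
    SlBrackets (y - z) (y + z) ((2 : ℝ) • x) d := by
  obtain ⟨h1, h2, h3⟩ := h.triple
  have h1' : ⁅y, x⁆ = z := by rw [← lie_skew, h1]; module
  have h3' : ⁅x, z⁆ = -y := by rw [← lie_skew, h3]
  have h2' : ⁅z, y⁆ = -x := by rw [← lie_skew, h2]
  refine ⟨?_, ?_, ?_, ?_, ?_, ?_⟩ <;>
    simp only [lie_add, add_lie, sub_lie, lie_smul, smul_lie, lie_self, h1', h2, h2', h3,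
      h.comm_x, h.comm_y, h.comm_z] <;> module

theorem isSpanningSystem_sl (h : IsReducedDecomposition (-1) x y z d N)
    (hab : ∀ u ∈ N, ∀ v ∈ N, ⁅u, v⁆ = 0) {v : Fin 4 → N}
    (hv : ∀ w, ∃ c : Fin 4 → ℝ, w = ∑ i, c i • v i) :
    IsSpanningSystem (y - z) (y + z) ((2 : ℝ) • x) d (fun i => (v i : L)) := by
  refine h.isSpanningSystem hab (fun S ha hb hc => ⟨?_, ?_, ?_⟩) hv
  · have : x = (1 / 2 : ℝ) • ((2 : ℝ) • x) := by module
    rw [this]; exact S.smul_mem _ hc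
  · have : y = (1 / 2 : ℝ) • ((y - z) + (y + z)) := by module
    rw [this]; exact S.smul_mem _ (S.add_mem ha hb)
  · have : z = (1 / 2 : ℝ) • ((y + z) - (y - z)) := by module
    rw [this]; exact S.smul_mem _ (S.sub_mem hb ha)

/-- `M` preserves the highest weight line, hence is a scalar on the module that it generates, and
the trace condition makes it zero. All weights are odd, so `N` is abelian. -/
theorem hasNormalForm_of_weight_three [FiniteDimensional ℝ L]
    (h : IsReducedDecomposition (-1) x y z d N)
    (hdim : finrank ℝ L = 8) (htr : LinearMap.trace ℝ N h.adM = 0) {v : N} (hv : v ≠ 0)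
    (he : h.adE v = 0) (hh : h.adH v = (3 : ℝ) • v) : HasNormalForm L := by
  have H := h.isSlTwoModule
  obtain ⟨w1, w2, w3⟩ := H.weights_of_weight_three hh
  obtain ⟨r1, r2, r3⟩ := H.raising_of_weight_three he hh
  have hcomb := H.exists_combination h.finrank_eq he hh hv
  have hf4 := H.f_pow_four h.finrank_eq v
  have hM0 : ∀ u, h.adM u = 0 := by
    obtain ⟨α, β, γ, δ, hM⟩ := hcomb (h.adM v)
    have hMv : h.adM v = α • v := by
      -- `(t + 3) (t² - 1)` vanishes at the weights 1, -1, -3 and equals 48 at 3.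
      have p1 : ∀ u, h.adH u = (3 : ℝ) • u →
          h.adH (h.adH (h.adH u)) + (3 : ℝ) • h.adH (h.adH u) - h.adH u - (3 : ℝ) • u =
            (48 : ℝ) • u := by
        intro u hu
        simp only [hu, map_smul]
        module
      have p2 := p1 (h.adM v) (by rw [← h.adM_adH, hh, map_smul])
      rw [hM] at p2 ⊢
      simp only [map_add, map_smul, hh, w1, w2, w3] at p2
      linear_combination (norm := module) (-1 / 48 : ℝ) • p2
    refine eq_zero_of_trace_eq_zero h.finrank_eq htr (c := α) fun u => ?_
    obtain ⟨p, q, r, s, rfl⟩ := hcomb u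
    simp only [map_add, map_smul, h.adM_adF, hMv]
    module
  let V : Fin 4 → N := ![v, h.adF v, h.adF (h.adF v), h.adF (h.adF (h.adF v))]
  have hV : ∀ w, ∃ c : Fin 4 → ℝ, w = ∑ i, c i • V i := by
    intro w
    obtain ⟨p, q, r, s, rfl⟩ := hcomb w
    exact ⟨![p, q, r, s], by simp [V, Fin.sum_univ_four]⟩
  have hwt : ∀ i, ∃ m : ℤ, h.adH (V i) = ((2 * m + 1 : ℤ) : ℝ) • V i := by
    intro i
    fin_cases i
    · exact ⟨1, hh.trans (by norm_num [V])⟩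
    · exact ⟨0, w1.trans (by norm_num [V])⟩
    · exact ⟨-1, w2.trans (by norm_num [V])⟩
    · exact ⟨-2, w3.trans (by norm_num [V])⟩
  have hpoly : ∀ u ∈ N, ⁅(2 : ℝ) • x, ⁅(2 : ℝ) • x, ⁅(2 : ℝ) • x, ⁅(2 : ℝ) • x, u⁆⁆⁆⁆ -
      (10 : ℝ) • ⁅(2 : ℝ) • x, ⁅(2 : ℝ) • x, u⁆⁆ + (9 : ℝ) • u = 0 := by
    intro u hu
    have hN : h.adH (h.adH (h.adH (h.adH ⟨u, hu⟩))) - (10 : ℝ) • h.adH (h.adH ⟨u, hu⟩) +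
        (9 : ℝ) • (⟨u, hu⟩ : N) = 0 := by
      obtain ⟨p, q, r, s, hpqrs⟩ := hcomb ⟨u, hu⟩
      rw [hpqrs]
      simp only [map_add, map_smul, hh, w1, w2, w3]
      module
    have := Subtype.ext_iff.mp hN
    simpa [h.coe_adH] using this
  have hVV : ∀ i j, ⁅(V i : L), (V j : L)⁆ = 0 := by
    intro i j
    obtain ⟨m, hm⟩ := hwt i
    obtain ⟨n, hn⟩ := hwt j
    refine lie_eq_zero_of_odd_weights h.lie_N_N hpoly (V i).2 (V j).2 (m := m) (n := n) ?_ ?_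
    · rw [← h.coe_adH, hm]; rfl
    · rw [← h.coe_adH, hn]; rfl
  have hab : ∀ u ∈ N, ∀ w ∈ N, ⁅u, w⁆ = 0 := by
    intro u hu w hw
    obtain ⟨k, hk⟩ := hV ⟨u, hu⟩
    obtain ⟨l, hl⟩ := hV ⟨w, hw⟩
    have hu' : u = ∑ i, k i • (V i : L) := by
      simpa only [map_sum, map_smul, Submodule.subtype_apply] using congrArg N.subtype hk
    have hw' : w = ∑ i, l i • (V i : L) := by
      simpa only [map_sum, map_smul, Submodule.subtype_apply] using congrArg N.subtype hl
    rw [hu', hw', sum_lie]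
    refine Finset.sum_eq_zero fun i _ => ?_
    rw [lie_sum]
    refine Finset.sum_eq_zero fun j _ => ?_
    rw [smul_lie, lie_smul, hVV, smul_zero, smul_zero]
  have hd : ∀ u : N, ⁅d, (u : L)⁆ = -u := fun u => by rw [h.lie_d, hM0]; simp
  refine (h.isSpanningSystem_sl hab hV).hasNormalForm_three hdim h.slBrackets ?_ ?_ ?_ ?_ ?_ ?_ ?_
    ?_ ?_ ?_ ?_ ?_ fun i => hd (V i)
  · exact (h.coe_adE _).symm.trans (Subtype.ext_iff.mp he)
  · exact (h.coe_adE _).symm.trans (Subtype.ext_iff.mp r1)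
  · exact (h.coe_adE _).symm.trans (Subtype.ext_iff.mp r2)
  · exact (h.coe_adE _).symm.trans (Subtype.ext_iff.mp r3)
  · exact (h.coe_adF _).symm
  · exact (h.coe_adF _).symm
  · exact (h.coe_adF _).symm
  · exact (h.coe_adF _).symm.trans (Subtype.ext_iff.mp hf4)
  · exact (h.coe_adH _).symm.trans (Subtype.ext_iff.mp hh)
  · exact (h.coe_adH _).symm.trans (Subtype.ext_iff.mp w1)
  · exact (h.coe_adH _).symm.trans (Subtype.ext_iff.mp w2)
  · exact (h.coe_adH _).symm.trans (Subtype.ext_iff.mp w3)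

theorem isDoubleStandard (h : IsReducedDecomposition (-1) x y z d N)
    (hsq : ∀ v, h.adH (h.adH v) = v) {p q : N} (hp : h.adH p = p) (hq : h.adH q = q) :
    IsDoubleStandard (y - z) (y + z) ((2 : ℝ) • x)
      (fun i => ((![p, q, h.adF p, h.adF q] i : N) : L)) := by
  obtain ⟨p1, p2, p3, p4⟩ := h.isSlTwoModule.table_of_involutive hsq hp
  obtain ⟨q1, q2, q3, q4⟩ := h.isSlTwoModule.table_of_involutive hsq hq
  exact
    { a0 := (h.coe_adE _).symm.trans (Subtype.ext_iff.mp p1)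
      a1 := (h.coe_adE _).symm.trans (Subtype.ext_iff.mp q1)
      a2 := (h.coe_adE _).symm.trans (Subtype.ext_iff.mp p2)
      a3 := (h.coe_adE _).symm.trans (Subtype.ext_iff.mp q2)
      b0 := (h.coe_adF _).symm
      b1 := (h.coe_adF _).symm
      b2 := (h.coe_adF _).symm.trans (Subtype.ext_iff.mp p3)
      b3 := (h.coe_adF _).symm.trans (Subtype.ext_iff.mp q3)
      c0 := (h.coe_adH _).symm.trans (Subtype.ext_iff.mp hp)
      c1 := (h.coe_adH _).symm.trans (Subtype.ext_iff.mp hq)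
      c2 := (h.coe_adH _).symm.trans (Subtype.ext_iff.mp p4)
      c3 := (h.coe_adH _).symm.trans (Subtype.ext_iff.mp q4) }

/-- `M` is determined by its restriction to the weight-one plane `W`. If this has a cyclic vector
`p`, the trace condition gives `M² = nu` on `p`, and the sign of `nu` decides the family. Otherwise
it is a scalar, hence zero, and family two applies with parameter zero. -/
theorem hasNormalForm_of_involutive [FiniteDimensional ℝ L]
    (h : IsReducedDecomposition (-1) x y z d N)
    (hdim : finrank ℝ L = 8) (htr : LinearMap.trace ℝ N h.adM = 0)
    (hsq : ∀ v, h.adH (h.adH v) = v) : HasNormalForm L := by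
  have H := h.isSlTwoModule
  have hab := lie_eq_zero_of_sq h.lie_N_N (a := (2 : ℝ) • x) (s := 1) one_ne_zero
    (fun u hu => by rw [smul_lie]; exact N.smul_mem _ (h.stable_x u hu))
    (fun u hu => by
      rw [one_smul]
      have := Subtype.ext_iff.mp (hsq ⟨u, hu⟩)
      rwa [h.coe_adH, h.coe_adH] at this)
  set W := LinearMap.ker (h.adH - LinearMap.id)
  have hW : ∀ v, v ∈ W ↔ h.adH v = v := fun v => by
    rw [LinearMap.mem_ker, LinearMap.sub_apply, sub_eq_zero]; rfl
  have hWdim : finrank ℝ W = 2 := H.finrank_weight_one hsq h.finrank_eq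
  have hspan : ∀ {p q : W}, LinearIndependent ℝ ![p, q] →
      ∀ w, h.adH w = w → ∃ a b : ℝ, w = a • (p : N) + b • (q : N) := by
    intro p q hli w hw
    have htop := hli.span_eq_top_of_card_eq_finrank (by simpa using hWdim.symm)
    rw [Matrix.range_cons, Matrix.range_cons, Matrix.range_empty, Set.union_empty,
      Set.singleton_union] at htop
    have hmem : (⟨w, (hW w).mpr hw⟩ : W) ∈ Submodule.span ℝ {p, q} := by rw [htop]; trivial
    obtain ⟨a, b, hab⟩ := Submodule.mem_span_pair.mp hmem
    exact ⟨a, b, (Subtype.ext_iff.mp hab).symm⟩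
  have two : ∀ {p q : N} {lam : ℝ}, 0 ≤ lam → h.adH p = p → h.adH q = q →
      (∀ w, h.adH w = w → ∃ a b : ℝ, w = a • p + b • q) → h.adM p = -(lam • p) →
      h.adM q = lam • q → HasNormalForm L := by
    intro p q lam hlam hp hq hpq hMp hMq
    refine (h.isSpanningSystem_sl hab (H.exists_combination_of_involutive hsq
      hpq)).hasNormalForm_two hdim h.slBrackets (h.isDoubleStandard hsq hp hq) hlam ?_ ?_ ?_ ?_
    · exact (h.lie_d p).trans (by rw [hMp, sub_eq_add_neg]; rfl)
    · exact (h.lie_d q).trans (by rw [hMq]; rfl)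
    · exact (h.lie_d (h.adF p)).trans (by
        rw [h.adM_adF, hMp, map_neg, map_smul, sub_eq_add_neg]; rfl)
    · exact (h.lie_d (h.adF q)).trans (by rw [h.adM_adF, hMq, map_smul]; rfl)
  have hMW : ∀ w ∈ W, h.adM w ∈ W := fun w hw => by
    rw [hW] at hw ⊢
    rw [← h.adM_adH, hw]
  let MW : Module.End ℝ W := h.adM.restrict hMW
  by_cases hcase : ∃ w, LinearIndependent ℝ ![w, MW w]
  · obtain ⟨⟨p, hpW⟩, hli⟩ := hcase
    have hp := (hW p).mp hpW
    have hq := (hW _).mp (hMW p hpW)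
    have hpq : ∀ w, h.adH w = w → ∃ a b : ℝ, w = a • p + b • h.adM p := hspan hli
    obtain ⟨nu, tau, hMM⟩ := hpq _ ((hW _).mp (hMW _ (hMW p hpW)))
    have hcomb := H.exists_combination_of_involutive hsq hpq
    have h0 := trace_eq_of_spanning h.finrank_eq hcomb (M := h.adM)
      (m := ![![0, 1, 0, 0], ![nu, tau, 0, 0], ![0, 0, 0, 1], ![0, 0, nu, tau]]) (by
      intro i
      rw [Fin.sum_univ_four]
      fin_cases i
      · simp
      · simpa using hMM
      · simp [h.adM_adF]
      · simp [h.adM_adF, hMM])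
    rw [htr, Fin.sum_univ_four] at h0
    simp only [Matrix.cons_val] at h0
    have h0 : tau = 0 := by linarith
    rw [h0, zero_smul, add_zero] at hMM
    rcases le_or_gt nu 0 with hnu | hnu
    · refine (h.isSpanningSystem_sl hab hcomb).hasNormalForm_four
        hdim h.slBrackets (h.isDoubleStandard hsq hp hq) hnu ?_ ?_ ?_ ?_
      · exact h.lie_d p
      · exact (h.lie_d (h.adM p)).trans (by rw [hMM]; rfl)
      · exact (h.lie_d (h.adF p)).trans (by rw [h.adM_adF]; rfl)
      · exact (h.lie_d (h.adF (h.adM p))).trans (by rw [h.adM_adF, hMM, map_smul]; rfl)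
    · set lam := Real.sqrt nu
      have hlam : 0 < lam := Real.sqrt_pos.mpr hnu
      have hlam2 : lam * lam = nu := Real.mul_self_sqrt hnu.le
      rw [← hlam2] at hMM
      -- With `M² = lam²` on `p`, these vectors are eigenvectors of `M` for `-lam` and `lam`.
      refine two (p := h.adM p - lam • p) (q := h.adM p + lam • p) hlam.le ?_ ?_ ?_ ?_ ?_
      · rw [map_sub, map_smul, hp, hq]
      · rw [map_add, map_smul, hp, hq]
      · intro w hw
        obtain ⟨a, b, rfl⟩ := hpq w hw
        refine ⟨b / 2 - a / (2 * lam), b / 2 + a / (2 * lam), ?_⟩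
        match_scalars
        · field_simp
          ring
        · ring
      · rw [map_sub, map_smul, hMM]; module
      · rw [map_add, map_smul, hMM]; module
  · push Not at hcase
    obtain ⟨c, hc⟩ := LinearMap.exists_eq_smul_id_of_forall_notLinearIndependent hcase
    have hcW : ∀ w, h.adH w = w → h.adM w = c • w := fun w hw =>
      Subtype.ext_iff.mp (LinearMap.congr_fun hc ⟨w, (hW w).mpr hw⟩)
    let B : Basis (Fin 2) ℝ W := Module.finBasisOfFinrankEq ℝ W hWdim
    have hB : LinearIndependent ℝ ![B 0, B 1] := by
      convert B.linearIndependent using 1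
      ext i
      fin_cases i <;> rfl
    have hp := (hW _).mp (B 0).2
    have hq := (hW _).mp (B 1).2
    have hM0 : ∀ u, h.adM u = 0 := by
      refine eq_zero_of_trace_eq_zero h.finrank_eq htr (c := c) fun u => ?_
      obtain ⟨k, rfl⟩ := H.exists_combination_of_involutive hsq (hspan hB) u
      rw [Fin.sum_univ_four]
      simp only [Matrix.cons_val, map_add, map_smul, h.adM_adF, hcW _ hp, hcW _ hq]
      module
    exact two le_rfl hp hq (hspan hB) (by rw [hM0]; simp) (by rw [hM0]; simp)

theorem hasNormalForm [FiniteDimensional ℝ L] {ε : ℝ} (h : IsReducedDecomposition ε x y z d N)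
    (hdim : finrank ℝ L = 8) :
    HasNormalForm L := by
  obtain ⟨d', h', htr⟩ := h.exists_trace_adM_eq_zero
  rcases h.sign with rfl | rfl
  · exact h'.hasNormalForm_of_compact hdim htr
  · by_cases h3 : ∀ v, h'.adE v = 0 → h'.adH v = (3 : ℝ) • v → v = 0
    · exact h'.hasNormalForm_of_involutive hdim htr (h'.isSlTwoModule.h_h_eq h'.finrank_eq h3)
    · push Not at h3
      obtain ⟨v, he, hh, hv⟩ := h3
      exact h'.hasNormalForm_of_weight_three hdim htr hv he hh

end IsReducedDecomposition
end Conclusion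
end FrobeniusEight

theorem proposition4p1 {L : Type*} [LieRing L] [LieAlgebra ℝ L]
    (hdim : Module.finrank ℝ L = 8)
    (hFrob : FrobeniusEight.IsFrobenius L)
    (hindec : FrobeniusEight.IsIndecomposable L)
    (hsolv : ¬ LieAlgebra.IsSolvable L) :
    ∃ f : Module.Basis (Fin 8) ℝ L,
      FrobeniusEight.IsSymplecticForm (FrobeniusEight.omegaZero f) ∧
      FrobeniusEight.IsExactForm (FrobeniusEight.omegaZero f) ∧
      ∃ F : FrobeniusEight.Family, F.Admissible ∧
        F.HasBrackets f ∧
        FrobeniusEight.IsLeftSymmetric F.product ∧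
        FrobeniusEight.IsLagrangianExtension f F.product 0 := by
  have : FiniteDimensional ℝ L := Module.finite_of_finrank_pos (by omega)
  obtain ⟨β, hβ⟩ := hFrob.exists_isRegularForm
  have hq := FrobeniusEight.finrank_quotient_radical hdim hFrob hindec hsolv
  obtain ⟨ε, x, y, z, T, N, h⟩ := FrobeniusEight.exists_isLeviDecomposition hdim hq
  obtain ⟨d, h'⟩ := h.exists_isReducedDecomposition hdim hβ hindec
  exact h'.hasNormalForm hdim
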